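/- **Theorem (Lagrangian coisotropic embedding).** Let $Q$ be a finite-dimensional smooth manifold without boundary, $\pi:TQ\to Q$ its tangent bundle with vertical endomorphism $S$ and Liouville field $\Delta$. For a smooth function $L$ on the tangent bundle of a manifold put $\theta_L=S^*(dL)$, $\omega_L=-d\theta_L$, $E_L=\Delta(L)-L$. Let $L:TQ\to\mathbb R$ be a smooth Lagrangian which is singular ($\omega_L$ is degenerate) and consistent ($\ker\omega_L\subseteq\ker dE_L$ at every point). Let $\underset{\sim}{K}\subset TQ$ be a regular (smooth, constant rank $r$) distribution, and suppose that the characteristic distribution $K=\ker\omega_L\subset T(TQ)$ is regular of rank $2r$ and is the complete lift of $\underset{\sim}{K}$, i.e. is spanned by the complete lifts $X^C$ and the vertical lifts $X^V$ of the local sections $X$ of $\underset{\sim}{K}$. (Then $\underset{\sim}{K}$ is automatically integrable, because $\omega_L$ is closed.) Let $\widetilde Q=\underset{\sim}{K}^{*}$ be the total space of the dual vector bundle, $p:\widetilde Q\to Q$ its projection and $0:Q\to\widetilde Q$ its zero section. Let $\nabla$ be an Ehresmann connection on $p$, i.e. a smooth distribution $\mathcal H$ on $\widetilde Q$ with $T\widetilde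 Q=\mathcal V\oplus\mathcal H$, $\mathcal V=\ker Tp$, such that along the zero section $\mathcal H_{0(q)}=T_q0\,(T_qQ)$; let $p_{\mathcal V}(\xi)\in\underset{\sim}{K}^*_{q}$ denote the vertical part of $\xi\in T\widetilde Q$, under the identification of the vertical vectors over $q$ with the fibre. Let $P$ be an almost product structure complementing $\underset{\sim}{K}$, i.e. a smooth $(1,1)$-tensor field on $Q$ with $P^2=P$ and $\operatorname{Im}P=\underset{\sim}{K}$. Define $$F^{P,\nabla}(\xi)=\big\langle P(Tp\,\xi),\,p_{\mathcal V}(\xi)\big\rangle,\qquad \widetilde L=L\circ Tp+F^{P,\nabla}\qquad\text{on } T\widetilde Q .$$ Then: 1. $\widetilde L$ is a globally defined smooth function on $T\widetilde Q=T(\underset{\sim}{K}^*)$, and $\widetilde L\circ T0=L$. 2. There is a diffeomorphism $\alpha:T\widetilde Q\to K^*$ onto the total space of the dual bundle $\tau:K^*\to TQ$ of $K$ (the thickening), namely the foliated Tulczyjew isomorphism: $\tau\circ\alpha=Tp$, and for smooth curves $c(t)$ in $\underset{\sim}{K}^*$ and $y(t)$ in $\underset{\sim}{K}$ over the same curve in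 $Q$ one has $\delta(\dot y(0))\in K$ and $\langle\alpha(\dot c(0)),\delta(\dot y(0))\rangle=\frac{d}{dt}\big|_{t=0}\langle c(t),y(t)\rangle$, where $\delta$ is the canonical involution of $T(TQ)$. Moreover $\alpha\circ T0$ is the zero section $TQ\hookrightarrow K^*$. 3. $T0:TQ\hookrightarrow T\widetilde Q$ is a coisotropic embedding on a neighbourhood of $TQ$: $T0$ is a smooth embedding with closed image; $\omega_{\widetilde L}$ is symplectic (smooth, closed, nondegenerate) on some open neighbourhood of $T0(TQ)$; $(T0)^*\omega_{\widetilde L}=\omega_L$; and at every point of $T0(TQ)$ the $\omega_{\widetilde L}$-orthogonal of the tangent space of $T0(TQ)$ is contained in that tangent space. -/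

import Mathlib

open Bundle Set Topology
open scoped Manifold ContDiff

noncomputable section

/-! ### Regular distributions and their dual bundles -/

section Distribution

variable {E : Type*} [NormedAddCommGroup E] [NormedSpace ℝ E]
  {H : Type*} [TopologicalSpace H]

/-- A regular (smooth, constant rank `r`) distribution on the manifold `M`: a family of subspaces
of the tangent spaces which is locally spanned by `r` pointwise independent smooth vector
fields. -/
structure RegularDistribution (I : ModelWithCorners ℝ E H) (M : Type*) [TopologicalSpace M]
    [ChartedSpace H M] [IsManifold I ∞ M] (r : ℕ) where
  /-- the subspace of the tangent space at `x` -/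
  space : ∀ x : M, Submodule ℝ (TangentSpace I x)
  exists_frame : ∀ x₀ : M, ∃ U : Set M, IsOpen U ∧ x₀ ∈ U ∧
    ∃ s : Fin r → ∀ x : M, TangentSpace I x,
      (∀ i, ContMDiffOn I I.tangent ∞ (fun x => (⟨x, s i x⟩ : TangentBundle I M)) U) ∧
      ∀ x ∈ U, LinearIndependent ℝ (fun i => s i x) ∧
        Submodule.span ℝ (range fun i => s i x) = space x

namespace RegularDistribution

variable {I : ModelWithCorners ℝ E H} {M : Type*} [TopologicalSpace M]
    [ChartedSpace H M] [IsManifold I ∞ M] {r : ℕ} (D : RegularDistribution I M r)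

/-- The fibre at `x` of the dual vector bundle of a distribution. -/
def Dual (x : M) : Type _ := D.space x →L[ℝ] ℝ

instance (x : M) : TopologicalSpace (D.Dual x) :=
  inferInstanceAs (TopologicalSpace (D.space x →L[ℝ] ℝ))
instance (x : M) : AddCommGroup (D.Dual x) :=
  inferInstanceAs (AddCommGroup (D.space x →L[ℝ] ℝ))
instance (x : M) : Module ℝ (D.Dual x) :=
  inferInstanceAs (Module ℝ (D.space x →L[ℝ] ℝ))
instance (x : M) : IsTopologicalAddGroup (D.Dual x) :=
  inferInstanceAs (IsTopologicalAddGroup (D.space x →L[ℝ] ℝ))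
instance (x : M) : ContinuousSMul ℝ (D.Dual x) :=
  inferInstanceAs (ContinuousSMul ℝ (D.space x →L[ℝ] ℝ))

/-- The natural pairing between the dual of a distribution and the distribution. -/
def pair {x : M} (μ : D.Dual x) : D.space x →L[ℝ] ℝ := μ

/-- The domain of a chosen local frame of `D` around `x₀`. -/
def frameSet (x₀ : M) : Set M := (D.exists_frame x₀).choose

/-- A chosen local frame of `D` around `x₀`. -/
def frame (x₀ : M) (i : Fin r) (x : M) : TangentSpace I x :=
  (D.exists_frame x₀).choose_spec.2.2.choose i x

lemma isOpen_frameSet (x₀ : M) : IsOpen (D.frameSet x₀) := (D.exists_frame x₀).choose_spec.1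

lemma mem_frameSet (x₀ : M) : x₀ ∈ D.frameSet x₀ := (D.exists_frame x₀).choose_spec.2.1

lemma contMDiffOn_frame (x₀ : M) (i : Fin r) :
    ContMDiffOn I I.tangent ∞ (fun x => (⟨x, D.frame x₀ i x⟩ : TangentBundle I M))
      (D.frameSet x₀) :=
  (D.exists_frame x₀).choose_spec.2.2.choose_spec.1 i

lemma linearIndependent_frame (x₀ : M) {x : M} (hx : x ∈ D.frameSet x₀) :
    LinearIndependent ℝ (fun i => D.frame x₀ i x) :=
  ((D.exists_frame x₀).choose_spec.2.2.choose_spec.2 x hx).1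

lemma span_frame (x₀ : M) {x : M} (hx : x ∈ D.frameSet x₀) :
    Submodule.span ℝ (range fun i => D.frame x₀ i x) = D.space x :=
  ((D.exists_frame x₀).choose_spec.2.2.choose_spec.2 x hx).2

/-- The basis of `D.space x` given by the chosen local frame. -/
def frameBasis (x₀ : M) {x : M} (hx : x ∈ D.frameSet x₀) : Module.Basis (Fin r) ℝ (D.space x) :=
  (Module.Basis.span (D.linearIndependent_frame x₀ hx)).map
    (LinearEquiv.ofEq _ _ (D.span_frame x₀ hx))

lemma coe_frameBasis (x₀ : M) {x : M} (hx : x ∈ D.frameSet x₀) (i : Fin r) :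
    (D.frameBasis x₀ hx i : TangentSpace I x) = D.frame x₀ i x := by
  simp [frameBasis, Module.Basis.span_apply]

instance (x : M) : T2Space (TangentSpace I x) := inferInstanceAs (T2Space E)

lemma finiteDimensional_space (x : M) : FiniteDimensional ℝ (D.space x) :=
  Module.Basis.finiteDimensional_of_finite (D.frameBasis x (D.mem_frameSet x))

/-- Coordinates `μ ↦ (μ (s₁ x), …, μ (s_r x))` on the fibre of the dual bundle. -/
def dualCoord (x₀ : M) {x : M} (hx : x ∈ D.frameSet x₀) : D.Dual x ≃ₗ[ℝ] (Fin r → ℝ) :=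
  have := D.finiteDimensional_space x
  (((D.frameBasis x₀ hx).constr ℝ).trans
    (LinearMap.toContinuousLinearMap (E := D.space x) (F' := ℝ))).symm

lemma dualCoord_apply (x₀ : M) {x : M} (hx : x ∈ D.frameSet x₀) (μ : D.Dual x) (i : Fin r) :
    D.dualCoord x₀ hx μ i = D.pair μ (D.frameBasis x₀ hx i) := by
  rfl

open Classical in
/-- The pretrivialization of the dual bundle given by the chosen local frame. -/
def pretriv (x₀ : M) : Pretrivialization (Fin r → ℝ) (π (Fin r → ℝ) D.Dual) where
  toFun z := ⟨z.1, if h : z.1 ∈ D.frameSet x₀ then D.dualCoord x₀ h z.2 else 0⟩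
  invFun p := ⟨p.1, if h : p.1 ∈ D.frameSet x₀ then (D.dualCoord x₀ h).symm p.2 else 0⟩
  source := π (Fin r → ℝ) D.Dual ⁻¹' D.frameSet x₀
  target := D.frameSet x₀ ×ˢ univ
  map_source' z hz := ⟨hz, trivial⟩
  map_target' p hp := hp.1
  left_inv' := by
    rintro ⟨x, μ⟩ (hx : x ∈ D.frameSet x₀)
    simp [hx]
  right_inv' := by
    rintro ⟨x, y⟩ ⟨hx : x ∈ D.frameSet x₀, -⟩
    simp [hx]
  open_target := (D.isOpen_frameSet x₀).prod isOpen_univ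
  baseSet := D.frameSet x₀
  open_baseSet := D.isOpen_frameSet x₀
  source_eq := rfl
  target_eq := rfl
  proj_toFun z hz := rfl

lemma pretriv_apply (x₀ : M) {x : M} (hx : x ∈ D.frameSet x₀) (μ : D.Dual x) :
    (D.pretriv x₀ ⟨x, μ⟩).2 = D.dualCoord x₀ hx μ := by
  exact dif_pos hx

lemma pretriv_symm (x₀ : M) {x : M} (hx : x ∈ D.frameSet x₀) (y : Fin r → ℝ) :
    (D.pretriv x₀).symm x y = (D.dualCoord x₀ hx).symm y := by
  apply (D.dualCoord x₀ hx).injective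
  rw [← D.pretriv_apply x₀ hx, LinearEquiv.apply_symm_apply]
  have := (D.pretriv x₀).apply_mk_symm (b := x) hx y
  rw [this]

open Classical in
/-- The coefficients of one chosen frame in another one. -/
def frameCoeff (x₀ x₁ : M) (i j : Fin r) (x : M) : ℝ :=
  if h : x ∈ D.frameSet x₀ ∩ D.frameSet x₁ then
    (D.frameBasis x₀ h.1).repr (D.frameBasis x₁ h.2 j) i
  else 0

lemma sum_frameCoeff (x₀ x₁ : M) (j : Fin r) {x : M} (hx : x ∈ D.frameSet x₀ ∩ D.frameSet x₁) :
    ∑ i, D.frameCoeff x₀ x₁ i j x • D.frameBasis x₀ hx.1 i = D.frameBasis x₁ hx.2 j := by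
  simp only [frameCoeff, dif_pos hx]
  exact (D.frameBasis x₀ hx.1).sum_repr _

/-- The coordinate change of the dual bundle. -/
def dualChange (x₀ x₁ : M) (x : M) : (Fin r → ℝ) →L[ℝ] (Fin r → ℝ) :=
  ∑ i, ∑ j, D.frameCoeff x₀ x₁ i j x •
    (ContinuousLinearMap.proj (R := ℝ) (φ := fun _ : Fin r => ℝ) i).smulRight
      (Pi.single j 1 : Fin r → ℝ)

lemma dualChange_apply (x₀ x₁ : M) {x : M} (hx : x ∈ D.frameSet x₀ ∩ D.frameSet x₁)
    (y : Fin r → ℝ) :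
    D.dualChange x₀ x₁ x y = D.dualCoord x₁ hx.2 ((D.dualCoord x₀ hx.1).symm y) := by
  obtain ⟨μ, rfl⟩ := (D.dualCoord x₀ hx.1).surjective y
  rw [LinearEquiv.symm_apply_apply]
  funext k
  have h1 : D.dualCoord x₁ hx.2 μ k = ∑ i, D.frameCoeff x₀ x₁ i k x * D.dualCoord x₀ hx.1 μ i := by
    rw [dualCoord_apply, ← D.sum_frameCoeff x₀ x₁ k hx]
    simp only [map_sum, map_smul, smul_eq_mul, dualCoord_apply]
  rw [h1]
  simp [dualChange, Finset.sum_apply, Pi.single_apply]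

variable [FiniteDimensional ℝ E]

lemma contMDiffOn_frameCoeff (x₀ x₁ : M) (i j : Fin r) :
    ContMDiffOn I 𝓘(ℝ, ℝ) ∞ (D.frameCoeff x₀ x₁ i j) (D.frameSet x₀ ∩ D.frameSet x₁) := by
  intro p hp
  have hopen : D.frameSet x₀ ∩ D.frameSet x₁ ∈ 𝓝 p :=
    ((D.isOpen_frameSet x₀).inter (D.isOpen_frameSet x₁)).mem_nhds hp
  apply ContMDiffAt.contMDiffWithinAt
  let e := trivializationAt E (TangentSpace I : M → Type _) p
  have hepos : p ∈ e.baseSet := mem_baseSet_trivializationAt E (TangentSpace I : M → Type _) p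
  -- frames read in the trivialization
  let s₀ : Fin r → M → E := fun i x => (e ⟨x, D.frame x₀ i x⟩).2
  let s₁ : Fin r → M → E := fun i x => (e ⟨x, D.frame x₁ i x⟩).2
  have hs₀ : ∀ i, ContMDiffAt I 𝓘(ℝ, E) ∞ (s₀ i) p := fun i =>
    (contMDiffAt_section p).1 ((D.contMDiffOn_frame x₀ i).contMDiffAt
      ((D.isOpen_frameSet x₀).mem_nhds hp.1))
  have hs₁ : ∀ i, ContMDiffAt I 𝓘(ℝ, E) ∞ (s₁ i) p := fun i =>
    (contMDiffAt_section p).1 ((D.contMDiffOn_frame x₁ i).contMDiffAt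
      ((D.isOpen_frameSet x₁).mem_nhds hp.2))
  let S : M → (Fin r → ℝ) →L[ℝ] E := fun x =>
    ∑ i, (ContinuousLinearMap.proj (R := ℝ) (φ := fun _ : Fin r => ℝ) i).smulRight (s₀ i x)
  have hS : ContMDiffAt I 𝓘(ℝ, (Fin r → ℝ) →L[ℝ] E) ∞ S p := by
    apply ContMDiffAt.sum
    intro i _
    exact ((ContinuousLinearMap.smulRightL ℝ (Fin r → ℝ) E
      (ContinuousLinearMap.proj (R := ℝ) (φ := fun _ : Fin r => ℝ) i)).contMDiff.contMDiffAt).comp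
      p (hs₀ i)
  have hSapp : ∀ x ∈ e.baseSet, ∀ c : Fin r → ℝ,
      S x c = e.linearMapAt ℝ x (∑ i, c i • D.frame x₀ i x) := by
    intro x hx c
    simp only [S, s₀, _root_.sum_apply, ContinuousLinearMap.smulRight_apply,
      ContinuousLinearMap.proj_apply, map_sum, map_smul]
    refine Finset.sum_congr rfl fun i _ => ?_
    rw [Trivialization.linearMapAt_apply, if_pos hx]
  have hinj : LinearMap.ker (S p : (Fin r → ℝ) →ₗ[ℝ] E) = ⊥ := by
    rw [LinearMap.ker_eq_bot']
    intro c hc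
    have h1 : S p c = 0 := hc
    rw [hSapp p hepos] at h1
    have h2 : ∑ i, c i • D.frame x₀ i p = 0 := by
      have h3 := congrArg (e.symmₗ ℝ p) h1
      rwa [Trivialization.symmₗ_linearMapAt (R := ℝ) e hepos, map_zero] at h3
    funext i
    exact Fintype.linearIndependent_iff.1 (D.linearIndependent_frame x₀ hp.1) c h2 i
  obtain ⟨l, hl⟩ := (S p : (Fin r → ℝ) →ₗ[ℝ] E).exists_leftInverse_of_injective hinj
  let l' : E →L[ℝ] (Fin r → ℝ) := LinearMap.toContinuousLinearMap l
  have hl' : l'.comp (S p) = ContinuousLinearMap.id ℝ _ := by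
    ext c : 1
    exact LinearMap.congr_fun hl c
  let G : M → (Fin r → ℝ) →L[ℝ] (Fin r → ℝ) := fun x => l'.comp (S x)
  have hG : ContMDiffAt I 𝓘(ℝ, (Fin r → ℝ) →L[ℝ] (Fin r → ℝ)) ∞ G p :=
    contMDiffAt_const.clm_comp hS
  have hGp : G p = ContinuousLinearEquiv.refl ℝ (Fin r → ℝ) := hl'
  have hGinv : ContMDiffAt I 𝓘(ℝ, (Fin r → ℝ) →L[ℝ] (Fin r → ℝ)) ∞
      (fun x => (G x).inverse) p := by
    have h : ContDiffAt ℝ ∞ ContinuousLinearMap.inverse (G p) := by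
      rw [hGp]; exact contDiffAt_map_inverse _
    exact h.contMDiffAt.comp p hG
  have hGunit : ∀ᶠ x in 𝓝 p, ∃ A : (Fin r → ℝ) ≃L[ℝ] (Fin r → ℝ), (A : _ →L[ℝ] _) = G x := by
    have h : range ((↑) : ((Fin r → ℝ) ≃L[ℝ] (Fin r → ℝ)) → (Fin r → ℝ) →L[ℝ] (Fin r → ℝ)) ∈
        𝓝 (G p) := by
      rw [hGp]
      exact ContinuousLinearEquiv.nhds (ContinuousLinearEquiv.refl ℝ (Fin r → ℝ))
    exact hG.continuousAt h
  have hfin : ContMDiffAt I 𝓘(ℝ, ℝ) ∞ (fun x => (G x).inverse (l' (s₁ j x)) i) p := by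
    have h1 : ContMDiffAt I 𝓘(ℝ, Fin r → ℝ) ∞ (fun x => (G x).inverse (l' (s₁ j x))) p :=
      hGinv.clm_apply (contMDiffAt_const.clm_apply (hs₁ j))
    exact contMDiffAt_pi_space.1 h1 i
  refine hfin.congr_of_eventuallyEq ?_
  filter_upwards [hopen, hGunit, e.open_baseSet.mem_nhds hepos] with x hx hA hxe
  obtain ⟨A, hA⟩ := hA
  have h1 : s₁ j x = S x (fun i => D.frameCoeff x₀ x₁ i j x) := by
    have h2 := congrArg (Subtype.val) (D.sum_frameCoeff x₀ x₁ j hx)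
    rw [coe_frameBasis] at h2
    rw [hSapp x hxe]
    simp only [s₁]
    rw [← h2, Trivialization.linearMapAt_apply, if_pos hxe]
    simp [coe_frameBasis]
  have h3 : l' (S x (fun i => D.frameCoeff x₀ x₁ i j x)) =
      A (fun i => D.frameCoeff x₀ x₁ i j x) := by
    have := DFunLike.congr_fun hA (fun i => D.frameCoeff x₀ x₁ i j x)
    exact this.symm
  rw [h1, h3, ← hA, ContinuousLinearMap.inverse_equiv]
  simp

lemma contMDiffOn_dualChange (x₀ x₁ : M) :
    ContMDiffOn I 𝓘(ℝ, (Fin r → ℝ) →L[ℝ] (Fin r → ℝ)) ∞ (D.dualChange x₀ x₁)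
      (D.frameSet x₀ ∩ D.frameSet x₁) := by
  intro x hx
  refine ContMDiffWithinAt.sum fun i _ => ContMDiffWithinAt.sum fun j _ => ?_
  exact (D.contMDiffOn_frameCoeff x₀ x₁ i j x hx).smul contMDiffWithinAt_const

/-- The dual `D*` of a distribution as a vector bundle, with the trivializations
`μ ↦ (μ (s₁ x), …, μ (s_r x))` given by local frames. -/
def dualPrebundle : VectorPrebundle ℝ (Fin r → ℝ) D.Dual where
  pretrivializationAtlas := range D.pretriv
  pretrivialization_linear' := by
    rintro _ ⟨x₀, rfl⟩
    refine ⟨fun x (hx : x ∈ D.frameSet x₀) => ⟨fun μ ν => ?_, fun c μ => ?_⟩⟩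
    · simp only [D.pretriv_apply x₀ hx, map_add]
    · simp only [D.pretriv_apply x₀ hx, map_smul]
  pretrivializationAt := D.pretriv
  mem_base_pretrivializationAt := D.mem_frameSet
  pretrivialization_mem_atlas x := ⟨x, rfl⟩
  exists_coordChange := by
    rintro _ ⟨x₀, rfl⟩ _ ⟨x₁, rfl⟩
    refine ⟨D.dualChange x₀ x₁, (D.contMDiffOn_dualChange x₀ x₁).continuousOn, ?_⟩
    intro x hx y
    rw [D.dualChange_apply x₀ x₁ hx, D.pretriv_symm x₀ hx.1, D.pretriv_apply x₁ hx.2]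
  totalSpaceMk_isInducing x := by
    have := D.finiteDimensional_space x
    have : T2Space (D.Dual x) := inferInstanceAs (T2Space (D.space x →L[ℝ] ℝ))
    have : FiniteDimensional ℝ (D.Dual x) :=
      LinearEquiv.finiteDimensional (D.dualCoord x (D.mem_frameSet x)).symm
    have h : (D.pretriv x ∘ TotalSpace.mk x : D.Dual x → M × (Fin r → ℝ)) =
        Prod.mk x ∘ (D.dualCoord x (D.mem_frameSet x)).toContinuousLinearEquiv := by
      funext μ
      exact Prod.ext rfl (D.pretriv_apply x (D.mem_frameSet x) μ)
    rw [h]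
    exact (isInducing_const_prod.2 Topology.IsInducing.id).comp
      (D.dualCoord x (D.mem_frameSet x)).toContinuousLinearEquiv.toHomeomorph.isInducing

instance : D.dualPrebundle.IsContMDiff I ∞ where
  exists_contMDiffCoordChange := by
    rintro _ ⟨x₀, rfl⟩ _ ⟨x₁, rfl⟩
    refine ⟨D.dualChange x₀ x₁, D.contMDiffOn_dualChange x₀ x₁, ?_⟩
    intro x hx y
    rw [D.dualChange_apply x₀ x₁ hx, D.pretriv_symm x₀ hx.1, D.pretriv_apply x₁ hx.2]

instance : TopologicalSpace (TotalSpace (Fin r → ℝ) D.Dual) :=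
  D.dualPrebundle.totalSpaceTopology

instance : FiberBundle (Fin r → ℝ) D.Dual := D.dualPrebundle.toFiberBundle

instance : VectorBundle ℝ (Fin r → ℝ) D.Dual := D.dualPrebundle.toVectorBundle

instance : ContMDiffVectorBundle ∞ (Fin r → ℝ) D.Dual I :=
  D.dualPrebundle.contMDiffVectorBundle I

/-- The total space of the dual bundle. -/
abbrev DualTotal : Type _ := TotalSpace (Fin r → ℝ) D.Dual

end RegularDistribution
end Distribution

/-! ### Differential forms on manifolds without boundary -/

section Forms

variable {E : Type*} [NormedAddCommGroup E] [NormedSpace ℝ E]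
  {H : Type*} [TopologicalSpace H] {I : ModelWithCorners ℝ E H}
  {M : Type*} [TopologicalSpace M] [ChartedSpace H M]
  {E' : Type*} [NormedAddCommGroup E'] [NormedSpace ℝ E']
  {H' : Type*} [TopologicalSpace H'] {J : ModelWithCorners ℝ E' H'}
  {N : Type*} [TopologicalSpace N] [ChartedSpace H' N]

/-- Differential `k`-forms (not necessarily smooth) on `M`. -/
abbrev DiffForm (I : ModelWithCorners ℝ E H) (M : Type*) [TopologicalSpace M] [ChartedSpace H M]
    (k : ℕ) : Type _ :=
  ∀ x : M, TangentSpace I x [⋀^Fin k]→L[ℝ] ℝ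

namespace DiffForm

/-- The pullback of a form along a map. -/
def pullback {k : ℕ} (f : M → N) (σ : DiffForm J N k) : DiffForm I M k :=
  fun x => (σ (f x)).compContinuousLinearMap (mfderiv I J f x)

/-- The expression of a form in the preferred chart at `x₀`: its pullback to the model vector
space along the inverse of the chart. -/
def inChart {k : ℕ} (σ : DiffForm I M k) (x₀ : M) : E → E [⋀^Fin k]→L[ℝ] ℝ :=
  fun y => (σ ((extChartAt I x₀).symm y)).compContinuousLinearMap
    (mfderiv 𝓘(ℝ, E) I (extChartAt I x₀).symm y)

/-- The exterior derivative, computed at `x` in the preferred chart at `x`. -/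
def d {k : ℕ} (σ : DiffForm I M k) : DiffForm I M (k + 1) :=
  fun x => (extDeriv (σ.inChart x) (extChartAt I x x)).compContinuousLinearMap
    (mfderiv I 𝓘(ℝ, E) (extChartAt I x) x)

/-- A form is smooth on the set `U` if all its chart expressions are smooth there. -/
def SmoothOn {k : ℕ} (σ : DiffForm I M k) (U : Set M) : Prop :=
  ∀ x₀ : M, ContDiffOn ℝ ∞ (σ.inChart x₀)
    ((extChartAt I x₀).target ∩ (extChartAt I x₀).symm ⁻¹' U)

/-- The kernel `{w | i_w σ = 0}` of a two-form at the point `x`. -/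
def ker (σ : DiffForm I M 2) (x : M) : Submodule ℝ (TangentSpace I x) where
  carrier := {w | ∀ u, σ x ![w, u] = 0}
  add_mem' {a b} ha hb u := by
    have h := (σ x).toAlternatingMap.map_vecCons_add ![u] a b
    have h' : σ x ![a + b, u] = σ x ![a, u] + σ x ![b, u] := h
    rw [h', ha u, hb u, add_zero]
  zero_mem' u := (σ x).toAlternatingMap.map_coord_zero 0 rfl
  smul_mem' c a ha u := by
    have h := (σ x).toAlternatingMap.map_vecCons_smul ![u] c a
    have h' : σ x ![c • a, u] = c • σ x ![a, u] := h
    rw [h', ha u, smul_zero]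

/-- A two-form is symplectic on `U` if it is smooth, closed and nondegenerate there. -/
structure IsSymplecticOn (σ : DiffForm I M 2) (U : Set M) : Prop where
  smooth : σ.SmoothOn U
  closed : ∀ x ∈ U, σ.d x = 0
  nondegenerate : ∀ x ∈ U, σ.ker x = ⊥

/-- `i : M → N` is a coisotropic embedding of the manifold `M` with the two-form `σ` into an open
neighbourhood of `i(M)` in `N` on which the two-form `Ω` is symplectic: `i` is a smooth embedding
with closed image, `i^* Ω = σ`, and the `Ω`-orthogonal of every tangent space of `i(M)` is contained
in that tangent space. -/
structure IsCoisotropicEmbedding (i : M → N) (σ : DiffForm I M 2) (Ω : DiffForm J N 2) :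
    Prop where
  isSmoothEmbedding : Manifold.IsSmoothEmbedding I J ∞ i
  isClosed_range : IsClosed (range i)
  exists_symplectic : ∃ U : Set N, IsOpen U ∧ range i ⊆ U ∧ Ω.IsSymplecticOn U
  pullback_eq : pullback (I := I) i Ω = σ
  coisotropic : ∀ (x : M) (w : TangentSpace J (i x)),
    (∀ u : TangentSpace I x, Ω (i x) ![w, mfderiv I J i x u] = 0) →
      w ∈ LinearMap.range (mfderiv I J i x : TangentSpace I x →ₗ[ℝ] TangentSpace J (i x))

end DiffForm
end Forms

/-! ### Vertical vectors of a vector bundle -/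

section Vertical

variable {E : Type*} [NormedAddCommGroup E] [NormedSpace ℝ E]
  {H : Type*} [TopologicalSpace H] {I : ModelWithCorners ℝ E H}
  {M : Type*} [TopologicalSpace M] [ChartedSpace H M]
  {F : Type*} [NormedAddCommGroup F] [NormedSpace ℝ F]
  {V : M → Type*} [TopologicalSpace (TotalSpace F V)] [∀ x, AddCommGroup (V x)]
  [∀ x, Module ℝ (V x)] [∀ x, TopologicalSpace (V x)] [FiberBundle F V] [VectorBundle ℝ F V]

/-- The linear coordinates on the fibre of a vector bundle over `x` given by the preferred
trivialization at `x`. -/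
def fibreCoord (F : Type*) [NormedAddCommGroup F] [NormedSpace ℝ F]
    (V : M → Type*) [TopologicalSpace (TotalSpace F V)] [∀ x, AddCommGroup (V x)]
    [∀ x, Module ℝ (V x)] [∀ x, TopologicalSpace (V x)] [FiberBundle F V] [VectorBundle ℝ F V]
    (x : M) : V x ≃L[ℝ] F :=
  (trivializationAt F V x).continuousLinearEquivAt ℝ x (mem_baseSet_trivializationAt F V x)

/-- The canonical identification of the fibre `V x` with the vertical tangent vectors at a point
`z` over `x`: `η` is sent to the velocity at `t = 0` of the curve `t ↦ z + t η` in the fibre.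
A tangent vector at `z` is, by definition of `TangentSpace`, a pair in `E × F` of coordinates with
respect to the preferred chart at `z`, which is the one given by the preferred chart of the base and
the preferred trivialization of the bundle at `x`; so this velocity has the coordinates
`(0, η)`. -/
def vLift (I : ModelWithCorners ℝ E H) (z : TotalSpace F V) :
    V z.proj →L[ℝ] TangentSpace (I.prod 𝓘(ℝ, F)) z :=
  (ContinuousLinearMap.inr ℝ E F).comp (fibreCoord F V z.proj : V z.proj →L[ℝ] F)

/-- `vLift I z η` is the velocity at `t = 0` of the curve `t ↦ z + t η`. -/
lemma hasMFDerivAt_line (z : TotalSpace F V) (η : V z.proj) :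
    HasMFDerivAt 𝓘(ℝ, ℝ) (I.prod 𝓘(ℝ, F))
      (fun t : ℝ => (⟨z.proj, z.2 + t • η⟩ : TotalSpace F V)) 0
      (ContinuousLinearMap.toSpanSingleton ℝ (vLift I z η)) := by
  obtain ⟨x, μ⟩ := z
  have hz : (⟨x, μ + (0 : ℝ) • η⟩ : TotalSpace F V) = ⟨x, μ⟩ := by simp
  have hcoord : ∀ t : ℝ, (trivializationAt F V x ⟨x, μ + t • η⟩) =
      (x, fibreCoord F V x μ + t • fibreCoord F V x η) := by
    intro t
    refine Prod.ext (Trivialization.coe_fst' _ (mem_baseSet_trivializationAt F V x)) ?_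
    have : (trivializationAt F V x ⟨x, μ + t • η⟩).2 = fibreCoord F V x (μ + t • η) := by
      simp [fibreCoord]
    rw [this, map_add, map_smul]
  have hcont : Continuous (fun t : ℝ => (⟨x, μ + t • η⟩ : TotalSpace F V)) := by
    rw [continuous_iff_continuousAt]
    intro t
    rw [FiberBundle.continuousAt_totalSpace]
    refine ⟨continuousAt_const, ?_⟩
    simp only [hcoord]
    fun_prop
  refine ⟨hcont.continuousAt, ?_⟩
  have hw : writtenInExtChartAt 𝓘(ℝ, ℝ) (I.prod 𝓘(ℝ, F)) 0
      (fun t : ℝ => (⟨x, μ + t • η⟩ : TotalSpace F V)) =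
      fun t : ℝ => (extChartAt I x x, fibreCoord F V x μ + t • fibreCoord F V x η) := by
    funext t
    simp only [writtenInExtChartAt, FiberBundle.extChartAt, hz, Function.comp]
    simp [hcoord]
    rfl
  rw [hw]
  apply HasFDerivAt.hasFDerivWithinAt
  have h1 : HasFDerivAt
      (fun t : ℝ => (extChartAt I x x, fibreCoord F V x μ + t • fibreCoord F V x η))
      ((0 : ℝ →L[ℝ] E).prod (ContinuousLinearMap.toSpanSingleton ℝ (fibreCoord F V x η)))
      (extChartAt 𝓘(ℝ, ℝ) (0 : ℝ) 0) := by
    refine (hasFDerivAt_const _ _).prodMk ?_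
    refine HasFDerivAt.const_add _ ?_
    exact (ContinuousLinearMap.toSpanSingleton ℝ (fibreCoord F V x η)).hasFDerivAt
      (x := extChartAt 𝓘(ℝ, ℝ) (0 : ℝ) 0)
  have h2 : (ContinuousLinearMap.toSpanSingleton ℝ (vLift I ⟨x, μ⟩ η) : ℝ →L[ℝ] E × F) =
      (0 : ℝ →L[ℝ] E).prod (ContinuousLinearMap.toSpanSingleton ℝ (fibreCoord F V x η)) := by
    ext
    · change (1 : ℝ) • (vLift I (⟨x, μ⟩ : TotalSpace F V) η : E × F).1 = 0
      rw [one_smul]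
      rfl
    · change (1 : ℝ) • (vLift I (⟨x, μ⟩ : TotalSpace F V) η : E × F).2 = _
      rw [one_smul]
      exact (one_smul ℝ (fibreCoord F V x η)).symm
  rw [← h2] at h1
  exact h1

/-- The space of vertical vectors at `z`. -/
def verticalSpace (I : ModelWithCorners ℝ E H) (z : TotalSpace F V) :
    Submodule ℝ (TangentSpace (I.prod 𝓘(ℝ, F)) z) :=
  LinearMap.ker (mfderiv (I.prod 𝓘(ℝ, F)) I (π F V) z :
    TangentSpace (I.prod 𝓘(ℝ, F)) z →ₗ[ℝ] TangentSpace I z.proj)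

/-- The inverse of `vLift`, sending a vertical vector at `z` to the corresponding element of the
fibre (in coordinates, `(0, η) ↦ η`). -/
def vDrop (I : ModelWithCorners ℝ E H) (z : TotalSpace F V) :
    verticalSpace I z →ₗ[ℝ] V z.proj :=
  ((fibreCoord F V z.proj).symm : F →ₗ[ℝ] V z.proj) ∘ₗ (LinearMap.snd ℝ E F) ∘ₗ
    (verticalSpace I z).subtype

end Vertical

/-! ### Lagrangian systems -/

section Lagrangian

variable {E : Type*} [NormedAddCommGroup E] [NormedSpace ℝ E]
  {H : Type*} [TopologicalSpace H] {I : ModelWithCorners ℝ E H}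
  {M : Type*} [TopologicalSpace M] [ChartedSpace H M] [IsManifold I ∞ M]

/-- The vertical endomorphism `S` of the tangent bundle: `S w = (Tπ w)^V`. -/
def verticalEndo (v : TangentBundle I M) :
    TangentSpace I.tangent v →L[ℝ] TangentSpace I.tangent v :=
  (vLift I v).comp (mfderiv I.tangent I (π E (TangentSpace I : M → Type _)) v)

/-- The Liouville vector field of the tangent bundle. -/
def liouville (v : TangentBundle I M) : TangentSpace I.tangent v := vLift I v v.2

/-- The differential of a function, as a linear functional on tangent vectors. -/
def differential {E : Type*} [NormedAddCommGroup E] [NormedSpace ℝ E]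
    {H : Type*} [TopologicalSpace H] (I : ModelWithCorners ℝ E H)
    {M : Type*} [TopologicalSpace M] [ChartedSpace H M] (f : M → ℝ) (x : M) :
    TangentSpace I x →L[ℝ] ℝ :=
  mfderiv I 𝓘(ℝ, ℝ) f x

/-- The Poincaré–Cartan one-form `θ_L = S^* dL`. -/
def poincareCartan (L : TangentBundle I M → ℝ) : DiffForm I.tangent (TangentBundle I M) 1 :=
  fun v => ContinuousAlternatingMap.ofSubsingleton ℝ (TangentSpace I.tangent v) ℝ (0 : Fin 1)
    ((differential I.tangent L v).comp (verticalEndo v))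

/-- The Lagrangian two-form `ω_L = - d θ_L`. -/
def lagrangianForm (L : TangentBundle I M → ℝ) : DiffForm I.tangent (TangentBundle I M) 2 :=
  fun v => -DiffForm.d (poincareCartan L) v

/-- The energy `E_L = Δ(L) - L`. -/
def energy (L : TangentBundle I M → ℝ) (v : TangentBundle I M) : ℝ :=
  differential I.tangent L v (liouville v) - L v

/-- A Lagrangian is singular if its two-form is degenerate. -/
def IsSingular (L : TangentBundle I M → ℝ) : Prop :=
  ∃ v, DiffForm.ker (lagrangianForm L) v ≠ ⊥

/-- A Lagrangian is consistent if `ker ω_L ⊆ ker dE_L` everywhere. -/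
def IsConsistent (L : TangentBundle I M → ℝ) : Prop :=
  ∀ v, ∀ w ∈ DiffForm.ker (lagrangianForm L) v, differential I.tangent (energy L) v w = 0

end Lagrangian

/-! ### Lifts to the tangent bundle and the foliated Tulczyjew isomorphism -/

section Lift

variable {E : Type*} [NormedAddCommGroup E] [NormedSpace ℝ E]
  {H : Type*} [TopologicalSpace H] {I : ModelWithCorners ℝ E H}
  {M : Type*} [TopologicalSpace M] [ChartedSpace H M] [IsManifold I ∞ M]

/-- The components in `E × E` of a tangent vector to `TM` in the chart of `TM` induced by the
preferred chart of `M` at the base point. -/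
def comps {v : TangentBundle I M} (w : TangentSpace I.tangent v) : E × E := w

/-- The complete lift `X^C = X^i ∂/∂q^i + v^k (∂X^i/∂q^k) ∂/∂v^i` of a vector field at `v`; the
components are those in the chart of `TM` induced by the preferred chart of `M` at the base
point. -/
def completeLift (X : ∀ q : M, TangentSpace I q) (v : TangentBundle I M) :
    TangentSpace I.tangent v :=
  show E × E from (X v.proj,
    (comps (mfderiv I I.tangent (fun q => (⟨q, X q⟩ : TangentBundle I M)) v.proj v.2)).2)

/-- The canonical involution `δ (q, v, a, b) = (q, a, v, b)` of `T(TM)`. -/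
def canonicalFlip (z : TangentBundle I.tangent (TangentBundle I M)) :
    TangentBundle I.tangent (TangentBundle I M) :=
  ⟨⟨z.proj.proj, (comps z.2).1⟩, show E × E from (z.proj.2, (comps z.2).2)⟩

/-- The velocity at time `0` of a curve. -/
def velocity {E : Type*} [NormedAddCommGroup E] [NormedSpace ℝ E]
    {H : Type*} [TopologicalSpace H] (I : ModelWithCorners ℝ E H)
    {M : Type*} [TopologicalSpace M] [ChartedSpace H M] (c : ℝ → M) : TangentBundle I M :=
  ⟨c 0, mfderiv 𝓘(ℝ, ℝ) I c 0 (1 : ℝ)⟩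

namespace RegularDistribution

variable {r : ℕ} (D : RegularDistribution I M r)

/-- `X` is a smooth section of `D` near the point `q`. -/
def IsSectionAt (X : ∀ q : M, TangentSpace I q) (q : M) : Prop :=
  ContMDiffAt I I.tangent ∞ (fun p => (⟨p, X p⟩ : TangentBundle I M)) q ∧
    ∀ᶠ p in 𝓝 q, X p ∈ D.space p

/-- The complete lift (tangent distribution) of `D`, spanned by the complete and the vertical lifts
of the local sections of `D`. -/
def liftSpace (v : TangentBundle I M) : Submodule ℝ (TangentSpace I.tangent v) :=
  Submodule.span ℝ
    ({w | ∃ X, D.IsSectionAt X v.proj ∧ w = completeLift X v} ∪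
      {w | ∃ X, D.IsSectionAt X v.proj ∧ w = vLift I v (X v.proj)})

variable [FiniteDimensional ℝ E]

/-- The model with corners of the total space of the dual of a rank `r` distribution. -/
abbrev dualModel (I : ModelWithCorners ℝ E H) (r : ℕ) :
    ModelWithCorners ℝ (E × (Fin r → ℝ)) (ModelProd H (Fin r → ℝ)) :=
  I.prod 𝓘(ℝ, Fin r → ℝ)

/-- The projection `T(D*) → TM`, the tangent map of the bundle projection `D* → M`. -/
def tangentProj (ξ : TangentBundle (dualModel I r) D.DualTotal) : TangentBundle I M :=
  tangentMap (dualModel I r) I (π (Fin r → ℝ) D.Dual) ξ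

/-- The embedding `TM → T(D*)`, the tangent map of the zero section. -/
def tangentZero (v : TangentBundle I M) : TangentBundle (dualModel I r) D.DualTotal :=
  tangentMap I (dualModel I r) (zeroSection (Fin r → ℝ) D.Dual) v

/-- Let `K` be a distribution on `TM` (below, the complete lift of `D`). A map
`α : T(D*) → K*` is the foliated Tulczyjew map if it covers the identity of `TM` and is the
transpose of the canonical involution `δ` with respect to the tangent lift of the pairing between
`D*` and `D`: for smooth curves `c` in `D*` and `y` in `D` over the same curve in `M`,
`⟨α (c'(0)), δ (y'(0))⟩ = d/dt ⟨c t, y t⟩` at `t = 0`. -/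
structure IsTulczyjew {s : ℕ} (K : RegularDistribution I.tangent (TangentBundle I M) s)
    (α : TangentBundle (dualModel I r) D.DualTotal → K.DualTotal) : Prop where
  proj_eq : ∀ ξ, (α ξ).proj = D.tangentProj ξ
  pair_eq : ∀ (c : ℝ → D.DualTotal) (y : ∀ t, D.space (c t).proj),
    ContMDiff 𝓘(ℝ, ℝ) (dualModel I r) ∞ c →
    ContMDiff 𝓘(ℝ, ℝ) I.tangent ∞
      (fun t => (⟨(c t).proj, (y t : TangentSpace I (c t).proj)⟩ : TangentBundle I M)) →
    ∃ w : K.space (α (velocity (dualModel I r) c)).proj,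
      (⟨(α (velocity (dualModel I r) c)).proj, w⟩ :
          TangentBundle I.tangent (TangentBundle I M)) =
        canonicalFlip (velocity I.tangent
          (fun t => (⟨(c t).proj, (y t : TangentSpace I (c t).proj)⟩ : TangentBundle I M))) ∧
      K.pair (α (velocity (dualModel I r) c)).2 w = deriv (fun t => D.pair (c t).2 (y t)) 0

end RegularDistribution
end Lift

/-! ### Connections, almost product structures and the extended Lagrangian -/

section Extension

variable {E : Type*} [NormedAddCommGroup E] [NormedSpace ℝ E] [FiniteDimensional ℝ E]
  {H : Type*} [TopologicalSpace H] {I : ModelWithCorners ℝ E H}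
  {M : Type*} [TopologicalSpace M] [ChartedSpace H M] [IsManifold I ∞ M]
  {r : ℕ}

open RegularDistribution

/-- An almost product structure `P` adapted to the distribution `D`: a smooth field of projectors
of the tangent spaces with image `D` (so that `ker P` is a complement of `D`). -/
structure AlmostProduct (D : RegularDistribution I M r) where
  /-- the projector at the point `q` -/
  proj : ∀ q : M, TangentSpace I q →L[ℝ] TangentSpace I q
  smooth : ContMDiff I.tangent I.tangent ∞
    (fun v : TangentBundle I M => (⟨v.proj, proj v.proj v.2⟩ : TangentBundle I M))
  idem : ∀ q v, proj q (proj q v) = proj q v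
  range_eq : ∀ q,
    LinearMap.range (proj q : TangentSpace I q →ₗ[ℝ] TangentSpace I q) = D.space q

/-- The projector of an almost product structure as a map into the distribution. -/
def AlmostProduct.toSpace {D : RegularDistribution I M r} (P : AlmostProduct D)
    (v : TangentBundle I M) : D.space v.proj :=
  ⟨P.proj v.proj v.2, by rw [← P.range_eq]; exact ⟨v.2, rfl⟩⟩

/-- An Ehresmann connection on the bundle `D* → M`: a smooth distribution on the total space
complementary to the vertical one. -/
structure EhresmannConnection (D : RegularDistribution I M r) where
  /-- the horizontal distribution -/
  horizontal : RegularDistribution (dualModel I r) D.DualTotal (Module.finrank ℝ E)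
  isCompl : ∀ z, IsCompl (verticalSpace I z) (horizontal.space z)

namespace EhresmannConnection

variable {D : RegularDistribution I M r} (nab : EhresmannConnection D)

/-- Along the zero section, the horizontal spaces are the tangent spaces of the zero section. -/
def TrivialAlongZero : Prop :=
  ∀ q : M, nab.horizontal.space (zeroSection (Fin r → ℝ) D.Dual q) =
    LinearMap.range (mfderiv I (dualModel I r) (zeroSection (Fin r → ℝ) D.Dual) q :
      TangentSpace I q →ₗ[ℝ] TangentSpace (dualModel I r) (zeroSection (Fin r → ℝ) D.Dual q))

/-- The vertical part `p_V ξ` of a tangent vector of `D*`, as an element of the fibre. -/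
def verticalPart (ξ : TangentBundle (dualModel I r) D.DualTotal) : D.Dual ξ.proj.proj :=
  vDrop I ξ.proj (Submodule.projectionOnto _ _ (nab.isCompl ξ.proj) ξ.2)

/-- The function `F(ξ) = ⟨P (Tπ ξ), p_V ξ⟩` on `T(D*)`. -/
def correction (P : AlmostProduct D) (ξ : TangentBundle (dualModel I r) D.DualTotal) : ℝ :=
  D.pair (nab.verticalPart ξ) (P.toSpace (D.tangentProj ξ))

/-- The extended Lagrangian `L ∘ Tπ + F` on `T(D*)`. -/
def extendedLagrangian (P : AlmostProduct D) (L : TangentBundle I M → ℝ)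
    (ξ : TangentBundle (dualModel I r) D.DualTotal) : ℝ :=
  L (D.tangentProj ξ) + nab.correction P ξ

end EhresmannConnection
end Extension

end

noncomputable section

set_option linter.unusedSectionVars false

/-! ### Transition maps between preferred charts -/

section Charts

variable {E : Type*} [NormedAddCommGroup E] [NormedSpace ℝ E]
  {H : Type*} [TopologicalSpace H] {I : ModelWithCorners ℝ E H} [I.Boundaryless]
  {M : Type*} [TopologicalSpace M] [ChartedSpace H M] [IsManifold I ∞ M]

lemma mdifferentiableAt_extChartAt_symm' {x₀ : M} {y : E} (hy : y ∈ (extChartAt I x₀).target) :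
    MDifferentiableAt 𝓘(ℝ, E) I (extChartAt I x₀).symm y := by
  have h := mdifferentiableWithinAt_extChartAt_symm hy
  rwa [I.range_eq_univ, mdifferentiableWithinAt_univ] at h

lemma mdifferentiableAt_extChartAt' {x₀ x : M} (hx : x ∈ (extChartAt I x₀).source) :
    MDifferentiableAt I 𝓘(ℝ, E) (extChartAt I x₀) x :=
  mdifferentiableAt_extChartAt (by rwa [extChartAt_source] at hx)

lemma mfderiv_extChartAt_symm_left {x₀ : M} {y : E} (hy : y ∈ (extChartAt I x₀).target) (w : E) :
    mfderiv I 𝓘(ℝ, E) (extChartAt I x₀) ((extChartAt I x₀).symm y)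
      (mfderiv 𝓘(ℝ, E) I (extChartAt I x₀).symm y w) = w := by
  have h := mfderiv_extChartAt_comp_mfderivWithin_extChartAt_symm hy
  rw [I.range_eq_univ, mfderivWithin_univ] at h
  exact DFunLike.congr_fun h w

lemma mfderiv_extChartAt_symm_right {x₀ : M} {y : E} (hy : y ∈ (extChartAt I x₀).target)
    (w : TangentSpace I ((extChartAt I x₀).symm y)) :
    mfderiv 𝓘(ℝ, E) I (extChartAt I x₀).symm y
      (mfderiv I 𝓘(ℝ, E) (extChartAt I x₀) ((extChartAt I x₀).symm y) w) = w := by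
  have h := mfderivWithin_extChartAt_symm_comp_mfderiv_extChartAt hy
  rw [I.range_eq_univ, mfderivWithin_univ] at h
  exact DFunLike.congr_fun h w

/-- The transition map between two preferred charts. -/
def chartChange (I : ModelWithCorners ℝ E H) (x₀ x₁ : M) : E → E :=
  extChartAt I x₁ ∘ (extChartAt I x₀).symm

/-- The domain of the transition map between two preferred charts. -/
def chartChangeDomain (I : ModelWithCorners ℝ E H) (x₀ x₁ : M) : Set E :=
  (extChartAt I x₀).target ∩ (extChartAt I x₀).symm ⁻¹' (extChartAt I x₁).source

lemma isOpen_chartChangeDomain (x₀ x₁ : M) : IsOpen (chartChangeDomain I x₀ x₁) :=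
  (continuousOn_extChartAt_symm x₀).isOpen_inter_preimage (isOpen_extChartAt_target x₀)
    (isOpen_extChartAt_source x₁)

lemma contDiffAt_chartChange {x₀ x₁ : M} {y : E} (hy : y ∈ chartChangeDomain I x₀ x₁) :
    ContDiffAt ℝ ∞ (chartChange I x₀ x₁) y := by
  have h : ContDiffWithinAt ℝ ∞ (extChartAt I x₁ ∘ (extChartAt I x₀).symm) (range I) y :=
    contDiffWithinAt_ext_coord_change x₁ x₀ hy
  rwa [I.range_eq_univ, contDiffWithinAt_univ] at h

lemma fderiv_chartChange {x₀ x₁ : M} {y : E} (hy : y ∈ chartChangeDomain I x₀ x₁) (w : E) :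
    fderiv ℝ (chartChange I x₀ x₁) y w =
      mfderiv I 𝓘(ℝ, E) (extChartAt I x₁) ((extChartAt I x₀).symm y)
        (mfderiv 𝓘(ℝ, E) I (extChartAt I x₀).symm y w) := by
  rw [← mfderiv_eq_fderiv, chartChange, mfderiv_comp y (mdifferentiableAt_extChartAt' hy.2)
    (mdifferentiableAt_extChartAt_symm' hy.1)]
  rfl

lemma two_le_infty : (2 : WithTop ℕ∞) ≤ ∞ := by
  exact WithTop.coe_le_coe.2 (le_top : (2 : ℕ∞) ≤ ⊤)

namespace DiffForm

lemma inChart_apply {k : ℕ} (σ : DiffForm I M k) (x₀ : M) (y : E) (w : Fin k → E) :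
    σ.inChart x₀ y w = σ ((extChartAt I x₀).symm y)
      (fun i => mfderiv 𝓘(ℝ, E) I (extChartAt I x₀).symm y (w i)) := rfl

lemma d_apply {k : ℕ} (σ : DiffForm I M k) (x : M) (w : Fin (k + 1) → TangentSpace I x) :
    σ.d x w = extDeriv (σ.inChart x) (extChartAt I x x)
      (fun i => mfderiv I 𝓘(ℝ, E) (extChartAt I x) x (w i)) := rfl

lemma inChart_eq_pullback {k : ℕ} (σ : DiffForm I M k) {x₀ x₁ : M} {y : E}
    (hy : y ∈ chartChangeDomain I x₀ x₁) :
    σ.inChart x₀ y = (σ.inChart x₁ (chartChange I x₀ x₁ y)).compContinuousLinearMap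
      (fderiv ℝ (chartChange I x₀ x₁) y) := by
  have hxy : (extChartAt I x₁).symm (chartChange I x₀ x₁ y) = (extChartAt I x₀).symm y :=
    (extChartAt I x₁).left_inv hy.2
  have hty : chartChange I x₀ x₁ y ∈ (extChartAt I x₁).target := (extChartAt I x₁).map_source hy.2
  ext w
  have key : ∀ (x : M) (_ : (extChartAt I x₁).symm (chartChange I x₀ x₁ y) = x)
      (u : Fin k → TangentSpace I x), σ x u =
        σ ((extChartAt I x₁).symm (chartChange I x₀ x₁ y)) (fun i =>
          mfderiv 𝓘(ℝ, E) I (extChartAt I x₁).symm (chartChange I x₀ x₁ y)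
          (mfderiv I 𝓘(ℝ, E) (extChartAt I x₁) x (u i))) := by
    rintro _ rfl u
    congr 1
    funext i
    exact (mfderiv_extChartAt_symm_right hty (u i)).symm
  refine (key _ hxy _).trans ?_
  rw [ContinuousAlternatingMap.compContinuousLinearMap_apply, inChart_apply]
  congr 1
  funext i
  exact congrArg _ (fderiv_chartChange hy (w i)).symm

lemma SmoothOn.contDiffAt_inChart {k : ℕ} {σ : DiffForm I M k} (hσ : σ.SmoothOn univ) {x₀ : M}
    {y : E} (hy : y ∈ (extChartAt I x₀).target) : ContDiffAt ℝ ∞ (σ.inChart x₀) y := by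
  have h := hσ x₀
  rw [preimage_univ, inter_univ] at h
  exact h.contDiffAt ((isOpen_extChartAt_target x₀).mem_nhds hy)

/-- The exterior derivative of a smooth form can be computed in any preferred chart. -/
lemma inChart_d {k : ℕ} {σ : DiffForm I M k} (hσ : σ.SmoothOn univ) {x₀ : M}
    {y : E} (hy : y ∈ (extChartAt I x₀).target) :
    σ.d.inChart x₀ y = extDeriv (σ.inChart x₀) y := by
  set x := (extChartAt I x₀).symm y with hx
  have hyd : y ∈ chartChangeDomain I x₀ x := ⟨hy, mem_extChartAt_source x⟩
  have h1 : σ.inChart x₀ =ᶠ[𝓝 y] fun y' => (σ.inChart x (chartChange I x₀ x y')).compContinuousLinearMap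
      (fderiv ℝ (chartChange I x₀ x) y') := by
    filter_upwards [(isOpen_chartChangeDomain x₀ x).mem_nhds hyd] with y' hy'
    exact σ.inChart_eq_pullback hy'
  rw [h1.extDeriv_eq, extDeriv_pullback (r := 2)]
  · ext w
    rw [ContinuousAlternatingMap.compContinuousLinearMap_apply, inChart_apply, d_apply]
    congr 1
    funext i
    exact (fderiv_chartChange hyd (w i)).symm
  · exact (hσ.contDiffAt_inChart (mem_extChartAt_target x)).differentiableAt (by simp)
  · exact (contDiffAt_chartChange hyd).of_le two_le_infty
  · simp

lemma SmoothOn.d {k : ℕ} {σ : DiffForm I M k} (hσ : σ.SmoothOn univ) : σ.d.SmoothOn univ := by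
  intro x₀
  rw [preimage_univ, inter_univ]
  intro y hy
  apply ContDiffAt.contDiffWithinAt
  let A : (E →L[ℝ] E [⋀^Fin k]→L[ℝ] ℝ) →L[ℝ] E [⋀^Fin (k + 1)]→L[ℝ] ℝ :=
    ContinuousAlternatingMap.alternatizeUncurryFinCLM ℝ E ℝ
  have h : ContDiffAt ℝ ∞ (A ∘ fderiv ℝ (σ.inChart x₀)) y :=
    A.contDiff.contDiffAt.comp y ((hσ.contDiffAt_inChart hy).fderiv_right (m := ∞) (by simp))
  refine h.congr_of_eventuallyEq ?_
  filter_upwards [(isOpen_extChartAt_target x₀).mem_nhds hy] with y' hy'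
  exact inChart_d hσ hy'

lemma d_d {k : ℕ} {σ : DiffForm I M k} (hσ : σ.SmoothOn univ) (x : M) : σ.d.d x = 0 := by
  have h : σ.d.inChart x =ᶠ[𝓝 (extChartAt I x x)] extDeriv (σ.inChart x) := by
    filter_upwards [(isOpen_extChartAt_target x).mem_nhds (mem_extChartAt_target x)] with y' hy'
    exact inChart_d hσ hy'
  have h2 : extDeriv (σ.d.inChart x) (extChartAt I x x) = 0 := by
    rw [h.extDeriv_eq]
    exact extDeriv_extDeriv_apply (hσ.contDiffAt_inChart (mem_extChartAt_target x)) (by simpa using two_le_infty)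
  ext w
  rw [d_apply, h2]
  rfl

lemma inChart_neg {k : ℕ} (σ : DiffForm I M k) (x₀ : M) :
    DiffForm.inChart (fun x => -σ x) x₀ = fun y => -σ.inChart x₀ y := by
  rfl

lemma SmoothOn.neg {k : ℕ} {σ : DiffForm I M k} {U : Set M} (hσ : σ.SmoothOn U) :
    DiffForm.SmoothOn (fun x => -σ x) U := by
  intro x₀
  rw [inChart_neg]
  exact (hσ x₀).neg

lemma d_neg {k : ℕ} (σ : DiffForm I M k) (x : M) :
    DiffForm.d (fun x => -σ x) x = -σ.d x := by
  have : extDeriv (DiffForm.inChart (fun x => -σ x) x) (extChartAt I x x) =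
      -extDeriv (σ.inChart x) (extChartAt I x x) := by
    rw [inChart_neg]
    have := extDeriv_fun_smul (-1 : ℝ) (σ.inChart x) (x := extChartAt I x x)
    rwa [neg_one_smul, neg_one_smul] at this
  simp only [d, this]
  rfl

lemma SmoothOn.mono {k : ℕ} {σ : DiffForm I M k} {U V : Set M} (hσ : σ.SmoothOn U) (h : V ⊆ U) :
    σ.SmoothOn V := fun x₀ => (hσ x₀).mono (inter_subset_inter_right _ (preimage_mono h))

end DiffForm
end Charts

/-! ### Preferred charts of the tangent bundle -/

section TangentCharts

variable {E : Type*} [NormedAddCommGroup E] [NormedSpace ℝ E]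
  {H : Type*} [TopologicalSpace H] {I : ModelWithCorners ℝ E H} [I.Boundaryless]
  {M : Type*} [TopologicalSpace M] [ChartedSpace H M] [IsManifold I ∞ M]

lemma mem_tangent_extChartAt_source {ξ₀ ξ : TangentBundle I M} :
    ξ ∈ (extChartAt I.tangent ξ₀).source ↔ ξ.proj ∈ (extChartAt I ξ₀.proj).source := by
  rw [extChartAt_source, extChartAt_source, TangentBundle.mem_chart_source_iff]

lemma mem_tangent_extChartAt_target {ξ₀ : TangentBundle I M} {y : E × E} :
    y ∈ (extChartAt I.tangent ξ₀).target ↔ y.1 ∈ (extChartAt I ξ₀.proj).target := by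
  rw [FiberBundle.extChartAt_target]
  simp +contextual

lemma tangent_extChartAt_apply {ξ₀ ξ : TangentBundle I M}
    (h : ξ.proj ∈ (extChartAt I ξ₀.proj).source) :
    extChartAt I.tangent ξ₀ ξ = (extChartAt I ξ₀.proj ξ.proj,
      mfderiv I 𝓘(ℝ, E) (extChartAt I ξ₀.proj) ξ.proj ξ.2) := by
  rw [extChartAt_source] at h
  have h1 := TangentBundle.continuousLinearMapAt_trivializationAt (I := I) h
  rw [← h1, FiberBundle.extChartAt]
  refine Prod.ext rfl ?_
  exact (Trivialization.continuousLinearMapAt_apply_of_mem ℝ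
    (trivializationAt E (TangentSpace I : M → Type _) ξ₀.proj) h _).symm

lemma tangent_extChartAt_symm_apply {ξ₀ : TangentBundle I M} {y : E × E}
    (hy : y.1 ∈ (extChartAt I ξ₀.proj).target) :
    (extChartAt I.tangent ξ₀).symm y = ⟨(extChartAt I ξ₀.proj).symm y.1,
      mfderiv 𝓘(ℝ, E) I (extChartAt I ξ₀.proj).symm y.1 y.2⟩ := by
  have h1 : (extChartAt I ξ₀.proj).symm y.1 ∈ (extChartAt I ξ₀.proj).source :=
    (extChartAt I ξ₀.proj).map_target hy
  have h2 : (⟨(extChartAt I ξ₀.proj).symm y.1,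
      mfderiv 𝓘(ℝ, E) I (extChartAt I ξ₀.proj).symm y.1 y.2⟩ : TangentBundle I M) ∈
      (extChartAt I.tangent ξ₀).source := mem_tangent_extChartAt_source.2 h1
  rw [← (extChartAt I.tangent ξ₀).left_inv h2, tangent_extChartAt_apply h1]
  congr 1
  refine Prod.ext ((extChartAt I ξ₀.proj).right_inv hy).symm ?_
  exact (mfderiv_extChartAt_symm_left hy y.2).symm

lemma fibreCoord_tangent (x : M) (v : TangentSpace I x) :
    fibreCoord E (TangentSpace I : M → Type _) x v = v := by
  have h1 := TangentBundle.continuousLinearMapAt_trivializationAt (I := I) (mem_chart_source H x)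
  rw [mfderiv_extChartAt_self] at h1
  refine Eq.trans ?_ (DFunLike.congr_fun h1 v)
  exact (Trivialization.continuousLinearMapAt_apply_of_mem ℝ
    (trivializationAt E (TangentSpace I : M → Type _) x) (mem_chart_source H x) v).symm

lemma vLift_tangent (v : TangentBundle I M) (w : TangentSpace I v.proj) :
    vLift I v w = ((0, w) : E × E) :=
  Prod.ext rfl (fibreCoord_tangent v.proj w)

end TangentCharts

/-! ### The Poincaré–Cartan forms in charts -/

section LagrangianCharts

variable {E : Type*} [NormedAddCommGroup E] [NormedSpace ℝ E]
  {H : Type*} [TopologicalSpace H] {I : ModelWithCorners ℝ E H} [I.Boundaryless]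
  {M : Type*} [TopologicalSpace M] [ChartedSpace H M] [IsManifold I ∞ M]

/-- A function on the tangent bundle read in the preferred chart at `ξ₀`. -/
def readInChart (L : TangentBundle I M → ℝ) (ξ₀ : TangentBundle I M) : E × E → ℝ :=
  L ∘ (extChartAt I.tangent ξ₀).symm

lemma contDiffAt_readInChart {L : TangentBundle I M → ℝ} (hL : ContMDiff I.tangent 𝓘(ℝ, ℝ) ∞ L)
    {ξ₀ : TangentBundle I M} {y : E × E} (hy : y ∈ (extChartAt I.tangent ξ₀).target) :
    ContDiffAt ℝ ∞ (readInChart L ξ₀) y := by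
  have h1 := contMDiffOn_extChartAt_symm (I := I.tangent) (n := ∞) ξ₀
  have h2 := (hL.contMDiffAt (x := (extChartAt I.tangent ξ₀).symm y)).comp y
    (h1.contMDiffAt ((isOpen_extChartAt_target ξ₀).mem_nhds hy))
  exact contMDiffAt_iff_contDiffAt.1 h2

/-- The linear map `(a, b) ↦ (0, a)`, the vertical endomorphism in a chart. -/
def flatVerticalEndo (E : Type*) [NormedAddCommGroup E] [NormedSpace ℝ E] :
    E × E →L[ℝ] E × E :=
  (ContinuousLinearMap.inr ℝ E E).comp (ContinuousLinearMap.fst ℝ E E)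

lemma differential_vLift {L : TangentBundle I M → ℝ} (hL : ContMDiff I.tangent 𝓘(ℝ, ℝ) ∞ L)
    (ξ : TangentBundle I M) (u : TangentSpace I ξ.proj) :
    HasDerivAt (fun t : ℝ => L ⟨ξ.proj, ξ.2 + t • u⟩) (differential I.tangent L ξ (vLift I ξ u)) 0 := by
  have h1 := hasMFDerivAt_line (I := I) ξ u
  have hξ : (⟨ξ.proj, ξ.2 + (0 : ℝ) • u⟩ : TangentBundle I M) = ξ := by simp
  have h2 : HasMFDerivAt I.tangent 𝓘(ℝ, ℝ) L (⟨ξ.proj, ξ.2 + (0 : ℝ) • u⟩ : TangentBundle I M)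
      (differential I.tangent L ξ) := by
    rw [hξ]
    exact (hL.mdifferentiableAt (by simp)).hasMFDerivAt
  have h3 := HasFDerivAt.hasDerivAt (f := fun t : ℝ => L ⟨ξ.proj, ξ.2 + t • u⟩)
    (h2.comp (0 : ℝ) h1).hasFDerivAt
  have h4 : (differential I.tangent L ξ).comp
      (ContinuousLinearMap.toSpanSingleton ℝ (vLift I ξ u)) (1 : ℝ) =
      differential I.tangent L ξ (vLift I ξ u) :=
    congrArg (differential I.tangent L ξ) (one_smul ℝ (vLift I ξ u))
  exact h4 ▸ h3

lemma mfderiv_proj_extChartAt_symm {ξ₀ : TangentBundle I M} {y : E × E}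
    (hy : y ∈ (extChartAt I.tangent ξ₀).target) (w : E × E) :
    mfderiv I 𝓘(ℝ, E) (extChartAt I ξ₀.proj) ((extChartAt I.tangent ξ₀).symm y).proj
      (mfderiv I.tangent I (π E (TangentSpace I : M → Type _)) ((extChartAt I.tangent ξ₀).symm y)
        (mfderiv 𝓘(ℝ, E × E) I.tangent (extChartAt I.tangent ξ₀).symm y w)) = w.1 := by
  have hsrc : ((extChartAt I.tangent ξ₀).symm y).proj ∈ (extChartAt I ξ₀.proj).source :=
    mem_tangent_extChartAt_source.1 ((extChartAt I.tangent ξ₀).map_target hy)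
  have h1 : HasMFDerivAt 𝓘(ℝ, E × E) I.tangent (extChartAt I.tangent ξ₀).symm y _ :=
    (mdifferentiableAt_extChartAt_symm' hy).hasMFDerivAt
  have h2 : HasMFDerivAt I.tangent I (π E (TangentSpace I : M → Type _))
      ((extChartAt I.tangent ξ₀).symm y) _ :=
    ((contMDiff_proj (n := 1) (TangentSpace I : M → Type _)).mdifferentiableAt
      (by simp)).hasMFDerivAt
  have h3 : HasMFDerivAt I 𝓘(ℝ, E) (extChartAt I ξ₀.proj) ((extChartAt I.tangent ξ₀).symm y).proj _ :=
    (mdifferentiableAt_extChartAt' hsrc).hasMFDerivAt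
  have h4 : HasMFDerivAt 𝓘(ℝ, E × E) 𝓘(ℝ, E) (extChartAt I ξ₀.proj ∘
      π E (TangentSpace I : M → Type _) ∘ (extChartAt I.tangent ξ₀).symm) y _ :=
    HasMFDerivAt.comp y h3 (HasMFDerivAt.comp y h2 h1)
  have h5 : HasFDerivAt (extChartAt I ξ₀.proj ∘ π E (TangentSpace I : M → Type _) ∘
      (extChartAt I.tangent ξ₀).symm) (ContinuousLinearMap.fst ℝ E E) y := by
    refine (ContinuousLinearMap.fst ℝ E E).hasFDerivAt.congr_of_eventuallyEq ?_
    filter_upwards [(isOpen_extChartAt_target ξ₀).mem_nhds hy] with y' hy'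
    have hy1 := mem_tangent_extChartAt_target.1 hy'
    simp only [Function.comp_apply]
    rw [tangent_extChartAt_symm_apply hy1]
    exact (extChartAt I ξ₀.proj).right_inv hy1
  exact DFunLike.congr_fun (hasMFDerivAt_unique h4 h5.hasMFDerivAt) w

lemma inChart_poincareCartan {L : TangentBundle I M → ℝ} (hL : ContMDiff I.tangent 𝓘(ℝ, ℝ) ∞ L)
    {ξ₀ : TangentBundle I M} {y : E × E} (hy : y ∈ (extChartAt I.tangent ξ₀).target) :
    (poincareCartan L).inChart ξ₀ y = ContinuousAlternatingMap.ofSubsingleton ℝ (E × E) ℝ (0 : Fin 1)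
      ((fderiv ℝ (readInChart L ξ₀) y).comp (flatVerticalEndo E)) := by
  have hy1 := mem_tangent_extChartAt_target.1 hy
  ext w
  rw [DiffForm.inChart_apply]
  change differential I.tangent L _ (vLift I _ (mfderiv I.tangent I (π E (TangentSpace I : M → Type _)) _
    (mfderiv 𝓘(ℝ, E × E) I.tangent (extChartAt I.tangent ξ₀).symm y (w 0)))) =
    fderiv ℝ (readInChart L ξ₀) y (0, (w 0).1)
  set ξ := (extChartAt I.tangent ξ₀).symm y with hξ
  set u := mfderiv I.tangent I (π E (TangentSpace I : M → Type _)) ξ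
    (mfderiv 𝓘(ℝ, E × E) I.tangent (extChartAt I.tangent ξ₀).symm y (w 0)) with hu
  have hsrc : ξ.proj ∈ (extChartAt I ξ₀.proj).source :=
    mem_tangent_extChartAt_source.1 ((extChartAt I.tangent ξ₀).map_target hy)
  have hline : ∀ t : ℝ, L ⟨ξ.proj, ξ.2 + t • u⟩ = readInChart L ξ₀ (y + t • (0, (w 0).1)) := by
    intro t
    have h1 : (⟨ξ.proj, ξ.2 + t • u⟩ : TangentBundle I M) ∈ (extChartAt I.tangent ξ₀).source :=
      mem_tangent_extChartAt_source.2 hsrc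
    have h2 : extChartAt I.tangent ξ₀ ⟨ξ.proj, ξ.2 + t • u⟩ = y + t • (0, (w 0).1) := by
      have h3 : extChartAt I.tangent ξ₀ ξ = y := (extChartAt I.tangent ξ₀).right_inv hy
      rw [tangent_extChartAt_apply hsrc] at h3
      rw [tangent_extChartAt_apply (ξ := ⟨ξ.proj, ξ.2 + t • u⟩) hsrc, ← h3]
      refine Prod.ext ?_ ?_
      · change extChartAt I ξ₀.proj ξ.proj = extChartAt I ξ₀.proj ξ.proj + t • (0 : E)
        rw [smul_zero, add_zero]
      · have h4 : mfderiv I 𝓘(ℝ, E) (extChartAt I ξ₀.proj) ξ.proj u = (w 0).1 :=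
          mfderiv_proj_extChartAt_symm hy (w 0)
        refine (map_add (mfderiv I 𝓘(ℝ, E) (extChartAt I ξ₀.proj) ξ.proj) ξ.2 (t • u)).trans ?_
        rw [map_smul, h4]
        rfl
    rw [← (extChartAt I.tangent ξ₀).left_inv h1, h2]
    rfl
  have h1 := differential_vLift hL ξ u
  have h2 : HasDerivAt (fun t : ℝ => readInChart L ξ₀ (y + t • (0, (w 0).1)))
      (fderiv ℝ (readInChart L ξ₀) y (0, (w 0).1)) 0 := by
    have h3 : HasFDerivAt (readInChart L ξ₀) (fderiv ℝ (readInChart L ξ₀) y)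
        (y + (0 : ℝ) • (0, (w 0).1)) := by
      rw [zero_smul, add_zero]
      exact ((contDiffAt_readInChart hL hy).differentiableAt (by simp)).hasFDerivAt
    have h4 : HasDerivAt (fun t : ℝ => y + t • ((0, (w 0).1) : E × E)) (0, (w 0).1) 0 := by
      simpa using ((hasDerivAt_id (0 : ℝ)).smul_const ((0, (w 0).1) : E × E)).const_add y
    exact h3.comp_hasDerivAt (0 : ℝ) h4
  exact (funext hline ▸ h1).unique h2

lemma smoothOn_poincareCartan {L : TangentBundle I M → ℝ}
    (hL : ContMDiff I.tangent 𝓘(ℝ, ℝ) ∞ L) : (poincareCartan L).SmoothOn univ := by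
  intro ξ₀
  rw [preimage_univ, inter_univ]
  intro y hy
  apply ContDiffAt.contDiffWithinAt
  let A : (E × E →L[ℝ] ℝ) →L[ℝ] (E × E) [⋀^Fin 1]→L[ℝ] ℝ :=
    (ContinuousAlternatingMap.ofSubsingletonLIE (𝕜 := ℝ) (E := E × E) (F := ℝ)
      (0 : Fin 1)).toContinuousLinearEquiv.toContinuousLinearMap.comp
      ((ContinuousLinearMap.compL ℝ (E × E) (E × E) ℝ).flip (flatVerticalEndo E))
  have h : ContDiffAt ℝ ∞ (A ∘ fderiv ℝ (readInChart L ξ₀)) y :=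
    A.contDiff.contDiffAt.comp y ((contDiffAt_readInChart hL hy).fderiv_right (m := ∞) (by simp))
  refine h.congr_of_eventuallyEq ?_
  filter_upwards [(isOpen_extChartAt_target ξ₀).mem_nhds hy] with y' hy'
  exact inChart_poincareCartan hL hy'

lemma smoothOn_lagrangianForm {L : TangentBundle I M → ℝ}
    (hL : ContMDiff I.tangent 𝓘(ℝ, ℝ) ∞ L) : (lagrangianForm L).SmoothOn univ :=
  (smoothOn_poincareCartan hL).d.neg

lemma d_lagrangianForm {L : TangentBundle I M → ℝ}
    (hL : ContMDiff I.tangent 𝓘(ℝ, ℝ) ∞ L) (ξ : TangentBundle I M) :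
    (lagrangianForm L).d ξ = 0 := by
  have h := DiffForm.d_neg (poincareCartan L).d ξ
  rw [DiffForm.d_d (smoothOn_poincareCartan hL), neg_zero] at h
  exact h

/-- The Lagrangian two-form at `ξ` through the Hessian of the Lagrangian in the preferred chart
at `ξ`. -/
lemma lagrangianForm_apply {L : TangentBundle I M → ℝ} (hL : ContMDiff I.tangent 𝓘(ℝ, ℝ) ∞ L)
    (ξ : TangentBundle I M) (w w' : E × E) :
    lagrangianForm L ξ ![w, w'] =
      fderiv ℝ (fderiv ℝ (readInChart L ξ)) (extChartAt I.tangent ξ ξ) w' (0, w.1) -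
      fderiv ℝ (fderiv ℝ (readInChart L ξ)) (extChartAt I.tangent ξ ξ) w (0, w'.1) := by
  set y := extChartAt I.tangent ξ ξ with hy
  have hyt : y ∈ (extChartAt I.tangent ξ).target := mem_extChartAt_target ξ
  have hsm := (smoothOn_poincareCartan hL).contDiffAt_inChart hyt
  have hdiff : DifferentiableAt ℝ (fderiv ℝ (readInChart L ξ)) y :=
    ((contDiffAt_readInChart hL hyt).fderiv_right (m := ∞) (by simp)).differentiableAt (by simp)
  have key : ∀ u u' : E × E, fderiv ℝ (fun y' => (poincareCartan L).inChart ξ y' ![u']) y u =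
      fderiv ℝ (fderiv ℝ (readInChart L ξ)) y u (0, u'.1) := by
    intro u u'
    have h3 : (fun y' => (poincareCartan L).inChart ξ y' ![u']) =ᶠ[𝓝 y]
        fun y' => fderiv ℝ (readInChart L ξ) y' (0, u'.1) := by
      filter_upwards [(isOpen_extChartAt_target ξ).mem_nhds hyt] with y' hy'
      rw [inChart_poincareCartan hL hy']
      rfl
    rw [h3.fderiv_eq, fderiv_clm_apply hdiff (differentiableAt_const _)]
    simp
  have h1 : lagrangianForm L ξ ![w, w'] = -extDeriv ((poincareCartan L).inChart ξ) y ![w, w'] := by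
    change -((poincareCartan L).d ξ ![w, w']) = _
    rw [DiffForm.d_apply]
    congr 2
    funext i
    rw [mfderiv_extChartAt_self]
    rfl
  rw [h1, extDeriv_apply (hsm.differentiableAt (by simp)), Fin.sum_univ_two]
  have h2 : (0 : Fin 2).removeNth ![w, w'] = ![w'] := by
    funext i; fin_cases i; rfl
  have h3 : (1 : Fin 2).removeNth ![w, w'] = ![w] := by
    funext i; fin_cases i; rfl
  rw [h2, h3]
  have h4 := key w w'
  have h5 := key w' w
  simp only [Fin.val_zero, pow_zero, Fin.val_one, pow_one, Matrix.cons_val_zero,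
    Matrix.cons_val_one, h4, h5]
  rw [one_smul, neg_one_smul, neg_add_rev, neg_neg, sub_eq_add_neg]

end LagrangianCharts

/-! ### Maps which are linear in preferred charts -/

section LinearInCharts

variable {E : Type*} [NormedAddCommGroup E] [NormedSpace ℝ E]
  {H : Type*} [TopologicalSpace H] {I : ModelWithCorners ℝ E H} [I.Boundaryless]
  {M : Type*} [TopologicalSpace M] [ChartedSpace H M] [IsManifold I ∞ M]
  {E' : Type*} [NormedAddCommGroup E'] [NormedSpace ℝ E']
  {H' : Type*} [TopologicalSpace H'] {J : ModelWithCorners ℝ E' H'} [J.Boundaryless]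
  {N : Type*} [TopologicalSpace N] [ChartedSpace H' N] [IsManifold J ∞ N]

/-- A map which is given by the linear map `A` in the preferred charts has derivative `A`. -/
lemma hasMFDerivAt_of_linear_in_charts {f : M → N} {x : M} (hf : ContinuousAt f x) (A : E →L[ℝ] E')
    (h : ∀ᶠ x' in 𝓝 x, extChartAt J (f x) (f x') = A (extChartAt I x x')) :
    HasMFDerivAt I J f x A := by
  refine ⟨hf, ?_⟩
  rw [I.range_eq_univ]
  apply HasFDerivAt.hasFDerivWithinAt
  refine A.hasFDerivAt.congr_of_eventuallyEq ?_
  have h1 := (continuousAt_extChartAt_symm (I := I) x).tendsto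
  rw [extChartAt_to_inv] at h1
  filter_upwards [h1.eventually h, (isOpen_extChartAt_target x).mem_nhds (mem_extChartAt_target x)]
    with y hy hyt
  simp only [writtenInExtChartAt, Function.comp_apply]
  rw [hy, (extChartAt I x).right_inv hyt]

lemma extChartAt_tangentMap_of_linear_in_charts {f : M → N} {ξ₀ ξ : TangentBundle I M}
    {η₀ : TangentBundle J N} (hf : MDifferentiableAt I J f ξ.proj) (A : E →L[ℝ] E')
    (hξ : ξ.proj ∈ (extChartAt I ξ₀.proj).source) (hη : f ξ.proj ∈ (extChartAt J η₀.proj).source)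
    (h : ∀ᶠ x' in 𝓝 ξ.proj, extChartAt J η₀.proj (f x') = A (extChartAt I ξ₀.proj x')) :
    extChartAt J.tangent η₀ (tangentMap I J f ξ) =
      (A (extChartAt I.tangent ξ₀ ξ).1, A (extChartAt I.tangent ξ₀ ξ).2) := by
  rw [tangent_extChartAt_apply hξ, tangent_extChartAt_apply (ξ := tangentMap I J f ξ) hη]
  refine Prod.ext h.self_of_nhds ?_
  have h1 : HasMFDerivAt I 𝓘(ℝ, E') (extChartAt J η₀.proj ∘ f) ξ.proj _ :=
    HasMFDerivAt.comp ξ.proj (mdifferentiableAt_extChartAt' hη).hasMFDerivAt hf.hasMFDerivAt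
  have h2 : HasMFDerivAt I 𝓘(ℝ, E') (A ∘ extChartAt I ξ₀.proj) ξ.proj _ :=
    HasMFDerivAt.comp ξ.proj A.hasFDerivAt.hasMFDerivAt
      (mdifferentiableAt_extChartAt' hξ).hasMFDerivAt
  exact DFunLike.congr_fun (hasMFDerivAt_unique h1 (h2.congr_of_eventuallyEq h)) ξ.2

end LinearInCharts

section Nondegenerate

variable {E : Type*} [NormedAddCommGroup E] [NormedSpace ℝ E] [FiniteDimensional ℝ E]
  {H : Type*} [TopologicalSpace H] {I : ModelWithCorners ℝ E H} [I.Boundaryless]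
  {M : Type*} [TopologicalSpace M] [ChartedSpace H M] [IsManifold I ∞ M]

namespace DiffForm

/-- A two-form on a vector space as a map to the dual space. -/
def curryTwo (E : Type*) [NormedAddCommGroup E] [NormedSpace ℝ E] :
    (E [⋀^Fin 2]→L[ℝ] ℝ) →L[ℝ] (E →L[ℝ] E →L[ℝ] ℝ) :=
  (ContinuousLinearMap.compL ℝ E (E [×1]→L[ℝ] ℝ) (E →L[ℝ] ℝ)
    (continuousMultilinearCurryFin1 ℝ E ℝ).toContinuousLinearEquiv.toContinuousLinearMap).comp
  ((continuousMultilinearCurryLeftEquiv ℝ (fun _ : Fin 2 => E) ℝ).toContinuousLinearEquiv.toContinuousLinearMap.comp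
    (ContinuousAlternatingMap.toContinuousMultilinearMapCLM ℝ))

lemma curryTwo_apply (σ : E [⋀^Fin 2]→L[ℝ] ℝ) (w u : E) : curryTwo E σ w u = σ ![w, u] := by
  change σ (Fin.cons w (Fin.snoc 0 u)) = σ ![w, u]
  congr 1
  funext i
  fin_cases i <;> rfl

lemma injective_curryTwo_inChart_iff (σ : DiffForm I M 2) {x₀ : M} {y : E}
    (hy : y ∈ (extChartAt I x₀).target) :
    Function.Injective (curryTwo E (σ.inChart x₀ y)) ↔ σ.ker ((extChartAt I x₀).symm y) = ⊥ := by
  have happ : ∀ w u : E, curryTwo E (σ.inChart x₀ y) w u = σ ((extChartAt I x₀).symm y)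
      ![mfderiv 𝓘(ℝ, E) I (extChartAt I x₀).symm y w,
        mfderiv 𝓘(ℝ, E) I (extChartAt I x₀).symm y u] := by
    intro w u
    rw [curryTwo_apply, inChart_apply]
    congr 1
    funext i
    fin_cases i <;> rfl
  rw [injective_iff_map_eq_zero, Submodule.eq_bot_iff]
  constructor
  · intro h w hw
    have h1 := h (mfderiv I 𝓘(ℝ, E) (extChartAt I x₀) ((extChartAt I x₀).symm y) w) (by
      ext u
      refine (happ _ u).trans ?_
      have h2 := hw (mfderiv 𝓘(ℝ, E) I (extChartAt I x₀).symm y u)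
      rw [← mfderiv_extChartAt_symm_right hy w] at h2
      exact h2)
    rw [← mfderiv_extChartAt_symm_right hy w]
    exact (congrArg _ h1).trans (map_zero _)
  · intro h w hw
    have h1 := h (mfderiv 𝓘(ℝ, E) I (extChartAt I x₀).symm y w) (fun u => by
      rw [← mfderiv_extChartAt_symm_right hy u]
      refine (happ w _).symm.trans ?_
      rw [hw]
      rfl)
    rw [← mfderiv_extChartAt_symm_left hy w, h1]
    exact map_zero _

lemma isOpen_setOf_ker_eq_bot {σ : DiffForm I M 2} (hσ : σ.SmoothOn univ) :
    IsOpen {x | σ.ker x = ⊥} := by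
  rw [isOpen_iff_mem_nhds]
  intro x hx
  have hcont : ContinuousAt (fun y => curryTwo E (σ.inChart x y)) (extChartAt I x x) :=
    (curryTwo E).continuous.continuousAt.comp
      (hσ.contDiffAt_inChart (mem_extChartAt_target x)).continuousAt
  have h1 : Function.Injective (curryTwo E (σ.inChart x (extChartAt I x x))) := by
    rw [σ.injective_curryTwo_inChart_iff (mem_extChartAt_target x), extChartAt_to_inv]
    exact hx
  have h2 := (hcont.comp (continuousAt_extChartAt x)).eventually
    (ContinuousLinearMap.isOpen_injective.mem_nhds h1)
  filter_upwards [h2, extChartAt_source_mem_nhds (I := I) x] with x' hx' hsrc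
  have h3 := (σ.injective_curryTwo_inChart_iff ((extChartAt I x).map_source hsrc)).1 hx'
  rwa [(extChartAt I x).left_inv hsrc] at h3

end DiffForm
end Nondegenerate

/-! ### Smooth coframes -/

section Coframes

variable {E : Type*} [NormedAddCommGroup E] [NormedSpace ℝ E] [FiniteDimensional ℝ E]
  {H : Type*} [TopologicalSpace H] {I : ModelWithCorners ℝ E H}
  {M : Type*} [TopologicalSpace M] [ChartedSpace H M]

/-- Smooth vector-valued functions which are independent at a point have a smooth dual system near
that point. -/
lemma exists_dual_system {F : Type*} [NormedAddCommGroup F] [NormedSpace ℝ F]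
    [FiniteDimensional ℝ F] {ι : Type*} [Fintype ι] [DecidableEq ι] {g : ι → M → F} {x₁ : M}
    (hg : ∀ i, ContMDiffAt I 𝓘(ℝ, F) ∞ (g i) x₁) (hli : LinearIndependent ℝ fun i => g i x₁) :
    ∃ B : M → F →L[ℝ] (ι → ℝ), ContMDiffAt I 𝓘(ℝ, F →L[ℝ] (ι → ℝ)) ∞ B x₁ ∧
      ∀ᶠ x in 𝓝 x₁, ∀ j, B x (g j x) = Pi.single j 1 := by
  let S : M → (ι → ℝ) →L[ℝ] F := fun x =>
    ∑ i, (ContinuousLinearMap.proj (R := ℝ) (φ := fun _ : ι => ℝ) i).smulRight (g i x)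
  have hS : ContMDiffAt I 𝓘(ℝ, (ι → ℝ) →L[ℝ] F) ∞ S x₁ := by
    apply ContMDiffAt.sum
    intro i _
    exact ((ContinuousLinearMap.smulRightL ℝ (ι → ℝ) F
      (ContinuousLinearMap.proj (R := ℝ) (φ := fun _ : ι => ℝ) i)).contMDiff.contMDiffAt).comp
      x₁ (hg i)
  have hSapp : ∀ x (c : ι → ℝ), S x c = ∑ i, c i • g i x := by
    intro x c
    simp [S]
  have hinj : LinearMap.ker (S x₁ : (ι → ℝ) →ₗ[ℝ] F) = ⊥ := by
    rw [LinearMap.ker_eq_bot']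
    intro c hc
    have h1 : S x₁ c = 0 := hc
    rw [hSapp] at h1
    funext i
    exact Fintype.linearIndependent_iff.1 hli c h1 i
  obtain ⟨l, hl⟩ := (S x₁ : (ι → ℝ) →ₗ[ℝ] F).exists_leftInverse_of_injective hinj
  let l' : F →L[ℝ] (ι → ℝ) := LinearMap.toContinuousLinearMap l
  have hl' : l'.comp (S x₁) = ContinuousLinearMap.id ℝ _ := by
    ext c : 1
    exact LinearMap.congr_fun hl c
  let G : M → (ι → ℝ) →L[ℝ] (ι → ℝ) := fun x => l'.comp (S x)
  have hG : ContMDiffAt I 𝓘(ℝ, (ι → ℝ) →L[ℝ] (ι → ℝ)) ∞ G x₁ := contMDiffAt_const.clm_comp hS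
  have hGp : G x₁ = ContinuousLinearEquiv.refl ℝ (ι → ℝ) := hl'
  have hGinv : ContMDiffAt I 𝓘(ℝ, (ι → ℝ) →L[ℝ] (ι → ℝ)) ∞ (fun x => (G x).inverse) x₁ := by
    have h : ContDiffAt ℝ ∞ ContinuousLinearMap.inverse (G x₁) := by
      rw [hGp]; exact contDiffAt_map_inverse _
    exact h.contMDiffAt.comp x₁ hG
  have hGunit : ∀ᶠ x in 𝓝 x₁, ∃ A : (ι → ℝ) ≃L[ℝ] (ι → ℝ), (A : _ →L[ℝ] _) = G x := by
    have h : range ((↑) : ((ι → ℝ) ≃L[ℝ] (ι → ℝ)) → (ι → ℝ) →L[ℝ] (ι → ℝ)) ∈ 𝓝 (G x₁) := by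
      rw [hGp]
      exact ContinuousLinearEquiv.nhds (ContinuousLinearEquiv.refl ℝ (ι → ℝ))
    exact hG.continuousAt h
  refine ⟨fun x => (G x).inverse.comp l', hGinv.clm_comp contMDiffAt_const, ?_⟩
  filter_upwards [hGunit] with x hA j
  obtain ⟨A, hA⟩ := hA
  have h1 : l' (g j x) = A (Pi.single j 1) := by
    have h2 : S x (Pi.single j 1) = g j x := by
      rw [hSapp, Finset.sum_eq_single j]
      · simp
      · intro i _ hij
        simp [hij]
      · simp
    rw [← h2]
    exact (DFunLike.congr_fun hA (Pi.single j 1)).symm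
  rw [ContinuousLinearMap.comp_apply, h1, ← hA, ContinuousLinearMap.inverse_equiv]
  simp

variable [I.Boundaryless] [IsManifold I ∞ M]

/-- The derivative at `x` of the preferred chart at `x₀`. -/
def chartDeriv (I : ModelWithCorners ℝ E H) (x₀ x : M) : TangentSpace I x →L[ℝ] E :=
  mfderiv I 𝓘(ℝ, E) (extChartAt I x₀) x

/-- A tangent vector read in the chart at `x₁` depends smoothly on the vector. -/
lemma contMDiffAt_chart_snd {x₁ : M} {v : TangentBundle I M}
    (hv : v.proj ∈ (extChartAt I x₁).source) :
    ContMDiffAt I.tangent 𝓘(ℝ, E) ∞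
      (fun w : TangentBundle I M => mfderiv I 𝓘(ℝ, E) (extChartAt I x₁) w.proj w.2) v := by
  have h1 : ContMDiffAt I.tangent 𝓘(ℝ, E × E) ∞
      (extChartAt I.tangent (⟨x₁, 0⟩ : TangentBundle I M)) v :=
    contMDiffAt_extChartAt' (by
      have := mem_tangent_extChartAt_source (ξ₀ := (⟨x₁, 0⟩ : TangentBundle I M)) (ξ := v)
      rw [← extChartAt_source I.tangent]
      exact this.2 hv)
  have h2 : ContMDiffAt I.tangent 𝓘(ℝ, E) ∞
      (fun w => (extChartAt I.tangent (⟨x₁, 0⟩ : TangentBundle I M) w).2) v :=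
    contDiff_snd.contMDiff.contMDiffAt.comp v h1
  refine h2.congr_of_eventuallyEq ?_
  have h3 : ∀ᶠ w : TangentBundle I M in 𝓝 v, w.proj ∈ (extChartAt I x₁).source :=
    (FiberBundle.continuous_proj E (TangentSpace I : M → Type _)).continuousAt.eventually
      ((isOpen_extChartAt_source x₁).mem_nhds hv)
  filter_upwards [h3] with w hw
  rw [tangent_extChartAt_apply (ξ₀ := ⟨x₁, 0⟩) hw]

/-- A map to the tangent bundle is smooth if its base and its reading in a chart are. -/
lemma contMDiffAt_tangentBundle {E' : Type*} [NormedAddCommGroup E'] [NormedSpace ℝ E']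
    {H' : Type*} [TopologicalSpace H'] {J : ModelWithCorners ℝ E' H'}
    {N : Type*} [TopologicalSpace N] [ChartedSpace H' N] {f : N → TangentBundle I M} {a : N}
    (h1 : ContMDiffAt J I ∞ (fun x => (f x).proj) a)
    (h2 : ContMDiffAt J 𝓘(ℝ, E) ∞
      (fun x => (mfderiv I 𝓘(ℝ, E) (extChartAt I (f a).proj) (f x).proj (f x).2 : E)) a) :
    ContMDiffAt J I.tangent ∞ f a := by
  rw [contMDiffAt_totalSpace]
  refine ⟨h1, h2.congr_of_eventuallyEq ?_⟩
  filter_upwards [h1.continuousAt.eventually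
    ((isOpen_extChartAt_source (f a).proj).mem_nhds (mem_extChartAt_source (I := I) _))] with x hx
  rw [extChartAt_source] at hx
  rw [← TangentBundle.continuousLinearMapAt_trivializationAt hx]
  exact (Trivialization.continuousLinearMapAt_apply_of_mem ℝ
    (trivializationAt E (TangentSpace I : M → Type _) (f a).proj) hx _).symm

lemma exists_coframe {ι : Type*} [Fintype ι] [DecidableEq ι]
    {s : ι → ∀ x : M, TangentSpace I x} {x₁ : M}
    (hs : ∀ i, ContMDiffAt I I.tangent ∞ (fun x => (⟨x, s i x⟩ : TangentBundle I M)) x₁)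
    (hli : LinearIndependent ℝ fun i => s i x₁) :
    ∃ Θ : ∀ x : M, TangentSpace I x →ₗ[ℝ] (ι → ℝ),
      (∀ v : TangentBundle I M, v.proj = x₁ →
        ContMDiffAt I.tangent 𝓘(ℝ, ι → ℝ) ∞ (fun w : TangentBundle I M => Θ w.proj w.2) v) ∧
      ∀ᶠ x in 𝓝 x₁, ∀ j, Θ x (s j x) = Pi.single j 1 := by
  let g : ι → M → E := fun i x => mfderiv I 𝓘(ℝ, E) (extChartAt I x₁) x (s i x)
  have hg : ∀ i, ContMDiffAt I 𝓘(ℝ, E) ∞ (g i) x₁ := fun i =>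
    (contMDiffAt_chart_snd (v := ⟨x₁, s i x₁⟩) (mem_extChartAt_source x₁)).comp x₁ (hs i)
  have hgli : LinearIndependent ℝ fun i => g i x₁ := by
    have h1 : (fun i => g i x₁) = fun i => s i x₁ := by
      funext i
      simp only [g]
      rw [mfderiv_extChartAt_self]
      rfl
    rw [h1]
    exact hli
  obtain ⟨B, hB, hB'⟩ := exists_dual_system hg hgli
  refine ⟨fun x => (B x : E →ₗ[ℝ] (ι → ℝ)) ∘ₗ
    (chartDeriv I x₁ x : TangentSpace I x →ₗ[ℝ] E), ?_, hB'⟩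
  rintro v rfl
  exact (ContMDiffAt.comp v hB (contMDiffAt_proj (TangentSpace I : M → Type _))).clm_apply
    (contMDiffAt_chart_snd (mem_extChartAt_source v.proj))

end Coframes

namespace RegularDistribution

section DualSmooth

variable {E : Type*} [NormedAddCommGroup E] [NormedSpace ℝ E] [FiniteDimensional ℝ E]
  {H : Type*} [TopologicalSpace H] {I : ModelWithCorners ℝ E H} [I.Boundaryless]
  {M : Type*} [TopologicalSpace M] [ChartedSpace H M] [IsManifold I ∞ M] {r : ℕ}
  (D : RegularDistribution I M r)

lemma finrank_space (x : M) : Module.finrank ℝ (D.space x) = r := by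
  rw [Module.finrank_eq_card_basis (D.frameBasis x (D.mem_frameSet x)), Fintype.card_fin]

lemma isSectionAt_frame (x₀ : M) (i : Fin r) {x : M} (hx : x ∈ D.frameSet x₀) :
    D.IsSectionAt (D.frame x₀ i) x := by
  refine ⟨(D.contMDiffOn_frame x₀ i).contMDiffAt ((D.isOpen_frameSet x₀).mem_nhds hx), ?_⟩
  filter_upwards [(D.isOpen_frameSet x₀).mem_nhds hx] with p hp
  rw [← D.coe_frameBasis x₀ hp i]
  exact (D.frameBasis x₀ hp i).2

/-- A local frame of a distribution consisting of smooth sections has a smooth coframe. -/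
lemma exists_coframe_of_sections {ι : Type*} [Fintype ι] [DecidableEq ι]
    (hcard : Fintype.card ι = r) {s : ι → ∀ x : M, TangentSpace I x} {x₁ : M}
    (hs : ∀ i, D.IsSectionAt (s i) x₁) (hli : LinearIndependent ℝ fun i => s i x₁) :
    ∃ Θ : ∀ x : M, TangentSpace I x →ₗ[ℝ] (ι → ℝ),
      (∀ v : TangentBundle I M, v.proj = x₁ →
        ContMDiffAt I.tangent 𝓘(ℝ, ι → ℝ) ∞ (fun w : TangentBundle I M => Θ w.proj w.2) v) ∧
      (∀ᶠ x in 𝓝 x₁, ∀ j, Θ x (s j x) = Pi.single j 1) ∧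
      ∀ᶠ x in 𝓝 x₁, ∀ w ∈ D.space x, w = ∑ i, Θ x w i • s i x := by
  obtain ⟨Θ, h1, h2⟩ := exists_coframe (fun i => (hs i).1) hli
  refine ⟨Θ, h1, h2, ?_⟩
  filter_upwards [h2, Filter.eventually_all.2 fun i => (hs i).2] with x hx hxD w hw
  have hind : LinearIndependent ℝ fun i => (⟨s i x, hxD i⟩ : D.space x) := by
    rw [Fintype.linearIndependent_iff]
    intro c hc i
    have h3 : ∑ i, c i • s i x = 0 := by
      have := congrArg (Subtype.val) hc
      simpa using this
    have h4 := congrFun (congrArg (Θ x) h3) i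
    simpa [hx, Finset.sum_apply, Pi.single_apply] using h4
  have := D.finiteDimensional_space x
  have hspan := hind.span_eq_top_of_card_eq_finrank' (by rw [hcard, D.finrank_space])
  have hmem : (⟨w, hw⟩ : D.space x) ∈ Submodule.span ℝ (range fun i => (⟨s i x, hxD i⟩ : D.space x)) := by
    rw [hspan]; trivial
  obtain ⟨c, hc⟩ := (Submodule.mem_span_range_iff_exists_fun ℝ).1 hmem
  have h3 : ∑ i, c i • s i x = w := by
    have := congrArg (Subtype.val) hc
    simpa using this
  have h4 : Θ x w = c := by
    rw [← h3]
    funext i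
    simp [hx, Finset.sum_apply, Pi.single_apply]
  rw [h4, h3]

open Classical in
/-- The fibrewise linear function on the dual bundle given by a section of the distribution
(zero where the value is not in the distribution). -/
def evalSec (s : ∀ x : M, TangentSpace I x) (z : D.DualTotal) : ℝ :=
  if h : s z.proj ∈ D.space z.proj then D.pair z.2 ⟨s z.proj, h⟩ else 0

lemma evalSec_of_mem {s : ∀ x : M, TangentSpace I x} {z : D.DualTotal}
    (h : s z.proj ∈ D.space z.proj) : D.evalSec s z = D.pair z.2 ⟨s z.proj, h⟩ := dif_pos h

lemma trivializationAt_snd (x₀ : M) {z : D.DualTotal} (hz : z.proj ∈ D.frameSet x₀) :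
    (trivializationAt (Fin r → ℝ) D.Dual x₀ z).2 = D.dualCoord x₀ hz z.2 :=
  D.pretriv_apply x₀ hz z.2

lemma trivializationAt_snd_apply (x₀ : M) {z : D.DualTotal} (hz : z.proj ∈ D.frameSet x₀)
    (i : Fin r) : (trivializationAt (Fin r → ℝ) D.Dual x₀ z).2 i = D.evalSec (D.frame x₀ i) z := by
  have h1 := D.coe_frameBasis x₀ hz i
  have h2 : D.frame x₀ i z.proj ∈ D.space z.proj := by
    rw [← h1]; exact (D.frameBasis x₀ hz i).2
  rw [D.trivializationAt_snd x₀ hz, dualCoord_apply, D.evalSec_of_mem h2]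
  congr 1
  exact Subtype.ext h1

/-- The pairing of an element of the dual with a vector, computed in a local frame. -/
lemma pair_eq_sum {ι : Type*} [Fintype ι] {s : ι → ∀ x : M, TangentSpace I x} {z : D.DualTotal}
    (hs : ∀ i, s i z.proj ∈ D.space z.proj) (w : D.space z.proj) (c : ι → ℝ)
    (hw : (w : TangentSpace I z.proj) = ∑ i, c i • s i z.proj) :
    D.pair z.2 w = ∑ i, c i * D.evalSec (s i) z := by
  have h1 : w = ∑ i, c i • (⟨s i z.proj, hs i⟩ : D.space z.proj) := by
    apply Subtype.ext
    rw [hw]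
    simp
  rw [h1, map_sum]
  refine Finset.sum_congr rfl fun i _ => ?_
  rw [map_smul, smul_eq_mul, D.evalSec_of_mem (hs i)]

lemma evalSec_eq_sum {ι : Type*} [Fintype ι] {s : ι → ∀ x : M, TangentSpace I x}
    {t : ∀ x : M, TangentSpace I x} {z : D.DualTotal} (hs : ∀ i, s i z.proj ∈ D.space z.proj)
    (c : ι → ℝ) (hw : t z.proj = ∑ i, c i • s i z.proj) :
    D.evalSec t z = ∑ i, c i * D.evalSec (s i) z := by
  have h1 : t z.proj ∈ D.space z.proj := by
    rw [hw]
    exact Submodule.sum_mem _ fun i _ => Submodule.smul_mem _ _ (hs i)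
  rw [D.evalSec_of_mem h1]
  exact D.pair_eq_sum hs _ c hw

lemma contMDiffAt_evalSec_frame (x₀ : M) (i : Fin r) {z : D.DualTotal}
    (hz : z.proj ∈ D.frameSet x₀) :
    ContMDiffAt (dualModel I r) 𝓘(ℝ, ℝ) ∞ (D.evalSec (D.frame x₀ i)) z := by
  have h1 : ContMDiffAt (dualModel I r) (I.prod 𝓘(ℝ, Fin r → ℝ)) ∞
      (trivializationAt (Fin r → ℝ) D.Dual x₀) z :=
    (Trivialization.contMDiffOn (trivializationAt (Fin r → ℝ) D.Dual x₀)).contMDiffAt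
      ((trivializationAt (Fin r → ℝ) D.Dual x₀).open_source.mem_nhds
        ((trivializationAt (Fin r → ℝ) D.Dual x₀).mem_source.2 hz))
  have h2 := contMDiffAt_pi_space.1 (contMDiffAt_snd.comp z h1) i
  refine h2.congr_of_eventuallyEq ?_
  have h3 : ∀ᶠ z' : D.DualTotal in 𝓝 z, z'.proj ∈ D.frameSet x₀ :=
    (FiberBundle.continuous_proj (Fin r → ℝ) D.Dual).continuousAt.eventually
      ((D.isOpen_frameSet x₀).mem_nhds hz)
  filter_upwards [h3] with z' hz'
  exact (D.trivializationAt_snd_apply x₀ hz' i).symm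

lemma contMDiffAt_evalSec {s : ∀ x : M, TangentSpace I x} {z : D.DualTotal}
    (hs : D.IsSectionAt s z.proj) :
    ContMDiffAt (dualModel I r) 𝓘(ℝ, ℝ) ∞ (D.evalSec s) z := by
  have hmem := D.mem_frameSet z.proj
  obtain ⟨Θ, h1, -, h3⟩ := D.exists_coframe_of_sections (Fintype.card_fin r)
    (fun i => D.isSectionAt_frame z.proj i hmem) (D.linearIndependent_frame z.proj hmem)
  have h4 : ContMDiffAt (dualModel I r) 𝓘(ℝ, Fin r → ℝ) ∞
      (fun z' : D.DualTotal => Θ z'.proj (s z'.proj)) z :=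
    (ContMDiffAt.comp (f := fun x => (⟨x, s x⟩ : TangentBundle I M)) z.proj
      (h1 ⟨z.proj, s z.proj⟩ rfl) hs.1).comp z (contMDiffAt_proj D.Dual)
  have h5 : ContMDiffAt (dualModel I r) 𝓘(ℝ, ℝ) ∞ (fun z' : D.DualTotal =>
      ∑ i, Θ z'.proj (s z'.proj) i * D.evalSec (D.frame z.proj i) z') z := by
    apply ContMDiffAt.sum
    intro i _
    exact (contMDiffAt_pi_space.1 h4 i).mul (D.contMDiffAt_evalSec_frame z.proj i hmem)
  refine h5.congr_of_eventuallyEq ?_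
  have hcont := (FiberBundle.continuous_proj (Fin r → ℝ) D.Dual).continuousAt (x := z)
  filter_upwards [hcont.eventually h3, hcont.eventually hs.2,
    hcont.eventually ((D.isOpen_frameSet z.proj).mem_nhds hmem)] with z' h6 h7 h8
  apply D.evalSec_eq_sum
  · intro i
    exact (D.isSectionAt_frame z.proj i h8).2.self_of_nhds
  · exact h6 _ h7

/-- A map to the dual bundle is smooth if its base and its pairings with a local frame are. -/
lemma contMDiffAt_dualTotal {E' : Type*} [NormedAddCommGroup E'] [NormedSpace ℝ E']
    {H' : Type*} [TopologicalSpace H'] {J : ModelWithCorners ℝ E' H'}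
    {N : Type*} [TopologicalSpace N] [ChartedSpace H' N] {f : N → D.DualTotal} {a : N}
    {ι : Type*} [Fintype ι] [DecidableEq ι] (hcard : Fintype.card ι = r)
    {s : ι → ∀ x : M, TangentSpace I x}
    (hs : ∀ i, D.IsSectionAt (s i) (f a).proj) (hli : LinearIndependent ℝ fun i => s i (f a).proj)
    (h1 : ContMDiffAt J I ∞ (fun x => (f x).proj) a)
    (h2 : ∀ i, ContMDiffAt J 𝓘(ℝ, ℝ) ∞ (fun x => D.evalSec (s i) (f x)) a) :
    ContMDiffAt J (dualModel I r) ∞ f a := by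
  rw [contMDiffAt_totalSpace]
  refine ⟨h1, contMDiffAt_pi_space.2 fun j => ?_⟩
  obtain ⟨Θ, h3, -, h5⟩ := D.exists_coframe_of_sections hcard hs hli
  have hmem := D.mem_frameSet (f a).proj
  have h6 : ContMDiffAt J 𝓘(ℝ, ι → ℝ) ∞
      (fun x => Θ (f x).proj (D.frame (f a).proj j (f x).proj)) a :=
    (ContMDiffAt.comp (f := fun x => (⟨x, D.frame (f a).proj j x⟩ : TangentBundle I M)) (f a).proj
      (h3 ⟨(f a).proj, _⟩ rfl) (D.isSectionAt_frame (f a).proj j hmem).1).comp a h1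
  have h7 : ContMDiffAt J 𝓘(ℝ, ℝ) ∞ (fun x =>
      ∑ i, Θ (f x).proj (D.frame (f a).proj j (f x).proj) i * D.evalSec (s i) (f x)) a := by
    apply ContMDiffAt.sum
    intro i _
    exact (contMDiffAt_pi_space.1 h6 i).mul (h2 i)
  refine h7.congr_of_eventuallyEq ?_
  filter_upwards [h1.continuousAt.eventually h5,
    h1.continuousAt.eventually (Filter.eventually_all.2 fun i => (hs i).2),
    h1.continuousAt.eventually ((D.isOpen_frameSet (f a).proj).mem_nhds hmem)] with x h8 h9 h10
  rw [D.trivializationAt_snd_apply _ h10]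
  exact D.evalSec_eq_sum h9 _ (h8 _ (D.isSectionAt_frame (f a).proj j h10).2.self_of_nhds)

end DualSmooth
end RegularDistribution

/-! ### Complete and vertical lifts -/

section MDiffApply

variable {E : Type*} [NormedAddCommGroup E] [NormedSpace ℝ E] [FiniteDimensional ℝ E]
  {H : Type*} [TopologicalSpace H] {I : ModelWithCorners ℝ E H} [I.Boundaryless]
  {M : Type*} [TopologicalSpace M] [ChartedSpace H M] [IsManifold I ∞ M]
  {F : Type*} [NormedAddCommGroup F] [NormedSpace ℝ F]

/-- The derivative of a vector-valued function as a function on the tangent bundle. -/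
def mdiffApply (I : ModelWithCorners ℝ E H) (f : M → F) (v : TangentBundle I M) : F :=
  mfderiv I 𝓘(ℝ, F) f v.proj v.2

lemma mdiffApply_congr {f g : M → F} {v : TangentBundle I M} (h : f =ᶠ[𝓝 v.proj] g) :
    mdiffApply I f v = mdiffApply I g v := by
  rw [mdiffApply, h.mfderiv_eq]
  rfl

lemma mdiffApply_of_hasMFDerivAt {f : M → F} {v : TangentBundle I M}
    {f' : TangentSpace I v.proj →L[ℝ] F} (h : HasMFDerivAt I 𝓘(ℝ, F) f v.proj f') :
    mdiffApply I f v = f' v.2 := by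
  rw [mdiffApply, h.mfderiv]
  rfl

/-- The derivative computed in the preferred chart at another point. -/
lemma mdiffApply_eq_fderiv {f : M → F} {x₀ : M} {v : TangentBundle I M}
    (hf : MDifferentiableAt I 𝓘(ℝ, F) f v.proj) (hv : v.proj ∈ (extChartAt I x₀).source) :
    mdiffApply I f v = fderiv ℝ (f ∘ (extChartAt I x₀).symm) (extChartAt I x₀ v.proj)
      (chartDeriv I x₀ v.proj v.2) := by
  have hy := (extChartAt I x₀).map_source hv
  have h1 : MDifferentiableAt I 𝓘(ℝ, F) f ((extChartAt I x₀).symm (extChartAt I x₀ v.proj)) := by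
    rwa [(extChartAt I x₀).left_inv hv]
  have h2 : MDifferentiableAt 𝓘(ℝ, E) 𝓘(ℝ, F) (f ∘ (extChartAt I x₀).symm)
      (extChartAt I x₀ v.proj) := h1.comp _ (mdifferentiableAt_extChartAt_symm' hy)
  have h3 : HasMFDerivAt I 𝓘(ℝ, F) ((f ∘ (extChartAt I x₀).symm) ∘ extChartAt I x₀) v.proj _ :=
    HasMFDerivAt.comp v.proj h2.hasMFDerivAt (mdifferentiableAt_extChartAt' hv).hasMFDerivAt
  have h4 : f =ᶠ[𝓝 v.proj] (f ∘ (extChartAt I x₀).symm) ∘ extChartAt I x₀ := by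
    filter_upwards [(isOpen_extChartAt_source x₀).mem_nhds hv] with x hx
    simp only [Function.comp_apply]
    rw [(extChartAt I x₀).left_inv hx]
  rw [mdiffApply_of_hasMFDerivAt (h3.congr_of_eventuallyEq h4), mfderiv_eq_fderiv]
  rfl

lemma differentiableAt_comp_extChartAt_symm {f : M → F} {x : M}
    (hf : MDifferentiableAt I 𝓘(ℝ, F) f x) :
    DifferentiableAt ℝ (f ∘ (extChartAt I x).symm) (extChartAt I x x) := by
  have h1 : MDifferentiableAt I 𝓘(ℝ, F) f ((extChartAt I x).symm (extChartAt I x x)) := by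
    rwa [extChartAt_to_inv]
  exact (h1.comp _ (mdifferentiableAt_extChartAt_symm'
    (mem_extChartAt_target x))).differentiableAt

lemma chartDeriv_self (x : M) (v : TangentSpace I x) : chartDeriv I x x v = v := by
  rw [chartDeriv, mfderiv_extChartAt_self]
  rfl

/-- The derivative computed in the preferred chart at the base point. -/
lemma mdiffApply_self {f : M → F} {v : TangentBundle I M}
    (hf : MDifferentiableAt I 𝓘(ℝ, F) f v.proj) :
    mdiffApply I f v = fderiv ℝ (f ∘ (extChartAt I v.proj).symm) (extChartAt I v.proj v.proj)
      v.2 := by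
  rw [mdiffApply_eq_fderiv hf (mem_extChartAt_source v.proj), chartDeriv_self]

lemma mdifferentiableAt_of_hasFDerivAt {f : M → F} {x : M} {f' : E →L[ℝ] F}
    (h : HasFDerivAt (f ∘ (extChartAt I x).symm) f' (extChartAt I x x)) :
    MDifferentiableAt I 𝓘(ℝ, F) f x := by
  have h3 : HasMFDerivAt I 𝓘(ℝ, F) ((f ∘ (extChartAt I x).symm) ∘ extChartAt I x) x _ :=
    HasMFDerivAt.comp x h.hasMFDerivAt
      (mdifferentiableAt_extChartAt' (mem_extChartAt_source x)).hasMFDerivAt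
  refine (h3.congr_of_eventuallyEq ?_).mdifferentiableAt
  filter_upwards [extChartAt_source_mem_nhds (I := I) x] with x' hx'
  simp only [Function.comp_apply]
  rw [(extChartAt I x).left_inv hx']

lemma mdiffApply_of_hasFDerivAt {f : M → F} {v : TangentBundle I M} {f' : E →L[ℝ] F}
    (h : HasFDerivAt (f ∘ (extChartAt I v.proj).symm) f' (extChartAt I v.proj v.proj)) :
    mdiffApply I f v = f' v.2 := by
  rw [mdiffApply_self (mdifferentiableAt_of_hasFDerivAt h), h.fderiv]

lemma hasFDerivAt_comp_extChartAt_symm {f : M → F} {x : M}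
    (hf : MDifferentiableAt I 𝓘(ℝ, F) f x) :
    HasFDerivAt (f ∘ (extChartAt I x).symm)
      (fderiv ℝ (f ∘ (extChartAt I x).symm) (extChartAt I x x)) (extChartAt I x x) :=
  (differentiableAt_comp_extChartAt_symm hf).hasFDerivAt

lemma mdiffApply_sum_smul {ι : Type*} [Fintype ι] {c : ι → M → ℝ} {f : ι → M → F}
    {v : TangentBundle I M} (hc : ∀ i, MDifferentiableAt I 𝓘(ℝ, ℝ) (c i) v.proj)
    (hf : ∀ i, MDifferentiableAt I 𝓘(ℝ, F) (f i) v.proj) :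
    mdiffApply I (fun x => ∑ i, c i x • f i x) v =
      ∑ i, (c i v.proj • mdiffApply I (f i) v + mdiffApply I (c i) v • f i v.proj) := by
  have h2 := HasFDerivAt.fun_sum (u := Finset.univ) fun i _ =>
    (hasFDerivAt_comp_extChartAt_symm (hc i)).smul (hasFDerivAt_comp_extChartAt_symm (hf i))
  rw [mdiffApply_of_hasFDerivAt h2]
  refine (map_sum (ContinuousLinearMap.apply ℝ F (show E from v.2)) _ _).trans ?_
  refine Finset.sum_congr rfl fun i _ => ?_
  rw [mdiffApply_self (hc i), mdiffApply_self (hf i)]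
  simp only [Function.comp_apply, extChartAt_to_inv]
  rfl

lemma contDiffAt_comp_extChartAt_symm {f : M → F} {x₀ : M}
    (hf : ContMDiffAt I 𝓘(ℝ, F) ∞ f x₀) :
    ContDiffAt ℝ ∞ (f ∘ (extChartAt I x₀).symm) (extChartAt I x₀ x₀) := by
  have h1 : ContMDiffAt I 𝓘(ℝ, F) ∞ f ((extChartAt I x₀).symm (extChartAt I x₀ x₀)) := by
    rwa [extChartAt_to_inv]
  exact contMDiffAt_iff_contDiffAt.1 (h1.comp _
    ((contMDiffOn_extChartAt_symm x₀).contMDiffAt (extChartAt_target_mem_nhds x₀)))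

lemma eventually_mdifferentiableAt {E' : Type*} [NormedAddCommGroup E'] [NormedSpace ℝ E']
    {H' : Type*} [TopologicalSpace H'] {J : ModelWithCorners ℝ E' H'}
    {N : Type*} [TopologicalSpace N] [ChartedSpace H' N] [IsManifold J ∞ N] {f : M → N} {x₀ : M}
    (hf : ContMDiffAt I J ∞ f x₀) : ∀ᶠ x in 𝓝 x₀, MDifferentiableAt I J f x := by
  have h1 : ContMDiffAt I J 1 f x₀ := hf.of_le (by simp)
  filter_upwards [(contMDiffAt_iff_contMDiffAt_nhds (by simp)).1 h1] with x hx
  exact hx.mdifferentiableAt (by simp)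

/-- The differential of a smooth function is a smooth function on the tangent bundle. -/
lemma contMDiffAt_mdiffApply {f : M → F} {v : TangentBundle I M}
    (hf : ContMDiffAt I 𝓘(ℝ, F) ∞ f v.proj) :
    ContMDiffAt I.tangent 𝓘(ℝ, F) ∞ (mdiffApply I f) v := by
  have h1 : ContDiffAt ℝ ∞ (fderiv ℝ (f ∘ (extChartAt I v.proj).symm))
      (extChartAt I v.proj v.proj) :=
    (contDiffAt_comp_extChartAt_symm hf).fderiv_right (by simp)
  have h2 : ContMDiffAt I.tangent 𝓘(ℝ, E) ∞
      (fun w : TangentBundle I M => extChartAt I v.proj w.proj) v :=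
    ContMDiffAt.comp (g := extChartAt I v.proj) v (contMDiffAt_extChartAt (x := v.proj))
      (contMDiffAt_proj (TangentSpace I : M → Type _))
  have h3 : ContMDiffAt I.tangent 𝓘(ℝ, E →L[ℝ] F) ∞ (fun w : TangentBundle I M =>
      fderiv ℝ (f ∘ (extChartAt I v.proj).symm) (extChartAt I v.proj w.proj)) v :=
    ContMDiffAt.comp (g := fderiv ℝ (f ∘ (extChartAt I v.proj).symm)) v h1.contMDiffAt h2
  have h4 := h3.clm_apply (contMDiffAt_chart_snd (v := v) (mem_extChartAt_source v.proj))
  refine h4.congr_of_eventuallyEq ?_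
  have hcont := (FiberBundle.continuous_proj E (TangentSpace I : M → Type _)).continuousAt (x := v)
  filter_upwards [hcont.eventually (eventually_mdifferentiableAt hf),
    hcont.eventually (extChartAt_source_mem_nhds (I := I) v.proj)] with w hw hw'
  exact mdiffApply_eq_fderiv hw hw'

end MDiffApply

section Lifts

variable {E : Type*} [NormedAddCommGroup E] [NormedSpace ℝ E] [FiniteDimensional ℝ E]
  {H : Type*} [TopologicalSpace H] {I : ModelWithCorners ℝ E H} [I.Boundaryless]
  {M : Type*} [TopologicalSpace M] [ChartedSpace H M] [IsManifold I ∞ M]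

lemma contMDiffAt_chartDeriv {X : ∀ x : M, TangentSpace I x} {x₀ x : M}
    (hx : x ∈ (extChartAt I x₀).source)
    (hX : ContMDiffAt I I.tangent ∞ (fun x => (⟨x, X x⟩ : TangentBundle I M)) x) :
    ContMDiffAt I 𝓘(ℝ, E) ∞ (fun x' => chartDeriv I x₀ x' (X x')) x :=
  (contMDiffAt_chart_snd (v := ⟨x, X x⟩) hx).comp x hX

lemma completeLift_eq {X : ∀ x : M, TangentSpace I x} {v : TangentBundle I M}
    (hX : MDifferentiableAt I I.tangent (fun x => (⟨x, X x⟩ : TangentBundle I M)) v.proj) :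
    completeLift X v =
      ((X v.proj, mdiffApply I (fun x => chartDeriv I v.proj x (X x)) v) : E × E) := by
  refine Prod.ext rfl ?_
  let σ : M → TangentBundle I M := fun x => ⟨x, X x⟩
  have h1 : HasMFDerivAt I.tangent 𝓘(ℝ, E × E) (extChartAt I.tangent (σ v.proj)) (σ v.proj)
      (ContinuousLinearMap.id ℝ (E × E)) := by
    have := (mdifferentiableAt_extChartAt' (mem_extChartAt_source (I := I.tangent)
      (σ v.proj))).hasMFDerivAt
    rwa [mfderiv_extChartAt_self] at this
  have h2 : HasMFDerivAt I 𝓘(ℝ, E × E) (extChartAt I.tangent (σ v.proj) ∘ σ) v.proj _ :=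
    HasMFDerivAt.comp v.proj h1 hX.hasMFDerivAt
  have h3 : HasMFDerivAt I 𝓘(ℝ, E) (Prod.snd ∘ (extChartAt I.tangent (σ v.proj) ∘ σ)) v.proj _ :=
    HasMFDerivAt.comp v.proj (ContinuousLinearMap.snd ℝ E E).hasFDerivAt.hasMFDerivAt h2
  have h4 : (fun x => chartDeriv I v.proj x (X x)) =ᶠ[𝓝 v.proj]
      Prod.snd ∘ (extChartAt I.tangent (σ v.proj) ∘ σ) := by
    filter_upwards [extChartAt_source_mem_nhds (I := I) v.proj] with x hx
    simp only [Function.comp_apply]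
    rw [tangent_extChartAt_apply (ξ₀ := σ v.proj) (ξ := σ x) hx]
    rfl
  exact (mdiffApply_of_hasMFDerivAt (h3.congr_of_eventuallyEq h4)).symm

/-- The derivative of a preferred chart of the tangent bundle, in terms of the transition map of
the base. -/
lemma mfderiv_tangent_extChartAt {v₀ v : TangentBundle I M}
    (hv : v.proj ∈ (extChartAt I v₀.proj).source) (w : E × E) :
    chartDeriv I.tangent v₀ v w =
      (fderiv ℝ (chartChange I v.proj v₀.proj) (extChartAt I v.proj v.proj) w.1,
        fderiv ℝ (fderiv ℝ (chartChange I v.proj v₀.proj)) (extChartAt I v.proj v.proj) w.1 v.2 +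
        fderiv ℝ (chartChange I v.proj v₀.proj) (extChartAt I v.proj v.proj) w.2) := by
  set τ := chartChange I v.proj v₀.proj with hτdef
  set y := extChartAt I v.proj v.proj with hy
  have hyd : y ∈ chartChangeDomain I v.proj v₀.proj :=
    ⟨mem_extChartAt_target _, by rw [mem_preimage, hy, extChartAt_to_inv]; exact hv⟩
  have hτ := contDiffAt_chartChange hyd
  have hvy : extChartAt I.tangent v v = ((y, v.2) : E × E) := by
    rw [tangent_extChartAt_apply (mem_extChartAt_source _)]
    exact Prod.ext rfl (chartDeriv_self v.proj v.2)
  have h1 : HasFDerivAt (fun p : E × E => (τ p.1, fderiv ℝ τ p.1 p.2))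
      (((fderiv ℝ τ y).comp (ContinuousLinearMap.fst ℝ E E)).prod
        (((fderiv ℝ τ y).comp (ContinuousLinearMap.snd ℝ E E)) +
          ((fderiv ℝ (fderiv ℝ τ) y).comp (ContinuousLinearMap.fst ℝ E E)).flip v.2))
      (extChartAt I.tangent v v) := by
    rw [hvy]
    refine HasFDerivAt.prodMk ?_ ?_
    · exact HasFDerivAt.comp (g := τ) ((y, v.2) : E × E) (hτ.differentiableAt (by simp)).hasFDerivAt
        hasFDerivAt_fst
    · refine HasFDerivAt.clm_apply (x := ((y, v.2) : E × E)) (c := fun p : E × E => fderiv ℝ τ p.1)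
        (u := Prod.snd) ?_ hasFDerivAt_snd
      exact HasFDerivAt.comp (g := fderiv ℝ τ) ((y, v.2) : E × E)
        ((hτ.fderiv_right (m := ∞) (by simp)).differentiableAt (by simp)).hasFDerivAt
        hasFDerivAt_fst
  have h2 : HasMFDerivAt I.tangent 𝓘(ℝ, E × E) (extChartAt I.tangent v) v
      (ContinuousLinearMap.id ℝ (E × E)) := by
    have := (mdifferentiableAt_extChartAt' (mem_extChartAt_source (I := I.tangent) v)).hasMFDerivAt
    rwa [mfderiv_extChartAt_self] at this
  have h3 : HasMFDerivAt I.tangent 𝓘(ℝ, E × E)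
      ((fun p : E × E => (τ p.1, fderiv ℝ τ p.1 p.2)) ∘ extChartAt I.tangent v) v _ :=
    HasMFDerivAt.comp v h1.hasMFDerivAt h2
  have h4 : extChartAt I.tangent v₀ =ᶠ[𝓝 v]
      (fun p : E × E => (τ p.1, fderiv ℝ τ p.1 p.2)) ∘ extChartAt I.tangent v := by
    have hcont := (FiberBundle.continuous_proj E (TangentSpace I : M → Type _)).continuousAt (x := v)
    filter_upwards [hcont.eventually (extChartAt_source_mem_nhds (I := I) v.proj),
      hcont.eventually ((isOpen_extChartAt_source (I := I) v₀.proj).mem_nhds hv)] with u hu hu0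
    have hu' : (extChartAt I v.proj).symm (extChartAt I v.proj u.proj) = u.proj :=
      (extChartAt I v.proj).left_inv hu
    have hud : extChartAt I v.proj u.proj ∈ chartChangeDomain I v.proj v₀.proj :=
      ⟨(extChartAt I v.proj).map_source hu, by rw [mem_preimage, hu']; exact hu0⟩
    rw [Function.comp_apply, tangent_extChartAt_apply hu, tangent_extChartAt_apply hu0]
    refine Prod.ext ?_ ?_
    · simp only [hτdef, chartChange, Function.comp_apply]
      rw [hu']
    · refine Eq.trans ?_ (fderiv_chartChange hud _).symm
      have key : ∀ (x : M) (_ : u.proj = x) (c : TangentSpace I x),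
          mfderiv I 𝓘(ℝ, E) (extChartAt I v₀.proj) u.proj c =
          mfderiv I 𝓘(ℝ, E) (extChartAt I v₀.proj) x c := by
        rintro _ rfl c; rfl
      rw [← key _ hu'.symm]
      refine congrArg (mfderiv I 𝓘(ℝ, E) (extChartAt I v₀.proj) u.proj) ?_
      have h5 := mfderivWithin_extChartAt_symm_comp_mfderiv_extChartAt' (I := I) hu
      rw [I.range_eq_univ, mfderivWithin_univ] at h5
      exact (DFunLike.congr_fun h5 u.2).symm
  have h5 : chartDeriv I.tangent v₀ v = _ := (h3.congr_of_eventuallyEq h4).mfderiv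
  rw [h5]
  refine Prod.ext rfl ?_
  exact add_comm _ _

lemma chartDeriv_eq_fderiv {x₀ x q : M} (hx : x ∈ (extChartAt I x₀).source)
    (hx' : x ∈ (extChartAt I q).source) (c : TangentSpace I x) :
    chartDeriv I x₀ x c =
      fderiv ℝ (chartChange I q x₀) (extChartAt I q x) (chartDeriv I q x c) := by
  have h1 : (extChartAt I q).symm (extChartAt I q x) = x := (extChartAt I q).left_inv hx'
  have hd : extChartAt I q x ∈ chartChangeDomain I q x₀ :=
    ⟨(extChartAt I q).map_source hx', by rw [mem_preimage, h1]; exact hx⟩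
  refine Eq.trans ?_ (fderiv_chartChange hd _).symm
  have key : ∀ (x' : M) (_ : x = x') (c : TangentSpace I x'),
      mfderiv I 𝓘(ℝ, E) (extChartAt I x₀) x c = mfderiv I 𝓘(ℝ, E) (extChartAt I x₀) x' c := by
    rintro _ rfl c; rfl
  rw [← key _ h1.symm]
  refine congrArg (mfderiv I 𝓘(ℝ, E) (extChartAt I x₀) x) ?_
  have h5 := mfderivWithin_extChartAt_symm_comp_mfderiv_extChartAt' (I := I) hx'
  rw [I.range_eq_univ, mfderivWithin_univ] at h5
  exact (DFunLike.congr_fun h5 c).symm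

lemma chartDeriv_completeLift {X : ∀ x : M, TangentSpace I x} {v₀ v : TangentBundle I M}
    (hv : v.proj ∈ (extChartAt I v₀.proj).source)
    (hX : MDifferentiableAt I I.tangent (fun x => (⟨x, X x⟩ : TangentBundle I M)) v.proj)
    (hX' : MDifferentiableAt I 𝓘(ℝ, E) (fun x => chartDeriv I v.proj x (X x)) v.proj) :
    chartDeriv I.tangent v₀ v (completeLift X v) = (chartDeriv I v₀.proj v.proj (X v.proj),
      mdiffApply I (fun x => chartDeriv I v₀.proj x (X x)) v) := by
  rw [completeLift_eq hX, mfderiv_tangent_extChartAt hv]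
  have hsrc := mem_extChartAt_source (I := I) v.proj
  set τ := chartChange I v.proj v₀.proj with hτdef
  set y := extChartAt I v.proj v.proj with hy
  have hyd : y ∈ chartChangeDomain I v.proj v₀.proj :=
    ⟨mem_extChartAt_target _, by rw [mem_preimage, hy, extChartAt_to_inv]; exact hv⟩
  have hτ := contDiffAt_chartChange hyd
  refine Prod.ext ?_ ?_
  · refine Eq.trans ?_ (chartDeriv_eq_fderiv hv hsrc (X v.proj)).symm
    rw [chartDeriv_self]
  · have h1 : (fun x => chartDeriv I v₀.proj x (X x)) =ᶠ[𝓝 v.proj] fun x =>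
        fderiv ℝ τ (extChartAt I v.proj x) (chartDeriv I v.proj x (X x)) := by
      filter_upwards [extChartAt_source_mem_nhds (I := I) v.proj,
        (isOpen_extChartAt_source (I := I) v₀.proj).mem_nhds hv] with x hx hx0
      exact chartDeriv_eq_fderiv hx0 hx (X x)
    have h2 : HasFDerivAt (fderiv ℝ τ) (fderiv ℝ (fderiv ℝ τ) y) y :=
      ((hτ.fderiv_right (m := ∞) (by simp)).differentiableAt (by simp)).hasFDerivAt
    have h3 : HasFDerivAt ((fun x => fderiv ℝ τ (extChartAt I v.proj x)) ∘
        (extChartAt I v.proj).symm) (fderiv ℝ (fderiv ℝ τ) y) y := by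
      refine h2.congr_of_eventuallyEq ?_
      filter_upwards [extChartAt_target_mem_nhds (I := I) v.proj] with y' hy'
      simp only [Function.comp_apply]
      rw [(extChartAt I v.proj).right_inv hy']
    have h5 := h3.clm_apply (hasFDerivAt_comp_extChartAt_symm hX')
    have e1 : ((fun x => chartDeriv I v.proj x (X x)) ∘ (extChartAt I v.proj).symm) y =
        X v.proj := by
      simp only [Function.comp_apply, hy]
      rw [extChartAt_to_inv, chartDeriv_self]
    have e2 : ((fun x => fderiv ℝ τ (extChartAt I v.proj x)) ∘ (extChartAt I v.proj).symm) y =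
        fderiv ℝ τ y := by
      simp only [Function.comp_apply, hy]
      rw [extChartAt_to_inv]
    rw [e1, e2] at h5
    rw [mdiffApply_congr h1, mdiffApply_of_hasFDerivAt (f := fun x =>
      fderiv ℝ τ (extChartAt I v.proj x) (chartDeriv I v.proj x (X x))) h5, mdiffApply_self hX']
    have hsymm : fderiv ℝ (fderiv ℝ τ) y (X v.proj) v.2 = fderiv ℝ (fderiv ℝ τ) y v.2 (X v.proj) :=
      (hτ.of_le two_le_infty).isSymmSndFDerivAt (by simp) (X v.proj) v.2
    change fderiv ℝ (fderiv ℝ τ) y (X v.proj) v.2 + _ = _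
    rw [hsymm, add_comm]
    rfl

end Lifts

section LiftSections

variable {E : Type*} [NormedAddCommGroup E] [NormedSpace ℝ E] [FiniteDimensional ℝ E]
  {H : Type*} [TopologicalSpace H] {I : ModelWithCorners ℝ E H} [I.Boundaryless]
  {M : Type*} [TopologicalSpace M] [ChartedSpace H M] [IsManifold I ∞ M]

lemma mdifferentiableAt_chartDeriv {X : ∀ x : M, TangentSpace I x} {x₀ x : M}
    (hx : x ∈ (extChartAt I x₀).source)
    (hX : MDifferentiableAt I I.tangent (fun x => (⟨x, X x⟩ : TangentBundle I M)) x) :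
    MDifferentiableAt I 𝓘(ℝ, E) (fun x' => chartDeriv I x₀ x' (X x')) x :=
  MDifferentiableAt.comp x
    ((contMDiffAt_chart_snd (v := (⟨x, X x⟩ : TangentBundle I M)) hx).mdifferentiableAt (by simp)) hX

lemma contMDiffAt_completeLift {X : ∀ x : M, TangentSpace I x} {v : TangentBundle I M}
    (hX : ContMDiffAt I I.tangent ∞ (fun x => (⟨x, X x⟩ : TangentBundle I M)) v.proj) :
    ContMDiffAt I.tangent I.tangent.tangent ∞ (fun u : TangentBundle I M =>
      (⟨u, completeLift X u⟩ : TangentBundle I.tangent (TangentBundle I M))) v := by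
  refine contMDiffAt_tangentBundle contMDiffAt_id ?_
  have hsm := contMDiffAt_chartDeriv (mem_extChartAt_source v.proj) hX
  have h1 : ContMDiffAt I.tangent 𝓘(ℝ, E × E) ∞ (fun u : TangentBundle I M =>
      ((chartDeriv I v.proj u.proj (X u.proj),
        mdiffApply I (fun x => chartDeriv I v.proj x (X x)) u) : E × E)) v :=
    (ContMDiffAt.comp v hsm (contMDiffAt_proj (TangentSpace I : M → Type _))).prodMk_space
      (contMDiffAt_mdiffApply hsm)
  refine h1.congr_of_eventuallyEq ?_
  have hcont := (FiberBundle.continuous_proj E (TangentSpace I : M → Type _)).continuousAt (x := v)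
  filter_upwards [hcont.eventually (eventually_mdifferentiableAt hX),
    hcont.eventually (extChartAt_source_mem_nhds (I := I) v.proj)] with u hu hus
  exact chartDeriv_completeLift hus hu
    (mdifferentiableAt_chartDeriv (mem_extChartAt_source u.proj) hu)

lemma chartDeriv_vLift {v₀ v : TangentBundle I M} (hv : v.proj ∈ (extChartAt I v₀.proj).source)
    (c : TangentSpace I v.proj) :
    chartDeriv I.tangent v₀ v (vLift I v c) = ((0, chartDeriv I v₀.proj v.proj c) : E × E) := by
  rw [vLift_tangent, mfderiv_tangent_extChartAt hv]
  refine Prod.ext (map_zero _) ?_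
  rw [chartDeriv_eq_fderiv hv (mem_extChartAt_source v.proj) c, chartDeriv_self]
  refine (congrArg₂ (· + ·) ?_ rfl).trans (zero_add _)
  exact (congrArg (fun A : E →L[ℝ] E => A v.2) (map_zero _)).trans rfl

lemma contMDiffAt_vLift {X : ∀ x : M, TangentSpace I x} {v : TangentBundle I M}
    (hX : ContMDiffAt I I.tangent ∞ (fun x => (⟨x, X x⟩ : TangentBundle I M)) v.proj) :
    ContMDiffAt I.tangent I.tangent.tangent ∞ (fun u : TangentBundle I M =>
      (⟨u, vLift I u (X u.proj)⟩ : TangentBundle I.tangent (TangentBundle I M))) v := by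
  refine contMDiffAt_tangentBundle contMDiffAt_id ?_
  have hsm := contMDiffAt_chartDeriv (mem_extChartAt_source v.proj) hX
  have h1 : ContMDiffAt I.tangent 𝓘(ℝ, E × E) ∞ (fun u : TangentBundle I M =>
      ((0, chartDeriv I v.proj u.proj (X u.proj)) : E × E)) v :=
    contMDiffAt_const.prodMk_space
      (ContMDiffAt.comp v hsm (contMDiffAt_proj (TangentSpace I : M → Type _)))
  refine h1.congr_of_eventuallyEq ?_
  have hcont := (FiberBundle.continuous_proj E (TangentSpace I : M → Type _)).continuousAt (x := v)
  filter_upwards [hcont.eventually (extChartAt_source_mem_nhds (I := I) v.proj)] with u hus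
  exact chartDeriv_vLift hus (X u.proj)

lemma mdiffApply_comp {E' : Type*} [NormedAddCommGroup E'] [NormedSpace ℝ E']
    {H' : Type*} [TopologicalSpace H'] {J : ModelWithCorners ℝ E' H'}
    {N : Type*} [TopologicalSpace N] [ChartedSpace H' N]
    {F : Type*} [NormedAddCommGroup F] [NormedSpace ℝ F] {f : M → F} {g : N → M}
    {ξ : TangentBundle J N} (hf : MDifferentiableAt I 𝓘(ℝ, F) f (g ξ.proj))
    (hg : MDifferentiableAt J I g ξ.proj) :
    mdiffApply J (f ∘ g) ξ = mdiffApply I f (tangentMap J I g ξ) := by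
  rw [mdiffApply, mfderiv_comp ξ.proj hf hg]
  rfl

lemma mdiffApply_of_linear_in_chart {F : Type*} [NormedAddCommGroup F] [NormedSpace ℝ F]
    {f : M → F} {x₀ : M} {v : TangentBundle I M} (hv : v.proj ∈ (extChartAt I x₀).source)
    (A : E →L[ℝ] F) (h : ∀ᶠ x in 𝓝 v.proj, f x = A (extChartAt I x₀ x)) :
    mdiffApply I f v = A (chartDeriv I x₀ v.proj v.2) := by
  have h1 : HasMFDerivAt I 𝓘(ℝ, F) (A ∘ extChartAt I x₀) v.proj _ :=
    HasMFDerivAt.comp v.proj A.hasFDerivAt.hasMFDerivAt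
      (mdifferentiableAt_extChartAt' hv).hasMFDerivAt
  exact mdiffApply_of_hasMFDerivAt (h1.congr_of_eventuallyEq h)

end LiftSections

namespace RegularDistribution

section DualCharts

variable {E : Type*} [NormedAddCommGroup E] [NormedSpace ℝ E] [FiniteDimensional ℝ E]
  {H : Type*} [TopologicalSpace H] {I : ModelWithCorners ℝ E H} [I.Boundaryless]
  {M : Type*} [TopologicalSpace M] [ChartedSpace H M] [IsManifold I ∞ M] {r : ℕ}
  (D : RegularDistribution I M r)

lemma continuous_dualProj : Continuous (π (Fin r → ℝ) D.Dual) :=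
  FiberBundle.continuous_proj (Fin r → ℝ) D.Dual

lemma mem_extChartAt_source_dualTotal {z₀ z : D.DualTotal} :
    z ∈ (extChartAt (dualModel I r) z₀).source ↔
      z.proj ∈ D.frameSet z₀.proj ∧ z.proj ∈ (extChartAt I z₀.proj).source := by
  rw [FiberBundle.extChartAt, PartialEquiv.trans_source]
  constructor
  · rintro ⟨h1, h2⟩
    have h1' := (trivializationAt (Fin r → ℝ) D.Dual z₀.proj).mem_source.1 h1
    have h3 := (trivializationAt (Fin r → ℝ) D.Dual z₀.proj).coe_fst h1
    have h4 : (trivializationAt (Fin r → ℝ) D.Dual z₀.proj z).1 ∈ (extChartAt I z₀.proj).source := h2.1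
    rw [h3] at h4
    exact ⟨h1', h4⟩
  · rintro ⟨h1, h2⟩
    have h1' := (trivializationAt (Fin r → ℝ) D.Dual z₀.proj).mem_source.2 h1
    have h3 := (trivializationAt (Fin r → ℝ) D.Dual z₀.proj).coe_fst h1'
    refine ⟨h1', ?_, trivial⟩
    change (trivializationAt (Fin r → ℝ) D.Dual z₀.proj z).1 ∈ (extChartAt I z₀.proj).source
    rw [h3]
    exact h2

lemma extChartAt_dualTotal {z₀ z : D.DualTotal} (hz : z.proj ∈ D.frameSet z₀.proj) :
    extChartAt (dualModel I r) z₀ z =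
      (extChartAt I z₀.proj z.proj, fun i => D.evalSec (D.frame z₀.proj i) z) := by
  rw [FiberBundle.extChartAt]
  have h1' := (trivializationAt (Fin r → ℝ) D.Dual z₀.proj).mem_source.2 hz
  have h3 := (trivializationAt (Fin r → ℝ) D.Dual z₀.proj).coe_fst h1'
  refine Prod.ext ?_ ?_
  · change extChartAt I z₀.proj (trivializationAt (Fin r → ℝ) D.Dual z₀.proj z).1 = _
    rw [h3]
  · funext i
    exact D.trivializationAt_snd_apply z₀.proj hz i

lemma eventually_mem_source_dualTotal {z₀ z : D.DualTotal}
    (hz : z ∈ (extChartAt (dualModel I r) z₀).source) :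
    ∀ᶠ z' in 𝓝 z, extChartAt (dualModel I r) z₀ z' =
      (extChartAt I z₀.proj z'.proj, fun i => D.evalSec (D.frame z₀.proj i) z') := by
  filter_upwards [(isOpen_extChartAt_source z₀).mem_nhds hz] with z' hz'
  exact D.extChartAt_dualTotal (D.mem_extChartAt_source_dualTotal.1 hz').1

lemma hasMFDerivAt_dualProj (z : D.DualTotal) :
    HasMFDerivAt (dualModel I r) I (π (Fin r → ℝ) D.Dual) z
      (ContinuousLinearMap.fst ℝ E (Fin r → ℝ)) := by
  refine hasMFDerivAt_of_linear_in_charts D.continuous_dualProj.continuousAt _ ?_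
  filter_upwards [D.eventually_mem_source_dualTotal (mem_extChartAt_source z)] with z' hz'
  rw [hz']
  rfl

lemma tangentProj_eq (ξ : TangentBundle (dualModel I r) D.DualTotal) :
    D.tangentProj ξ = ⟨ξ.proj.proj, (show E × (Fin r → ℝ) from ξ.2).1⟩ := by
  rw [tangentProj, tangentMap, (D.hasMFDerivAt_dualProj ξ.proj).mfderiv]
  rfl

lemma evalSec_zero {s : ∀ x : M, TangentSpace I x} {x : M} :
    D.evalSec s (zeroSection (Fin r → ℝ) D.Dual x) = 0 := by
  by_cases h : s x ∈ D.space x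
  · exact D.evalSec_of_mem (z := zeroSection (Fin r → ℝ) D.Dual x) h
  · exact dif_neg h

lemma contMDiff_dualZero :
    ContMDiff I (dualModel I r) ∞ (zeroSection (Fin r → ℝ) D.Dual) :=
  contMDiff_zeroSection ℝ D.Dual

lemma hasMFDerivAt_dualZero (x : M) :
    HasMFDerivAt I (dualModel I r) (zeroSection (Fin r → ℝ) D.Dual) x
      (ContinuousLinearMap.inl ℝ E (Fin r → ℝ)) := by
  refine hasMFDerivAt_of_linear_in_charts D.contMDiff_dualZero.continuous.continuousAt _ ?_
  filter_upwards [(D.isOpen_frameSet x).mem_nhds (D.mem_frameSet x)] with x' hx'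
  rw [D.extChartAt_dualTotal (z := zeroSection (Fin r → ℝ) D.Dual x') hx']
  refine Prod.ext rfl ?_
  funext i
  exact D.evalSec_zero

lemma tangentZero_eq (v : TangentBundle I M) :
    D.tangentZero v = ⟨zeroSection (Fin r → ℝ) D.Dual v.proj,
      (show E × (Fin r → ℝ) from ((show E from v.2), 0))⟩ := by
  rw [tangentZero, tangentMap, (D.hasMFDerivAt_dualZero v.proj).mfderiv]
  rfl

lemma tangentProj_tangentZero (v : TangentBundle I M) : D.tangentProj (D.tangentZero v) = v := by
  rw [tangentZero_eq, tangentProj_eq]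
  rfl

/-- Fibre coordinates of tangent vectors of the dual in a preferred chart. -/
lemma mdiffApply_evalSec_frame {z₀ : D.DualTotal} {ξ : TangentBundle (dualModel I r) D.DualTotal}
    (hξ : ξ.proj ∈ (extChartAt (dualModel I r) z₀).source) (i : Fin r) :
    mdiffApply (dualModel I r) (D.evalSec (D.frame z₀.proj i)) ξ =
      (chartDeriv (dualModel I r) z₀ ξ.proj ξ.2).2 i := by
  refine mdiffApply_of_linear_in_chart hξ ((ContinuousLinearMap.proj i).comp
    (ContinuousLinearMap.snd ℝ E (Fin r → ℝ))) ?_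
  filter_upwards [D.eventually_mem_source_dualTotal hξ] with z' hz'
  rw [hz']
  rfl

lemma mdiffApply_evalSec_frame_self (ξ : TangentBundle (dualModel I r) D.DualTotal) (i : Fin r) :
    mdiffApply (dualModel I r) (D.evalSec (D.frame ξ.proj.proj i)) ξ =
      (show E × (Fin r → ℝ) from ξ.2).2 i := by
  rw [D.mdiffApply_evalSec_frame (mem_extChartAt_source ξ.proj), chartDeriv_self]

lemma contMDiff_tangentProj :
    ContMDiff (dualModel I r).tangent I.tangent ∞ D.tangentProj :=
  (contMDiff_proj D.Dual : ContMDiff (dualModel I r) I ∞ _).contMDiff_tangentMap (by simp)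

lemma contMDiff_tangentZero :
    ContMDiff I.tangent (dualModel I r).tangent ∞ D.tangentZero :=
  D.contMDiff_dualZero.contMDiff_tangentMap (by simp)

lemma chartDeriv_dual_fst {z₀ : D.DualTotal} {ξ : TangentBundle (dualModel I r) D.DualTotal}
    (hξ : ξ.proj ∈ (extChartAt (dualModel I r) z₀).source) :
    (chartDeriv (dualModel I r) z₀ ξ.proj ξ.2).1 =
      chartDeriv I z₀.proj ξ.proj.proj (D.tangentProj ξ).2 := by
  have hz := (D.mem_extChartAt_source_dualTotal.1 hξ).2
  have h1 : HasMFDerivAt (dualModel I r) 𝓘(ℝ, E) (extChartAt I z₀.proj ∘ π (Fin r → ℝ) D.Dual)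
      ξ.proj _ := HasMFDerivAt.comp ξ.proj (mdifferentiableAt_extChartAt' hz).hasMFDerivAt
    (contMDiffAt_proj (n := 1) D.Dual |>.mdifferentiableAt (by simp)).hasMFDerivAt
  have h2 : HasMFDerivAt (dualModel I r) 𝓘(ℝ, E) (Prod.fst ∘ extChartAt (dualModel I r) z₀)
      ξ.proj _ := HasMFDerivAt.comp ξ.proj
    (ContinuousLinearMap.fst ℝ E (Fin r → ℝ)).hasFDerivAt.hasMFDerivAt
    (mdifferentiableAt_extChartAt' hξ).hasMFDerivAt
  have h3 : Prod.fst ∘ extChartAt (dualModel I r) z₀ =ᶠ[𝓝 ξ.proj]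
      extChartAt I z₀.proj ∘ π (Fin r → ℝ) D.Dual := by
    filter_upwards [D.eventually_mem_source_dualTotal hξ] with z' hz'
    rw [Function.comp_apply, hz']
    rfl
  exact DFunLike.congr_fun (hasMFDerivAt_unique h2 (h1.congr_of_eventuallyEq h3)) ξ.2

/-- Elements of the dual are determined by their values on a spanning family of sections. -/
lemma dualTotal_ext {ι : Type*} {s : ι → ∀ x : M, TangentSpace I x} {a b : D.DualTotal}
    (hab : a.proj = b.proj) (hs : Submodule.span ℝ (range fun i => s i a.proj) = D.space a.proj)
    (h : ∀ i, D.evalSec (s i) a = D.evalSec (s i) b) : a = b := by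
  obtain ⟨x, μ⟩ := a
  obtain ⟨y, ν⟩ := b
  obtain rfl : x = y := hab
  have hmem : ∀ i, s i x ∈ D.space x := fun i => by
    change s i x ∈ D.space (⟨x, μ⟩ : D.DualTotal).proj
    rw [← hs]
    exact Submodule.subset_span ⟨i, rfl⟩
  congr 1
  apply ContinuousLinearMap.ext (M₁ := D.space x)
  rintro ⟨w, hw⟩
  have hw' : w ∈ Submodule.span ℝ (range fun i => s i x) := hs ▸ hw
  have key : ∀ w (hw : w ∈ Submodule.span ℝ (range fun i => s i x)),
      ∃ hw' : w ∈ D.space x, D.pair μ ⟨w, hw'⟩ = D.pair ν ⟨w, hw'⟩ := by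
    intro w hw
    induction hw using Submodule.span_induction with
    | mem w hw =>
      obtain ⟨i, rfl⟩ := hw
      refine ⟨hmem i, ?_⟩
      have h1 := h i
      rwa [D.evalSec_of_mem (z := ⟨x, μ⟩) (hmem i), D.evalSec_of_mem (z := ⟨x, ν⟩) (hmem i)] at h1
    | zero => exact ⟨zero_mem _, ((D.pair μ).map_zero).trans ((D.pair ν).map_zero).symm⟩
    | add a b _ _ ha hb =>
      obtain ⟨ha, ha'⟩ := ha
      obtain ⟨hb, hb'⟩ := hb
      refine ⟨add_mem ha hb, ?_⟩
      have h1 : (⟨a + b, add_mem ha hb⟩ : D.space x) = ⟨a, ha⟩ + ⟨b, hb⟩ := rfl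
      rw [h1, map_add, map_add, ha', hb']
    | smul c a _ ha =>
      obtain ⟨ha, ha'⟩ := ha
      refine ⟨Submodule.smul_mem _ c ha, ?_⟩
      have h1 : (⟨c • a, Submodule.smul_mem _ c ha⟩ : D.space x) = c • ⟨a, ha⟩ := rfl
      rw [h1, map_smul, map_smul, ha']
  exact (key w hw').2

end DualCharts
end RegularDistribution

/-! ### Frames of the lifted distribution -/

section Values

variable {E : Type*} [NormedAddCommGroup E] [NormedSpace ℝ E] [FiniteDimensional ℝ E]
  {H : Type*} [TopologicalSpace H] {I : ModelWithCorners ℝ E H} [I.Boundaryless]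
  {M : Type*} [TopologicalSpace M] [ChartedSpace H M] [IsManifold I ∞ M]

lemma mdiffApply_clm_comp {F F' : Type*} [NormedAddCommGroup F] [NormedSpace ℝ F]
    [NormedAddCommGroup F'] [NormedSpace ℝ F'] (A : F →L[ℝ] F') {f : M → F}
    {v : TangentBundle I M} (hf : MDifferentiableAt I 𝓘(ℝ, F) f v.proj) :
    mdiffApply I (A ∘ f) v = A (mdiffApply I f v) := by
  have h1 : HasMFDerivAt I 𝓘(ℝ, F') (A ∘ f) v.proj _ :=
    HasMFDerivAt.comp v.proj A.hasFDerivAt.hasMFDerivAt hf.hasMFDerivAt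
  exact mdiffApply_of_hasMFDerivAt h1

lemma mdiffApply_extChartAt (v : TangentBundle I M) :
    mdiffApply I (extChartAt I v.proj) v = v.2 := by
  exact chartDeriv_self v.proj v.2

lemma mdiffApply_extChartAt_comp {E' : Type*} [NormedAddCommGroup E'] [NormedSpace ℝ E']
    {H' : Type*} [TopologicalSpace H'] {J : ModelWithCorners ℝ E' H'}
    {N : Type*} [TopologicalSpace N] [ChartedSpace H' N] {g : N → M}
    {ξ : TangentBundle J N} (hg : MDifferentiableAt J I g ξ.proj) :
    mdiffApply J (extChartAt I (g ξ.proj) ∘ g) ξ = (tangentMap J I g ξ).2 := by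
  rw [mdiffApply_comp (mdifferentiableAt_extChartAt' (mem_extChartAt_source _)) hg]
  exact mdiffApply_extChartAt (tangentMap J I g ξ)

/-- Complete lifts of combinations of vector fields with variable coefficients. -/
lemma completeLift_sum_smul {ι : Type*} [Fintype ι] {X : ∀ x : M, TangentSpace I x}
    {s : ι → ∀ x : M, TangentSpace I x} {c : ι → M → ℝ} {v : TangentBundle I M}
    (hX : MDifferentiableAt I I.tangent (fun x => (⟨x, X x⟩ : TangentBundle I M)) v.proj)
    (hs : ∀ i, MDifferentiableAt I I.tangent (fun x => (⟨x, s i x⟩ : TangentBundle I M)) v.proj)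
    (hc : ∀ i, MDifferentiableAt I 𝓘(ℝ, ℝ) (c i) v.proj)
    (h : ∀ᶠ x in 𝓝 v.proj, X x = ∑ i, c i x • s i x) :
    completeLift X v = ∑ i, (c i v.proj • completeLift (s i) v +
      mdiffApply I (c i) v • vLift I v (s i v.proj)) := by
  have hsrc := mem_extChartAt_source (I := I) v.proj
  have h1 : (fun x => chartDeriv I v.proj x (X x)) =ᶠ[𝓝 v.proj]
      fun x => ∑ i, c i x • chartDeriv I v.proj x (s i x) := by
    filter_upwards [h] with x hx
    rw [hx, map_sum]
    exact Finset.sum_congr rfl fun i _ => map_smul _ _ _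
  rw [completeLift_eq hX, mdiffApply_congr h1,
    mdiffApply_sum_smul hc fun i => mdifferentiableAt_chartDeriv hsrc (hs i)]
  refine Prod.ext ?_ ?_
  · refine Eq.trans ?_ (map_sum (ContinuousLinearMap.fst ℝ E E) _ _).symm
    refine h.self_of_nhds.trans (Finset.sum_congr rfl fun i _ => ?_)
    rw [vLift_tangent]
    refine ((map_add (ContinuousLinearMap.fst ℝ E E) _ _).trans ?_).symm
    exact (congrArg (fun a : E => c i v.proj • (show E from s i v.proj) + a)
      (smul_zero (mdiffApply I (c i) v))).trans (add_zero _)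
  · refine Eq.trans ?_ (map_sum (ContinuousLinearMap.snd ℝ E E) _ _).symm
    refine Finset.sum_congr rfl fun i _ => ?_
    rw [vLift_tangent, completeLift_eq (hs i), chartDeriv_self]
    rfl

end Values

namespace RegularDistribution

section DualValues

variable {E : Type*} [NormedAddCommGroup E] [NormedSpace ℝ E] [FiniteDimensional ℝ E]
  {H : Type*} [TopologicalSpace H] {I : ModelWithCorners ℝ E H} [I.Boundaryless]
  {M : Type*} [TopologicalSpace M] [ChartedSpace H M] [IsManifold I ∞ M] {r : ℕ}
  (D : RegularDistribution I M r)

/-- The element of the dual with prescribed values on a basis. -/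
def dualOfValues {ι : Type*} {x : M} (b : Module.Basis ι ℝ (D.space x)) (c : ι → ℝ) :
    D.DualTotal :=
  ⟨x, have := D.finiteDimensional_space x
    LinearMap.toContinuousLinearMap (E := D.space x) (F' := ℝ) (b.constr ℝ c)⟩

lemma evalSec_dualOfValues {ι : Type*} {x : M} (b : Module.Basis ι ℝ (D.space x)) (c : ι → ℝ)
    {s : ∀ x : M, TangentSpace I x} {i : ι} (h : (b i : TangentSpace I x) = s x) :
    D.evalSec s (D.dualOfValues b c) = c i := by
  have h1 : s x ∈ D.space x := h ▸ (b i).2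
  refine (D.evalSec_of_mem (z := D.dualOfValues b c) h1).trans ?_
  have h2 : (⟨s x, h1⟩ : D.space x) = b i := Subtype.ext h.symm
  have h3 : b.constr ℝ c (⟨s x, h1⟩ : D.space x) = c i := by
    rw [h2, Module.Basis.constr_basis]
  exact h3

variable {D} in
lemma span_eq_space {ι : Type*} [Fintype ι] (hcard : Fintype.card ι = r) {x : M}
    {w : ι → TangentSpace I x} (hw : ∀ i, w i ∈ D.space x) (hli : LinearIndependent ℝ w) :
    Submodule.span ℝ (range w) = D.space x := by
  have := D.finiteDimensional_space x
  refine Submodule.eq_of_le_of_finrank_eq (Submodule.span_le.2 (range_subset_iff.2 hw)) ?_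
  rw [finrank_span_eq_card hli, hcard, D.finrank_space]

variable {D} in
/-- A basis of a fibre of a distribution from enough independent vectors. -/
def basisOfIndependent {ι : Type*} [Fintype ι] (hcard : Fintype.card ι = r) {x : M}
    {w : ι → TangentSpace I x} (hw : ∀ i, w i ∈ D.space x) (hli : LinearIndependent ℝ w) :
    Module.Basis ι ℝ (D.space x) :=
  (Module.Basis.span hli).map (LinearEquiv.ofEq _ _ (span_eq_space hcard hw hli))

variable {D} in
lemma coe_basisOfIndependent {ι : Type*} [Fintype ι] (hcard : Fintype.card ι = r) {x : M}
    {w : ι → TangentSpace I x} (hw : ∀ i, w i ∈ D.space x) (hli : LinearIndependent ℝ w) (i : ι) :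
    (basisOfIndependent hcard hw hli i : TangentSpace I x) = w i := by
  simp [basisOfIndependent, Module.Basis.span_apply]

/-- The complete and the vertical lifts of a chosen local frame. -/
def liftFrame (x₀ : M) : Fin r ⊕ Fin r → ∀ v : TangentBundle I M, TangentSpace I.tangent v :=
  Sum.elim (fun i => completeLift (D.frame x₀ i)) (fun i v => vLift I v (D.frame x₀ i v.proj))

lemma mdifferentiableAt_frame (x₀ : M) (i : Fin r) {x : M} (hx : x ∈ D.frameSet x₀) :
    MDifferentiableAt I I.tangent (fun x => (⟨x, D.frame x₀ i x⟩ : TangentBundle I M)) x :=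
  (D.isSectionAt_frame x₀ i hx).1.mdifferentiableAt (by simp)

lemma linearIndependent_liftFrame (x₀ : M) {v : TangentBundle I M} (hv : v.proj ∈ D.frameSet x₀) :
    LinearIndependent ℝ fun j => D.liftFrame x₀ j v := by
  have hli := D.linearIndependent_frame x₀ hv
  rw [Fintype.linearIndependent_iff]
  intro c hc
  rw [Fintype.sum_sum_type] at hc
  have hl : ∀ i, c (Sum.inl i) = 0 := by
    refine Fintype.linearIndependent_iff.1 hli (fun i => c (Sum.inl i)) ?_
    have h1 := congrArg (ContinuousLinearMap.fst ℝ E E) hc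
    have h2 := (map_add (ContinuousLinearMap.fst ℝ E E) _ _).symm.trans h1
    refine Eq.trans ?_ (h2.trans (map_zero _))
    refine Eq.trans ?_ (congrArg₂ (· + ·) (map_sum (ContinuousLinearMap.fst ℝ E E) _ _)
      (map_sum (ContinuousLinearMap.fst ℝ E E) _ _)).symm
    refine ((congrArg₂ (· + ·) rfl (Finset.sum_eq_zero fun i _ => ?_)).trans (add_zero _)).symm
    exact smul_zero (c (Sum.inr i))
  have hr : ∀ i, c (Sum.inr i) = 0 := by
    refine Fintype.linearIndependent_iff.1 hli (fun i => c (Sum.inr i)) ?_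
    have h0 : ∑ i, c (Sum.inr i) • D.liftFrame x₀ (Sum.inr i) v = 0 := by
      rw [← hc]
      simp [hl]
    have h1 := congrArg (ContinuousLinearMap.snd ℝ E E) h0
    have h2 := (map_sum (ContinuousLinearMap.snd ℝ E E) _ _).symm.trans h1
    refine Eq.trans (Finset.sum_congr rfl fun i _ => ?_) (h2.trans (map_zero _))
    exact (congrArg (fun w : E => c (Sum.inr i) • w)
      (congrArg Prod.snd (vLift_tangent v (D.frame x₀ i v.proj)))).symm
  rintro (i | i)
  exacts [hl i, hr i]

lemma liftFrame_mem_liftSpace (x₀ : M) {v : TangentBundle I M} (hv : v.proj ∈ D.frameSet x₀)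
    (j : Fin r ⊕ Fin r) : D.liftFrame x₀ j v ∈ D.liftSpace v := by
  apply Submodule.subset_span
  rcases j with i | i
  · exact Or.inl ⟨D.frame x₀ i, D.isSectionAt_frame x₀ i hv, rfl⟩
  · exact Or.inr ⟨D.frame x₀ i, D.isSectionAt_frame x₀ i hv, rfl⟩

lemma card_sum_fin (r : ℕ) : Fintype.card (Fin r ⊕ Fin r) = 2 * r := by
  simp [two_mul]

variable {D} {K : RegularDistribution I.tangent (TangentBundle I M) (2 * r)}

lemma liftFrame_mem (hlift : ∀ v, K.space v = D.liftSpace v)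
    (x₀ : M) {v : TangentBundle I M} (hv : v.proj ∈ D.frameSet x₀)
    (j : Fin r ⊕ Fin r) : D.liftFrame x₀ j v ∈ K.space v := by
  rw [hlift]
  exact D.liftFrame_mem_liftSpace x₀ hv j

lemma isSectionAt_liftFrame (hlift : ∀ v, K.space v = D.liftSpace v)
    (x₀ : M) {v : TangentBundle I M} (hv : v.proj ∈ D.frameSet x₀)
    (j : Fin r ⊕ Fin r) : K.IsSectionAt (D.liftFrame x₀ j) v := by
  refine ⟨?_, ?_⟩
  · rcases j with i | i
    · exact contMDiffAt_completeLift (D.isSectionAt_frame x₀ i hv).1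
    · exact contMDiffAt_vLift (D.isSectionAt_frame x₀ i hv).1
  · have hcont := (FiberBundle.continuous_proj E (TangentSpace I : M → Type _)).continuousAt (x := v)
    filter_upwards [hcont.eventually ((D.isOpen_frameSet x₀).mem_nhds hv)] with u hu
    exact liftFrame_mem hlift x₀ hu j

lemma span_liftFrame (hlift : ∀ v, K.space v = D.liftSpace v)
    (x₀ : M) {v : TangentBundle I M} (hv : v.proj ∈ D.frameSet x₀) :
    Submodule.span ℝ (range fun j => D.liftFrame x₀ j v) = K.space v :=
  span_eq_space (card_sum_fin r) (liftFrame_mem hlift x₀ hv) (D.linearIndependent_liftFrame x₀ hv)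

/-- The basis of a fibre of the lifted distribution given by the preferred frame. -/
def liftBasis (hlift : ∀ v, K.space v = D.liftSpace v)
    (v : TangentBundle I M) : Module.Basis (Fin r ⊕ Fin r) ℝ (K.space v) :=
  basisOfIndependent (card_sum_fin r) (liftFrame_mem hlift v.proj (D.mem_frameSet v.proj))
    (D.linearIndependent_liftFrame v.proj (D.mem_frameSet v.proj))

lemma coe_liftBasis (hlift : ∀ v, K.space v = D.liftSpace v)
    (v : TangentBundle I M) (j : Fin r ⊕ Fin r) :
    (liftBasis hlift v j : TangentSpace I.tangent v) = D.liftFrame v.proj j v :=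
  coe_basisOfIndependent _ _ _ j

end DualValues
end RegularDistribution

/-! ### The foliated Tulczyjew isomorphism -/

namespace RegularDistribution

section Tulczyjew

variable {E : Type*} [NormedAddCommGroup E] [NormedSpace ℝ E] [FiniteDimensional ℝ E]
  {H : Type*} [TopologicalSpace H] {I : ModelWithCorners ℝ E H} [I.Boundaryless]
  {M : Type*} [TopologicalSpace M] [ChartedSpace H M] [IsManifold I ∞ M] {r : ℕ}
  {D : RegularDistribution I M r}
  {K : RegularDistribution I.tangent (TangentBundle I M) (2 * r)}

/-- The foliated Tulczyjew map `T(D*) → K*`. -/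
def tulczyjew (hlift : ∀ v, K.space v = D.liftSpace v)
    (ξ : TangentBundle (dualModel I r) D.DualTotal) : K.DualTotal :=
  K.dualOfValues (liftBasis hlift (D.tangentProj ξ))
    (Sum.elim (fun i => mdiffApply (dualModel I r) (D.evalSec (D.frame ξ.proj.proj i)) ξ)
      (fun i => D.evalSec (D.frame ξ.proj.proj i) ξ.proj))

lemma evalSec_tulczyjew_self (hlift : ∀ v, K.space v = D.liftSpace v)
    (ξ : TangentBundle (dualModel I r) D.DualTotal) (j : Fin r ⊕ Fin r) :
    K.evalSec (D.liftFrame ξ.proj.proj j) (tulczyjew hlift ξ) =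
      Sum.elim (fun i => mdiffApply (dualModel I r) (D.evalSec (D.frame ξ.proj.proj i)) ξ)
      (fun i => D.evalSec (D.frame ξ.proj.proj i) ξ.proj) j :=
  K.evalSec_dualOfValues _ _ (coe_liftBasis hlift (D.tangentProj ξ) j)

/-- The coefficients of a smooth section in the preferred frame. -/
lemma exists_coeff {X : ∀ x : M, TangentSpace I x} {q : M} (hX : D.IsSectionAt X q) :
    ∃ c : Fin r → M → ℝ, (∀ i, ContMDiffAt I 𝓘(ℝ, ℝ) ∞ (c i) q) ∧
      ∀ᶠ x in 𝓝 q, X x = ∑ i, c i x • D.frame q i x := by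
  obtain ⟨Θ, h1, -, h2⟩ := D.exists_coframe_of_sections (Fintype.card_fin r)
    (fun i => D.isSectionAt_frame q i (D.mem_frameSet q))
    (D.linearIndependent_frame q (D.mem_frameSet q))
  refine ⟨fun i x => Θ x (X x) i, fun i => ?_, ?_⟩
  · have h3 : ContMDiffAt I 𝓘(ℝ, Fin r → ℝ) ∞ (fun x => Θ x (X x)) q :=
      ContMDiffAt.comp (f := fun x => (⟨x, X x⟩ : TangentBundle I M)) q
        (h1 ⟨q, X q⟩ rfl) hX.1
    exact contMDiffAt_pi_space.1 h3 i
  · filter_upwards [h2, hX.2] with x hx hxD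
    exact hx _ hxD

lemma mdifferentiableAt_evalSec {X : ∀ x : M, TangentSpace I x} {z : D.DualTotal}
    (hX : D.IsSectionAt X z.proj) :
    MDifferentiableAt (dualModel I r) 𝓘(ℝ, ℝ) (D.evalSec X) z :=
  (D.contMDiffAt_evalSec hX).mdifferentiableAt (by simp)

lemma mdifferentiableAt_dualProj (z : D.DualTotal) :
    MDifferentiableAt (dualModel I r) I (π (Fin r → ℝ) D.Dual) z :=
  (D.hasMFDerivAt_dualProj z).mdifferentiableAt

lemma eventually_frame_mem (q : M) :
    ∀ᶠ x in 𝓝 q, ∀ i, D.frame q i x ∈ D.space x := by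
  filter_upwards [(D.isOpen_frameSet q).mem_nhds (D.mem_frameSet q)] with x hx i
  exact (D.isSectionAt_frame q i hx).2.self_of_nhds

/-- The Tulczyjew map on lifts of an arbitrary section. -/
lemma evalSec_tulczyjew (hlift : ∀ v, K.space v = D.liftSpace v)
    (ξ : TangentBundle (dualModel I r) D.DualTotal) {X : ∀ x : M, TangentSpace I x}
    (hX : D.IsSectionAt X ξ.proj.proj) :
    K.evalSec (completeLift X) (tulczyjew hlift ξ) =
        mdiffApply (dualModel I r) (D.evalSec X) ξ ∧
      K.evalSec (fun v => vLift I v (X v.proj)) (tulczyjew hlift ξ) = D.evalSec X ξ.proj := by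
  set q := ξ.proj.proj with hq
  set v := D.tangentProj ξ with hv
  obtain ⟨c, hc, hcX⟩ := exists_coeff hX
  have hmem : ∀ j, D.liftFrame q j (tulczyjew hlift ξ).proj ∈ K.space (tulczyjew hlift ξ).proj :=
    liftFrame_mem hlift q (v := v) (D.mem_frameSet q)
  have hcd : ∀ i, MDifferentiableAt I 𝓘(ℝ, ℝ) (c i) q := fun i =>
    (hc i).mdifferentiableAt (by simp)
  have hfr := eventually_frame_mem (D := D) q
  have hsum : ∀ᶠ z : D.DualTotal in 𝓝 ξ.proj, D.evalSec X z =
      ∑ i, c i z.proj * D.evalSec (D.frame q i) z := by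
    filter_upwards [D.continuous_dualProj.continuousAt.eventually hcX,
      D.continuous_dualProj.continuousAt.eventually hfr] with z hz hz'
    exact D.evalSec_eq_sum hz' _ hz
  constructor
  · have h1 : completeLift X v = ∑ j, Sum.elim (fun i => c i q)
        (fun i => mdiffApply I (c i) v) j • D.liftFrame q j v := by
      rw [completeLift_sum_smul (s := D.frame q) (c := c) (hX.1.mdifferentiableAt (by simp))
        (fun i => D.mdifferentiableAt_frame q i (D.mem_frameSet q)) hcd hcX,
        Fintype.sum_sum_type, Finset.sum_add_distrib]
      rfl
    rw [K.evalSec_eq_sum (t := completeLift X) hmem _ h1]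
    have h2 : ∀ j, K.evalSec (D.liftFrame q j) (tulczyjew hlift ξ) = _ :=
      evalSec_tulczyjew_self hlift ξ
    simp only [h2]
    rw [Fintype.sum_sum_type, mdiffApply_congr hsum]
    have h3 := mdiffApply_sum_smul (I := dualModel I r) (v := ξ)
      (c := fun i => c i ∘ π (Fin r → ℝ) D.Dual) (f := fun i => D.evalSec (D.frame q i))
      (fun i => (hcd i).comp ξ.proj (mdifferentiableAt_dualProj ξ.proj))
      (fun i => mdifferentiableAt_evalSec (D.isSectionAt_frame q i (D.mem_frameSet q)))
    refine Eq.trans ?_ h3.symm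
    rw [Finset.sum_add_distrib]
    refine congrArg₂ (· + ·) rfl (Finset.sum_congr rfl fun i _ => ?_)
    rw [mdiffApply_comp (hcd i) (mdifferentiableAt_dualProj ξ.proj)]
    rfl
  · have h1 : vLift I v (X v.proj) = ∑ j, Sum.elim (fun _ => 0)
        (fun i => c i q) j • D.liftFrame q j v := by
      rw [Fintype.sum_sum_type]
      simp only [Sum.elim_inl, Sum.elim_inr, zero_smul, Finset.sum_const_zero, zero_add]
      have h0 : X v.proj = ∑ i, c i q • D.frame q i q := hcX.self_of_nhds
      refine (congrArg (vLift I v) h0).trans ?_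
      refine (map_sum (vLift I v) _ _).trans (Finset.sum_congr rfl fun i _ => ?_)
      exact map_smul (vLift I v) (c i q) (D.frame q i q)
    rw [K.evalSec_eq_sum (t := fun v => vLift I v (X v.proj)) hmem _ h1]
    have h2 : ∀ j, K.evalSec (D.liftFrame q j) (tulczyjew hlift ξ) = _ :=
      evalSec_tulczyjew_self hlift ξ
    simp only [h2]
    rw [Fintype.sum_sum_type, hsum.self_of_nhds]
    simp only [Sum.elim_inl, Sum.elim_inr, zero_mul, Finset.sum_const_zero, zero_add]
    rfl

lemma evalSec_tulczyjew_liftFrame (hlift : ∀ v, K.space v = D.liftSpace v)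
    (ξ : TangentBundle (dualModel I r) D.DualTotal) {x₀ : M} (h : ξ.proj.proj ∈ D.frameSet x₀)
    (j : Fin r ⊕ Fin r) :
    K.evalSec (D.liftFrame x₀ j) (tulczyjew hlift ξ) =
      Sum.elim (fun i => mdiffApply (dualModel I r) (D.evalSec (D.frame x₀ i)) ξ)
      (fun i => D.evalSec (D.frame x₀ i) ξ.proj) j := by
  rcases j with i | i
  · exact (evalSec_tulczyjew hlift ξ (D.isSectionAt_frame x₀ i h)).1
  · exact (evalSec_tulczyjew hlift ξ (D.isSectionAt_frame x₀ i h)).2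

lemma contMDiff_tulczyjew (hlift : ∀ v, K.space v = D.liftSpace v) :
    ContMDiff (dualModel I r).tangent (dualModel I.tangent (2 * r)) ∞ (tulczyjew hlift) := by
  intro ξ₀
  have hq := D.mem_frameSet ξ₀.proj.proj
  refine K.contMDiffAt_dualTotal (card_sum_fin r)
    (isSectionAt_liftFrame hlift ξ₀.proj.proj (v := D.tangentProj ξ₀) hq)
    (D.linearIndependent_liftFrame ξ₀.proj.proj (v := D.tangentProj ξ₀) hq)
    (D.contMDiff_tangentProj ξ₀) fun j => ?_
  have hcont : ContinuousAt (fun ξ : TangentBundle (dualModel I r) D.DualTotal => ξ.proj.proj) ξ₀ :=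
    (D.continuous_dualProj.comp (FiberBundle.continuous_proj (E × (Fin r → ℝ))
      (TangentSpace (dualModel I r) : D.DualTotal → Type _))).continuousAt
  have hev := hcont.eventually ((D.isOpen_frameSet ξ₀.proj.proj).mem_nhds hq)
  rcases j with i | i
  · have h1 : ContMDiffAt (dualModel I r).tangent 𝓘(ℝ, ℝ) ∞
        (mdiffApply (dualModel I r) (D.evalSec (D.frame ξ₀.proj.proj i))) ξ₀ :=
      contMDiffAt_mdiffApply (D.contMDiffAt_evalSec_frame ξ₀.proj.proj i hq)
    refine h1.congr_of_eventuallyEq ?_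
    filter_upwards [hev] with ξ hξ
    exact evalSec_tulczyjew_liftFrame hlift ξ hξ (Sum.inl i)
  · have h1 : ContMDiffAt (dualModel I r).tangent 𝓘(ℝ, ℝ) ∞
        (fun ξ : TangentBundle (dualModel I r) D.DualTotal =>
          D.evalSec (D.frame ξ₀.proj.proj i) ξ.proj) ξ₀ :=
      ContMDiffAt.comp ξ₀ (D.contMDiffAt_evalSec_frame ξ₀.proj.proj i hq)
        (contMDiffAt_proj (TangentSpace (dualModel I r) : D.DualTotal → Type _))
    refine h1.congr_of_eventuallyEq ?_
    filter_upwards [hev] with ξ hξ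
    exact evalSec_tulczyjew_liftFrame hlift ξ hξ (Sum.inr i)

/-- The inverse of the foliated Tulczyjew map. -/
def tulczyjewSymm (D : RegularDistribution I M r)
    (K : RegularDistribution I.tangent (TangentBundle I M) (2 * r)) (κ : K.DualTotal) :
    TangentBundle (dualModel I r) D.DualTotal :=
  ⟨D.dualOfValues (D.frameBasis κ.proj.proj (D.mem_frameSet κ.proj.proj))
      (fun i => K.evalSec (D.liftFrame κ.proj.proj (Sum.inr i)) κ),
    (show E × (Fin r → ℝ) from
      ((show E from κ.proj.2), fun i => K.evalSec (D.liftFrame κ.proj.proj (Sum.inl i)) κ))⟩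

lemma evalSec_tulczyjewSymm_self (κ : K.DualTotal) (i : Fin r) :
    D.evalSec (D.frame κ.proj.proj i) (tulczyjewSymm D K κ).proj =
      K.evalSec (D.liftFrame κ.proj.proj (Sum.inr i)) κ :=
  D.evalSec_dualOfValues _ _ (D.coe_frameBasis _ _ i)

lemma mdiffApply_tulczyjewSymm_self (κ : K.DualTotal) (i : Fin r) :
    mdiffApply (dualModel I r) (D.evalSec (D.frame κ.proj.proj i)) (tulczyjewSymm D K κ) =
      K.evalSec (D.liftFrame κ.proj.proj (Sum.inl i)) κ :=
  D.mdiffApply_evalSec_frame_self (tulczyjewSymm D K κ) i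

lemma tangentProj_tulczyjewSymm (κ : K.DualTotal) :
    D.tangentProj (tulczyjewSymm D K κ) = κ.proj := by
  rw [tangentProj_eq]
  rfl

lemma tulczyjew_tulczyjewSymm (hlift : ∀ v, K.space v = D.liftSpace v) (κ : K.DualTotal) :
    tulczyjew hlift (tulczyjewSymm D K κ) = κ := by
  refine K.dualTotal_ext (s := D.liftFrame κ.proj.proj) (tangentProj_tulczyjewSymm κ)
    (span_liftFrame hlift κ.proj.proj (v := D.tangentProj (tulczyjewSymm D K κ))
      (D.mem_frameSet κ.proj.proj)) fun j => ?_
  refine (evalSec_tulczyjew_self hlift (tulczyjewSymm D K κ) j).trans ?_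
  rcases j with i | i
  · exact mdiffApply_tulczyjewSymm_self κ i
  · exact evalSec_tulczyjewSymm_self κ i

lemma tulczyjewSymm_tulczyjew (hlift : ∀ v, K.space v = D.liftSpace v)
    (ξ : TangentBundle (dualModel I r) D.DualTotal) :
    tulczyjewSymm D K (tulczyjew hlift ξ) = ξ := by
  have h1 : (tulczyjewSymm D K (tulczyjew hlift ξ)).proj = ξ.proj := by
    refine D.dualTotal_ext (s := D.frame ξ.proj.proj) rfl
      (D.span_frame ξ.proj.proj (D.mem_frameSet ξ.proj.proj)) fun i => ?_
    refine (evalSec_tulczyjewSymm_self (D := D) (tulczyjew hlift ξ) i).trans ?_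
    exact evalSec_tulczyjew_self hlift ξ (Sum.inr i)
  have h2 : (show E × (Fin r → ℝ) from (tulczyjewSymm D K (tulczyjew hlift ξ)).2) =
      (show E × (Fin r → ℝ) from ξ.2) := by
    refine Prod.ext ?_ (funext fun i => ?_)
    · have h3 := D.tangentProj_eq ξ
      exact congrArg (fun v : TangentBundle I M => (show E from v.2)) h3
    · refine (evalSec_tulczyjew_self hlift ξ (Sum.inl i)).trans ?_
      exact D.mdiffApply_evalSec_frame_self ξ i
  obtain ⟨z, ξ⟩ := ξ
  exact TotalSpace.ext h1 (heq_of_eq h2)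

lemma evalSec_tulczyjewSymm (hlift : ∀ v, K.space v = D.liftSpace v) (κ : K.DualTotal) {x₀ : M}
    (h : κ.proj.proj ∈ D.frameSet x₀) (i : Fin r) :
    D.evalSec (D.frame x₀ i) (tulczyjewSymm D K κ).proj =
      K.evalSec (D.liftFrame x₀ (Sum.inr i)) κ := by
  have h1 := evalSec_tulczyjew_liftFrame hlift (tulczyjewSymm D K κ) (x₀ := x₀) h (Sum.inr i)
  rw [tulczyjew_tulczyjewSymm] at h1
  exact h1.symm

lemma mdiffApply_tulczyjewSymm (hlift : ∀ v, K.space v = D.liftSpace v) (κ : K.DualTotal) {x₀ : M}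
    (h : κ.proj.proj ∈ D.frameSet x₀) (i : Fin r) :
    mdiffApply (dualModel I r) (D.evalSec (D.frame x₀ i)) (tulczyjewSymm D K κ) =
      K.evalSec (D.liftFrame x₀ (Sum.inl i)) κ := by
  have h1 := evalSec_tulczyjew_liftFrame hlift (tulczyjewSymm D K κ) (x₀ := x₀) h (Sum.inl i)
  rw [tulczyjew_tulczyjewSymm] at h1
  exact h1.symm

lemma contMDiff_tulczyjewSymm (hlift : ∀ v, K.space v = D.liftSpace v) :
    ContMDiff (dualModel I.tangent (2 * r)) (dualModel I r).tangent ∞ (tulczyjewSymm D K) := by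
  intro κ₀
  set q := κ₀.proj.proj with hqdef
  have hq := D.mem_frameSet q
  have hp1 : ContMDiffAt (dualModel I.tangent (2 * r)) I.tangent ∞
      (fun κ : K.DualTotal => κ.proj) κ₀ := contMDiffAt_proj K.Dual
  have hp : ContMDiffAt (dualModel I.tangent (2 * r)) I ∞
      (fun κ : K.DualTotal => κ.proj.proj) κ₀ :=
    ContMDiffAt.comp κ₀ (contMDiffAt_proj (TangentSpace I : M → Type _)) hp1
  have hev := hp.continuousAt.eventually ((D.isOpen_frameSet q).mem_nhds hq)
  have hK : ∀ j, ContMDiffAt (dualModel I.tangent (2 * r)) 𝓘(ℝ, ℝ) ∞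
      (K.evalSec (D.liftFrame q j)) κ₀ := fun j =>
    K.contMDiffAt_evalSec (isSectionAt_liftFrame hlift q hq j)
  have hbase : ContMDiffAt (dualModel I.tangent (2 * r)) (dualModel I r) ∞
      (fun κ : K.DualTotal => (tulczyjewSymm D K κ).proj) κ₀ := by
    refine D.contMDiffAt_dualTotal (Fintype.card_fin r) (s := D.frame q)
      (fun i => D.isSectionAt_frame q i hq) (D.linearIndependent_frame q hq) hp fun i => ?_
    refine (hK (Sum.inr i)).congr_of_eventuallyEq ?_
    filter_upwards [hev] with κ hκ
    exact evalSec_tulczyjewSymm hlift κ hκ i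
  refine contMDiffAt_tangentBundle hbase ?_
  have h1 : ContMDiffAt (dualModel I.tangent (2 * r)) 𝓘(ℝ, E × (Fin r → ℝ)) ∞
      (fun κ : K.DualTotal => ((chartDeriv I q κ.proj.proj κ.proj.2,
        fun i => K.evalSec (D.liftFrame q (Sum.inl i)) κ) : E × (Fin r → ℝ))) κ₀ :=
    ContMDiffAt.prodMk_space
      (ContMDiffAt.comp κ₀ (contMDiffAt_chart_snd (v := κ₀.proj) (mem_extChartAt_source q)) hp1)
      (contMDiffAt_pi_space.2 fun i => hK (Sum.inl i))
  refine h1.congr_of_eventuallyEq ?_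
  filter_upwards [hev, hp.continuousAt.eventually (extChartAt_source_mem_nhds (I := I) q)]
    with κ hκ hκ'
  have hsrc : (tulczyjewSymm D K κ).proj ∈
      (extChartAt (dualModel I r) (tulczyjewSymm D K κ₀).proj).source :=
    D.mem_extChartAt_source_dualTotal.2 ⟨hκ, hκ'⟩
  refine Prod.ext ?_ (funext fun i => ?_)
  · refine (D.chartDeriv_dual_fst hsrc).trans ?_
    have h3 := D.tangentProj_eq (tulczyjewSymm D K κ)
    exact congrArg (fun v : TangentBundle I M => chartDeriv I q v.proj v.2) h3
  · refine (D.mdiffApply_evalSec_frame hsrc i).symm.trans ?_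
    exact mdiffApply_tulczyjewSymm hlift κ hκ i

/-- The foliated Tulczyjew isomorphism. -/
def tulczyjewDiffeomorph (hlift : ∀ v, K.space v = D.liftSpace v) :
    Diffeomorph (dualModel I r).tangent (dualModel I.tangent (2 * r))
      (TangentBundle (dualModel I r) D.DualTotal) K.DualTotal ∞ where
  toFun := tulczyjew hlift
  invFun := tulczyjewSymm D K
  left_inv := tulczyjewSymm_tulczyjew hlift
  right_inv := tulczyjew_tulczyjewSymm hlift
  contMDiff_toFun := contMDiff_tulczyjew hlift
  contMDiff_invFun := contMDiff_tulczyjewSymm hlift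

lemma tulczyjew_tangentZero (hlift : ∀ v, K.space v = D.liftSpace v) (v : TangentBundle I M) :
    tulczyjew hlift (D.tangentZero v) = zeroSection (Fin (2 * r) → ℝ) K.Dual v := by
  refine K.dualTotal_ext (s := D.liftFrame v.proj) (D.tangentProj_tangentZero v)
    (span_liftFrame hlift v.proj (v := D.tangentProj (D.tangentZero v))
      (D.mem_frameSet v.proj)) fun j => ?_
  refine (evalSec_tulczyjew_self hlift (D.tangentZero v) j).trans ?_
  rw [evalSec_zero]
  rcases j with i | i
  · refine (D.mdiffApply_evalSec_frame_self (D.tangentZero v) i).trans ?_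
    rw [tangentZero_eq]
    rfl
  · exact D.evalSec_zero

end Tulczyjew
end RegularDistribution

namespace RegularDistribution

section TulczyjewCurves

variable {E : Type*} [NormedAddCommGroup E] [NormedSpace ℝ E] [FiniteDimensional ℝ E]
  {H : Type*} [TopologicalSpace H] {I : ModelWithCorners ℝ E H} [I.Boundaryless]
  {M : Type*} [TopologicalSpace M] [ChartedSpace H M] [IsManifold I ∞ M] {r : ℕ}
  {D : RegularDistribution I M r}
  {K : RegularDistribution I.tangent (TangentBundle I M) (2 * r)}

lemma mdiffApply_real {F : Type*} [NormedAddCommGroup F] [NormedSpace ℝ F] (f : ℝ → F) :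
    mdiffApply 𝓘(ℝ, ℝ) f (⟨0, (1 : ℝ)⟩ : TangentBundle 𝓘(ℝ, ℝ) ℝ) = deriv f 0 := by
  rw [mdiffApply, mfderiv_eq_fderiv]
  rfl

/-- The components of the velocity of a curve of tangent vectors. -/
lemma velocity_tangent_snd {Y : ℝ → TangentBundle I M}
    (hY : ContMDiffAt 𝓘(ℝ, ℝ) I.tangent ∞ Y 0) :
    (velocity I.tangent Y).2 =
      ((mdiffApply 𝓘(ℝ, ℝ) (fun t => extChartAt I (Y 0).proj (Y t).proj)
          (⟨0, (1 : ℝ)⟩ : TangentBundle 𝓘(ℝ, ℝ) ℝ),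
        mdiffApply 𝓘(ℝ, ℝ) (fun t => chartDeriv I (Y 0).proj (Y t).proj (Y t).2)
          (⟨0, (1 : ℝ)⟩ : TangentBundle 𝓘(ℝ, ℝ) ℝ)) : E × E) := by
  have hYd : MDifferentiableAt 𝓘(ℝ, ℝ) I.tangent Y 0 := hY.mdifferentiableAt (by simp)
  have h1 := mdiffApply_extChartAt_comp (I := I.tangent) (J := 𝓘(ℝ, ℝ))
    (ξ := (⟨0, (1 : ℝ)⟩ : TangentBundle 𝓘(ℝ, ℝ) ℝ)) hYd
  have h2 : MDifferentiableAt 𝓘(ℝ, ℝ) 𝓘(ℝ, E × E) (extChartAt I.tangent (Y 0) ∘ Y) 0 :=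
    MDifferentiableAt.comp 0 (mdifferentiableAt_extChartAt' (mem_extChartAt_source _)) hYd
  have h3 : ∀ᶠ t in 𝓝 (0 : ℝ), (extChartAt I.tangent (Y 0) ∘ Y) t =
      ((extChartAt I (Y 0).proj (Y t).proj, chartDeriv I (Y 0).proj (Y t).proj (Y t).2) : E × E) := by
    have hcont := (FiberBundle.continuous_proj E (TangentSpace I : M → Type _)).continuousAt.comp
      hY.continuousAt
    filter_upwards [hcont.eventually (extChartAt_source_mem_nhds (I := I) (Y 0).proj)] with t ht
    exact tangent_extChartAt_apply ht
  refine Eq.trans h1.symm (Prod.ext ?_ ?_)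
  · refine (mdiffApply_clm_comp (ContinuousLinearMap.fst ℝ E E) h2).symm.trans ?_
    exact mdiffApply_congr (h3.mono fun t ht => congrArg Prod.fst ht)
  · refine (mdiffApply_clm_comp (ContinuousLinearMap.snd ℝ E E) h2).symm.trans ?_
    exact mdiffApply_congr (h3.mono fun t ht => congrArg Prod.snd ht)

lemma tangent_tangent_ext {x : M} {a b : E} {c d : E × E} (hab : a = b) (hcd : c = d) :
    (⟨(⟨x, a⟩ : TangentBundle I M), c⟩ : TangentBundle I.tangent (TangentBundle I M)) =
      ⟨(⟨x, b⟩ : TangentBundle I M), d⟩ := by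
  subst hab hcd
  rfl

lemma isTulczyjew_tulczyjew (hlift : ∀ v, K.space v = D.liftSpace v) :
    D.IsTulczyjew K (tulczyjew hlift) := by
  refine ⟨fun ξ => rfl, fun c y hc hY => ?_⟩
  set ξ := velocity (dualModel I r) c with hξ
  set v := D.tangentProj ξ with hv
  let q : M := (c 0).proj
  let o : TangentBundle 𝓘(ℝ, ℝ) ℝ := ⟨0, (1 : ℝ)⟩
  let Y : ℝ → TangentBundle I M := fun t => ⟨(c t).proj, (y t : TangentSpace I (c t).proj)⟩
  have hq := D.mem_frameSet q
  have hcd : MDifferentiableAt 𝓘(ℝ, ℝ) (dualModel I r) c 0 :=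
    (hc 0).mdifferentiableAt (by simp)
  have hγ : MDifferentiableAt 𝓘(ℝ, ℝ) I (fun t => (c t).proj) 0 :=
    MDifferentiableAt.comp 0 (mdifferentiableAt_dualProj (c 0)) hcd
  have hγc : ContinuousAt (fun t => (c t).proj) 0 := hγ.continuousAt
  have hγt : tangentMap 𝓘(ℝ, ℝ) I (fun t => (c t).proj) o = v := by
    have := tangentMap_comp_at (I := 𝓘(ℝ, ℝ)) (I' := dualModel I r) (I'' := I) (f := c)
      (g := π (Fin r → ℝ) D.Dual) o (mdifferentiableAt_dualProj (c 0)) hcd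
    exact this
  obtain ⟨Θ, hΘ, -, hΘ'⟩ := D.exists_coframe_of_sections (Fintype.card_fin r)
    (fun i => D.isSectionAt_frame q i hq) (D.linearIndependent_frame q hq)
  let a : Fin r → ℝ → ℝ := fun i t => Θ (c t).proj (y t) i
  have ha : ∀ i, MDifferentiableAt 𝓘(ℝ, ℝ) 𝓘(ℝ, ℝ) (a i) 0 := fun i => by
    have h1 : ContMDiffAt 𝓘(ℝ, ℝ) 𝓘(ℝ, Fin r → ℝ) ∞ (fun t => Θ (c t).proj (y t)) 0 :=
      ContMDiffAt.comp 0 (hΘ (Y 0) rfl) (hY 0)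
    exact (contMDiffAt_pi_space.1 h1 i).mdifferentiableAt (by simp)
  have hya : ∀ᶠ t in 𝓝 (0 : ℝ), (y t : TangentSpace I (c t).proj) =
      ∑ i, a i t • D.frame q i (c t).proj := by
    filter_upwards [hγc.eventually hΘ'] with t ht
    exact ht _ (y t).2
  let w : TangentSpace I.tangent v := ∑ j, Sum.elim (fun i => a i 0)
    (fun i => mdiffApply 𝓘(ℝ, ℝ) (a i) o) j • D.liftFrame q j v
  have hmem : ∀ j, D.liftFrame q j v ∈ K.space v := liftFrame_mem hlift q (v := v) hq
  have hw : w ∈ K.space v := Submodule.sum_mem _ fun j _ => Submodule.smul_mem _ _ (hmem j)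
  refine ⟨⟨w, hw⟩, ?_, ?_⟩
  · have hvel := velocity_tangent_snd (Y := Y) (hY 0)
    have h1 : mdiffApply 𝓘(ℝ, ℝ) (fun t => extChartAt I q (c t).proj) o = v.2 := by
      have h2 := mdiffApply_extChartAt_comp (I := I) (J := 𝓘(ℝ, ℝ)) (ξ := o) hγ
      refine h2.trans ?_
      exact congrArg (fun u : TangentBundle I M => (show E from u.2)) hγt
    have h2 : mdiffApply 𝓘(ℝ, ℝ) (fun t => chartDeriv I q (c t).proj (y t)) o =
        (show E × E from w).2 := by
      have h3 : (fun t => chartDeriv I q (c t).proj (y t)) =ᶠ[𝓝 0]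
          fun t => ∑ i, a i t • chartDeriv I q (c t).proj (D.frame q i (c t).proj) := by
        filter_upwards [hya] with t ht
        rw [ht, map_sum]
        exact Finset.sum_congr rfl fun i _ => map_smul _ _ _
      have hfd : ∀ i, MDifferentiableAt I 𝓘(ℝ, E) (fun x => chartDeriv I q x (D.frame q i x)) q :=
        fun i => mdifferentiableAt_chartDeriv (mem_extChartAt_source q)
          (D.mdifferentiableAt_frame q i hq)
      refine (mdiffApply_congr (v := o) h3).trans ?_
      refine (mdiffApply_sum_smul (v := o) ha
        (fun i => MDifferentiableAt.comp (0 : ℝ) (hfd i) hγ)).trans ?_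
      rw [Finset.sum_add_distrib]
      refine Eq.trans ?_ (map_sum (ContinuousLinearMap.snd ℝ E E) _ _).symm
      rw [Fintype.sum_sum_type]
      refine congrArg₂ (· + ·) (Finset.sum_congr rfl fun i _ => ?_)
        (Finset.sum_congr rfl fun i _ => ?_)
      · have h4 := mdiffApply_comp (ξ := o) (hfd i) hγ
        have h5 : mdiffApply 𝓘(ℝ, ℝ)
            (fun t => chartDeriv I q (c t).proj (D.frame q i (c t).proj)) o =
            (show E × E from completeLift (D.frame q i) v).2 := by
          refine h4.trans ?_
          rw [hγt, completeLift_eq (v := v) (D.mdifferentiableAt_frame q i hq)]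
          rfl
        exact congrArg (fun u : E => a i 0 • u) h5
      · have h5 : chartDeriv I q q (D.frame q i q) =
            (show E × E from vLift I v (D.frame q i v.proj)).2 := by
          rw [chartDeriv_self, vLift_tangent]
          rfl
        exact congrArg (fun u : E => mdiffApply 𝓘(ℝ, ℝ) (a i) o • u) h5
    have h3 : (show E × E from w).1 = (y 0 : TangentSpace I (c 0).proj) := by
      refine Eq.trans (map_sum (ContinuousLinearMap.fst ℝ E E) _ _) ?_
      rw [Fintype.sum_sum_type]
      refine Eq.trans ?_ hya.self_of_nhds.symm
      refine (congrArg₂ (· + ·) rfl (Finset.sum_eq_zero fun i _ => ?_)).trans (add_zero _)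
      exact smul_zero (mdiffApply 𝓘(ℝ, ℝ) (a i) o)
    have h4 : (⟨v, w⟩ : TangentBundle I.tangent (TangentBundle I M)) =
        ⟨⟨q, (comps (velocity I.tangent Y).2).1⟩,
          (show E × E from ((show E from (y 0 : TangentSpace I (c 0).proj)),
            (comps (velocity I.tangent Y).2).2))⟩ := by
      refine tangent_tangent_ext (x := q) (a := (show E from v.2)) (c := (show E × E from w)) ?_
        (Prod.ext h3 ?_)
      · exact (h1.symm.trans (congrArg Prod.fst hvel).symm)
      · exact h2.symm.trans (congrArg Prod.snd hvel).symm
    exact h4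
  · have h1 := K.pair_eq_sum (z := tulczyjew hlift ξ) (s := D.liftFrame q) hmem ⟨w, hw⟩ _ rfl
    refine h1.trans ?_
    have h2 : (fun t => D.pair (c t).2 (y t)) =ᶠ[𝓝 0]
        fun t => ∑ i, a i t • D.evalSec (D.frame q i) (c t) := by
      filter_upwards [hya, hγc.eventually (eventually_frame_mem (D := D) q)] with t ht ht'
      exact D.pair_eq_sum ht' (y t) _ ht
    have hed : ∀ i, MDifferentiableAt (dualModel I r) 𝓘(ℝ, ℝ) (D.evalSec (D.frame q i)) (c 0) :=
      fun i => mdifferentiableAt_evalSec (D.isSectionAt_frame q i hq)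
    rw [h2.deriv_eq, ← mdiffApply_real]
    have h3 := mdiffApply_sum_smul (v := o) ha fun i => MDifferentiableAt.comp (0 : ℝ) (hed i) hcd
    refine Eq.trans ?_ h3.symm
    rw [Finset.sum_add_distrib, Fintype.sum_sum_type]
    refine congrArg₂ (· + ·) (Finset.sum_congr rfl fun i _ => ?_)
        (Finset.sum_congr rfl fun i _ => ?_)
    · rw [mdiffApply_comp (ξ := o) (hed i) hcd]
      exact congrArg (fun u : ℝ => a i 0 * u) (evalSec_tulczyjew_self hlift ξ (Sum.inl i))
    · exact congrArg (fun u : ℝ => mdiffApply 𝓘(ℝ, ℝ) (a i) o * u)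
        (evalSec_tulczyjew_self hlift ξ (Sum.inr i))

end TulczyjewCurves
end RegularDistribution

/-! ### The extended Lagrangian -/

namespace RegularDistribution

section VerticalVectors

variable {E : Type*} [NormedAddCommGroup E] [NormedSpace ℝ E] [FiniteDimensional ℝ E]
  {H : Type*} [TopologicalSpace H] {I : ModelWithCorners ℝ E H} [I.Boundaryless]
  {M : Type*} [TopologicalSpace M] [ChartedSpace H M] [IsManifold I ∞ M] {r : ℕ}
  (D : RegularDistribution I M r)

lemma mem_verticalSpace {z : D.DualTotal} {ζ : TangentSpace (dualModel I r) z} :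
    ζ ∈ verticalSpace I z ↔ (show E × (Fin r → ℝ) from ζ).1 = 0 := by
  change mfderiv (dualModel I r) I (π (Fin r → ℝ) D.Dual) z ζ = 0 ↔ _
  rw [(D.hasMFDerivAt_dualProj z).mfderiv]
  rfl

lemma vLift_vDrop {z : D.DualTotal} (ζ : verticalSpace (V := D.Dual) I z) :
    vLift I z (vDrop I z ζ) = ζ := by
  have h1 := (D.mem_verticalSpace (ζ := (ζ : TangentSpace (dualModel I r) z))).1 ζ.2
  refine Prod.ext h1.symm ?_
  exact (fibreCoord (Fin r → ℝ) D.Dual z.proj).apply_symm_apply _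

lemma pair_add {x : M} (μ ν : D.Dual x) (w : D.space x) :
    D.pair (μ + ν) w = D.pair μ w + D.pair ν w := rfl

lemma pair_smul {x : M} (c : ℝ) (μ : D.Dual x) (w : D.space x) :
    D.pair (c • μ) w = c * D.pair μ w := rfl

/-- Derivatives of fibrewise linear functions in vertical directions. -/
lemma mdiffApply_evalSec_vLift {X : ∀ x : M, TangentSpace I x} {z : D.DualTotal}
    (hX : D.IsSectionAt X z.proj) (η : D.Dual z.proj) :
    mdiffApply (dualModel I r) (D.evalSec X)
      (⟨z, vLift I z η⟩ : TangentBundle (dualModel I r) D.DualTotal) =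
      D.evalSec X ⟨z.proj, η⟩ := by
  have hmem := hX.2.self_of_nhds
  have hz : (⟨z.proj, z.2 + (0 : ℝ) • η⟩ : D.DualTotal) = z := by simp
  have h1 := hasMFDerivAt_line (I := I) z η
  have h2 : HasMFDerivAt (dualModel I r) 𝓘(ℝ, ℝ) (D.evalSec X) (⟨z.proj, z.2 + (0 : ℝ) • η⟩ : D.DualTotal)
      (mfderiv (dualModel I r) 𝓘(ℝ, ℝ) (D.evalSec X) z) := by
    rw [hz]
    exact (mdifferentiableAt_evalSec hX).hasMFDerivAt
  have h3 : HasMFDerivAt 𝓘(ℝ, ℝ) 𝓘(ℝ, ℝ)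
      (D.evalSec X ∘ fun t : ℝ => (⟨z.proj, z.2 + t • η⟩ : D.DualTotal)) 0 _ :=
    HasMFDerivAt.comp 0 h2 h1
  have h4 : (D.evalSec X ∘ fun t : ℝ => (⟨z.proj, z.2 + t • η⟩ : D.DualTotal)) =
      fun t => D.evalSec X z + t * D.evalSec X ⟨z.proj, η⟩ := by
    funext t
    rw [Function.comp_apply, D.evalSec_of_mem (z := ⟨z.proj, z.2 + t • η⟩) hmem,
      D.evalSec_of_mem hmem, D.evalSec_of_mem (z := ⟨z.proj, η⟩) hmem, pair_add, pair_smul]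
  rw [h4] at h3
  have h5 : HasDerivAt (fun t : ℝ => D.evalSec X z + t * D.evalSec X ⟨z.proj, η⟩)
      (1 * D.evalSec X ⟨z.proj, η⟩) 0 := ((hasDerivAt_id 0).mul_const _).const_add _
  have h6 := DFunLike.congr_fun (hasMFDerivAt_unique h3 h5.hasFDerivAt.hasMFDerivAt) (1 : ℝ)
  have h7 : mfderiv (dualModel I r) 𝓘(ℝ, ℝ) (D.evalSec X) z ((1 : ℝ) • vLift I z η) =
      (1 : ℝ) • (1 * D.evalSec X ⟨z.proj, η⟩) := h6
  rw [one_smul] at h7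
  exact h7.trans ((one_smul ℝ _).trans (one_mul (D.evalSec X ⟨z.proj, η⟩)))

end VerticalVectors
end RegularDistribution

namespace EhresmannConnection

section ExtendedLagrangian

open RegularDistribution

variable {E : Type*} [NormedAddCommGroup E] [NormedSpace ℝ E] [FiniteDimensional ℝ E]
  {H : Type*} [TopologicalSpace H] {I : ModelWithCorners ℝ E H} [I.Boundaryless]
  {M : Type*} [TopologicalSpace M] [ChartedSpace H M] [IsManifold I ∞ M] {r : ℕ}
  {D : RegularDistribution I M r} (nab : EhresmannConnection D) (P : AlmostProduct D)

lemma sub_vertical_mem (ξ : TangentBundle (dualModel I r) D.DualTotal) :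
    ξ.2 - vLift I ξ.proj (nab.verticalPart ξ) ∈ nab.horizontal.space ξ.proj := by
  rw [verticalPart, vLift_vDrop]
  rw [← Submodule.projectionOnto_apply_eq_zero_iff (nab.isCompl ξ.proj), map_sub,
    Submodule.projectionOnto_apply_left, sub_self]

lemma verticalPart_add_vLift (ξ : TangentBundle (dualModel I r) D.DualTotal)
    (η : D.Dual ξ.proj.proj) :
    nab.verticalPart (⟨ξ.proj, ξ.2 + vLift I ξ.proj η⟩ :
      TangentBundle (dualModel I r) D.DualTotal) = nab.verticalPart ξ + η := by
  have hv : vLift I ξ.proj η ∈ verticalSpace I ξ.proj := (D.mem_verticalSpace).2 rfl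
  have h1 := Submodule.projectionOnto_apply_left (nab.isCompl ξ.proj) ⟨_, hv⟩
  rw [verticalPart, verticalPart]
  refine (congrArg (vDrop I ξ.proj) (map_add _ _ _)).trans ?_
  rw [map_add]
  refine congrArg₂ (· + ·) rfl ((congrArg (vDrop I ξ.proj) h1).trans ?_)
  exact (fibreCoord (Fin r → ℝ) D.Dual ξ.proj.proj).symm_apply_apply η

lemma pair_toSpace_congr {x : M} (μ : D.Dual x) {a b : TangentSpace I x} (h : a = b) :
    D.pair μ (P.toSpace (⟨x, a⟩ : TangentBundle I M)) =
      D.pair μ (P.toSpace (⟨x, b⟩ : TangentBundle I M)) := by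
  rw [h]

lemma tangentProj_snd (ξ : TangentBundle (dualModel I r) D.DualTotal) :
    (show E from (D.tangentProj ξ).2) = (show E × (Fin r → ℝ) from ξ.2).1 :=
  congrArg (fun v : TangentBundle I M => (show E from v.2)) (D.tangentProj_eq ξ)

/-- The extended Lagrangian is affine in vertical directions. -/
lemma extendedLagrangian_add_vLift (L : TangentBundle I M → ℝ)
    (ξ : TangentBundle (dualModel I r) D.DualTotal) (η : D.Dual ξ.proj.proj) :
    nab.extendedLagrangian P L (⟨ξ.proj, ξ.2 + vLift I ξ.proj η⟩ :
      TangentBundle (dualModel I r) D.DualTotal) =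
      nab.extendedLagrangian P L ξ + D.pair η (P.toSpace (D.tangentProj ξ)) := by
  set ξ' : TangentBundle (dualModel I r) D.DualTotal := ⟨ξ.proj, ξ.2 + vLift I ξ.proj η⟩ with hξ'
  have h1 : D.tangentProj ξ' = D.tangentProj ξ := by
    rw [tangentProj_eq, tangentProj_eq]
    exact congrArg (fun a : E => (⟨ξ.proj.proj, a⟩ : TangentBundle I M)) (add_zero _)
  have h2 : (show E from (D.tangentProj ξ').2) = (show E from (D.tangentProj ξ).2) :=
    congrArg (fun v : TangentBundle I M => (show E from v.2)) h1
  have h3 : nab.correction P ξ' = D.pair (nab.verticalPart ξ') (P.toSpace (D.tangentProj ξ)) :=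
    pair_toSpace_congr P (nab.verticalPart ξ') h2
  rw [extendedLagrangian, extendedLagrangian, h1, h3, nab.verticalPart_add_vLift, add_assoc]
  exact congrArg (fun a : ℝ => L (D.tangentProj ξ) + a)
    (D.pair_add (nab.verticalPart ξ) η (P.toSpace (D.tangentProj ξ)))

variable {nab} in
lemma extendedLagrangian_tangentZero (hnab : nab.TrivialAlongZero) (L : TangentBundle I M → ℝ)
    (v : TangentBundle I M) : nab.extendedLagrangian P L (D.tangentZero v) = L v := by
  have h1 : (D.tangentZero v).2 ∈ nab.horizontal.space (D.tangentZero v).proj := by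
    have := hnab v.proj
    rw [tangentZero, tangentMap]
    simp only
    rw [this]
    exact ⟨v.2, rfl⟩
  have h2 : nab.verticalPart (D.tangentZero v) = 0 := by
    rw [verticalPart, (Submodule.projectionOnto_apply_eq_zero_iff
      (nab.isCompl (D.tangentZero v).proj)).2 h1, map_zero]
  rw [extendedLagrangian, tangentProj_tangentZero, correction, h2]
  exact add_zero _

/-- Derivatives of fibrewise linear functions along the vertical part are smooth. -/
lemma contMDiffAt_evalSec_verticalPart (ξ₀ : TangentBundle (dualModel I r) D.DualTotal)
    {X : ∀ x : M, TangentSpace I x} (hX : ∀ᶠ x in 𝓝 ξ₀.proj.proj, D.IsSectionAt X x) :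
    ContMDiffAt (dualModel I r).tangent 𝓘(ℝ, ℝ) ∞
      (fun ξ : TangentBundle (dualModel I r) D.DualTotal =>
        D.evalSec X ⟨ξ.proj.proj, nab.verticalPart ξ⟩) ξ₀ := by
  set z₀ := ξ₀.proj with hz₀
  let h := nab.horizontal.frame z₀
  have hmem := nab.horizontal.mem_frameSet z₀
  have hsec : ∀ a, nab.horizontal.IsSectionAt (h a) z₀ := fun a =>
    nab.horizontal.isSectionAt_frame z₀ a hmem
  have hsrc := mem_extChartAt_source (I := dualModel I r) z₀
  let g : Fin (Module.finrank ℝ E) → D.DualTotal → E := fun a z =>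
    (chartDeriv (dualModel I r) z₀ z (h a z)).1
  have hg : ∀ a, ContMDiffAt (dualModel I r) 𝓘(ℝ, E) ∞ (g a) z₀ := fun a =>
    (ContinuousLinearMap.fst ℝ E (Fin r → ℝ)).contMDiff.contMDiffAt.comp z₀
      (contMDiffAt_chartDeriv hsrc (hsec a).1)
  have hli : LinearIndependent ℝ fun a => g a z₀ := by
    have hli0 := nab.horizontal.linearIndependent_frame z₀ hmem
    rw [Fintype.linearIndependent_iff] at hli0 ⊢
    intro c hc
    refine hli0 c ?_
    have hH : ∑ a, c a • h a z₀ ∈ nab.horizontal.space z₀ :=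
      Submodule.sum_mem _ fun a _ => Submodule.smul_mem _ _ (hsec a).2.self_of_nhds
    have hV : ∑ a, c a • h a z₀ ∈ verticalSpace I z₀ := by
      rw [D.mem_verticalSpace, ← hc]
      refine (map_sum (ContinuousLinearMap.fst ℝ E (Fin r → ℝ)) _ _).trans
        (Finset.sum_congr rfl fun a _ => ?_)
      refine congrArg (fun u : E => c a • u) ?_
      exact congrArg Prod.fst (chartDeriv_self (I := dualModel I r) z₀ (h a z₀)).symm
    exact Submodule.disjoint_def.1 (nab.isCompl z₀).disjoint _ hV hH
  obtain ⟨B, hB, hBg⟩ := exists_dual_system hg hli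
  have hXq := hX.self_of_nhds
  have hproj : ContMDiffAt (dualModel I r).tangent (dualModel I r) ∞
      (fun ξ : TangentBundle (dualModel I r) D.DualTotal => ξ.proj) ξ₀ :=
    contMDiffAt_proj (TangentSpace (dualModel I r) : D.DualTotal → Type _)
  have hchart : ContMDiffAt (dualModel I r).tangent 𝓘(ℝ, E) ∞
      (fun ξ : TangentBundle (dualModel I r) D.DualTotal =>
        (chartDeriv (dualModel I r) z₀ ξ.proj ξ.2).1) ξ₀ :=
    (ContinuousLinearMap.fst ℝ E (Fin r → ℝ)).contMDiff.contMDiffAt.comp ξ₀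
      (contMDiffAt_chart_snd (v := ξ₀) hsrc)
  have hcoef : ContMDiffAt (dualModel I r).tangent 𝓘(ℝ, Fin (Module.finrank ℝ E) → ℝ) ∞
      (fun ξ : TangentBundle (dualModel I r) D.DualTotal =>
        B ξ.proj (chartDeriv (dualModel I r) z₀ ξ.proj ξ.2).1) ξ₀ :=
    (ContMDiffAt.comp ξ₀ hB hproj).clm_apply hchart
  have hXz : ContMDiffAt (dualModel I r) 𝓘(ℝ, ℝ) ∞ (D.evalSec X) z₀ := D.contMDiffAt_evalSec hXq
  have hhor : ∀ a, ContMDiffAt (dualModel I r).tangent 𝓘(ℝ, ℝ) ∞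
      (fun ξ : TangentBundle (dualModel I r) D.DualTotal =>
        mdiffApply (dualModel I r) (D.evalSec X)
          (⟨ξ.proj, h a ξ.proj⟩ : TangentBundle (dualModel I r) D.DualTotal)) ξ₀ := fun a =>
    ContMDiffAt.comp (g := fun z : D.DualTotal => mdiffApply (dualModel I r) (D.evalSec X)
      (⟨z, h a z⟩ : TangentBundle (dualModel I r) D.DualTotal)) ξ₀
      (ContMDiffAt.comp (g := mdiffApply (dualModel I r) (D.evalSec X))
        (f := fun z => (⟨z, h a z⟩ : TangentBundle (dualModel I r) D.DualTotal)) z₀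
        (contMDiffAt_mdiffApply hXz) (hsec a).1) hproj
  have hfin : ContMDiffAt (dualModel I r).tangent 𝓘(ℝ, ℝ) ∞
      (fun ξ : TangentBundle (dualModel I r) D.DualTotal =>
        mdiffApply (dualModel I r) (D.evalSec X) ξ -
        ∑ a, B ξ.proj (chartDeriv (dualModel I r) z₀ ξ.proj ξ.2).1 a *
          mdiffApply (dualModel I r) (D.evalSec X)
          (⟨ξ.proj, h a ξ.proj⟩ : TangentBundle (dualModel I r) D.DualTotal)) ξ₀ := by
    refine (contMDiffAt_mdiffApply (v := ξ₀) hXz).sub ?_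
    apply ContMDiffAt.sum
    intro a _
    exact (contMDiffAt_pi_space.1 hcoef a).mul (hhor a)
  refine hfin.congr_of_eventuallyEq ?_
  have hpc : ContinuousAt (fun ξ : TangentBundle (dualModel I r) D.DualTotal => ξ.proj) ξ₀ :=
    hproj.continuousAt
  have hpc' := (D.continuous_dualProj.continuousAt (x := z₀)).comp hpc
  filter_upwards [hpc.eventually hBg, hpc'.eventually hX,
    hpc.eventually ((nab.horizontal.isOpen_frameSet z₀).mem_nhds hmem),
    hpc.eventually (extChartAt_source_mem_nhds (I := dualModel I r) z₀)] with ξ h1 h2 h3 h4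
  have h5 := nab.sub_vertical_mem ξ
  rw [← nab.horizontal.span_frame z₀ h3] at h5
  obtain ⟨c, hc⟩ := (Submodule.mem_span_range_iff_exists_fun ℝ).1 h5
  have hcB : B ξ.proj (chartDeriv (dualModel I r) z₀ ξ.proj ξ.2).1 = c := by
    have h6 : (chartDeriv (dualModel I r) z₀ ξ.proj (vLift I ξ.proj (nab.verticalPart ξ))).1 = 0 := by
      refine (D.chartDeriv_dual_fst (ξ := ⟨ξ.proj, vLift I ξ.proj (nab.verticalPart ξ)⟩) h4).trans ?_
      have h7 : (show E from (D.tangentProj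
        (⟨ξ.proj, vLift I ξ.proj (nab.verticalPart ξ)⟩ :
          TangentBundle (dualModel I r) D.DualTotal)).2) = 0 := tangentProj_snd _
      exact (congrArg (chartDeriv I z₀.proj ξ.proj.proj) h7).trans (map_zero _)
    have h8 : (chartDeriv (dualModel I r) z₀ ξ.proj ξ.2).1 = ∑ a, c a • g a ξ.proj := by
      have h9 : ξ.2 = ∑ a, c a • h a ξ.proj + vLift I ξ.proj (nab.verticalPart ξ) :=
        (sub_eq_iff_eq_add.1 hc.symm)
      rw [h9, map_add]
      refine (congrArg₂ (· + ·) ?_ h6).trans (add_zero _)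
      rw [map_sum]
      refine (map_sum (ContinuousLinearMap.fst ℝ E (Fin r → ℝ)) _ _).trans
        (Finset.sum_congr rfl fun a _ => ?_)
      rw [map_smul]
      rfl
    rw [h8, map_sum]
    simp only [map_smul, h1]
    funext a
    simp [Finset.sum_apply, Pi.single_apply]
  rw [hcB]
  have h10 : D.evalSec X ⟨ξ.proj.proj, nab.verticalPart ξ⟩ = _ :=
    (D.mdiffApply_evalSec_vLift (z := ξ.proj) h2 (nab.verticalPart ξ)).symm
  refine h10.trans ?_
  let A : TangentSpace (dualModel I r) ξ.proj →L[ℝ] ℝ :=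
    mfderiv (dualModel I r) 𝓘(ℝ, ℝ) (D.evalSec X) ξ.proj
  have h11 := congrArg A hc
  have h12 : ∑ a, c a * A (h a ξ.proj) = A ξ.2 - A (vLift I ξ.proj (nab.verticalPart ξ)) := by
    rw [← map_sub, ← h11, map_sum]
    refine Finset.sum_congr rfl fun a _ => ?_
    rw [map_smul]
    rfl
  change A (vLift I ξ.proj (nab.verticalPart ξ)) = A ξ.2 - ∑ a, c a * A (h a ξ.proj)
  rw [h12, sub_sub_cancel]

lemma contMDiff_correction :
    ContMDiff (dualModel I r).tangent 𝓘(ℝ, ℝ) ∞ (nab.correction P) := by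
  intro ξ₀
  set q := ξ₀.proj.proj with hq
  have hmem := D.mem_frameSet q
  obtain ⟨Θ, hΘ, -, hΘ'⟩ := D.exists_coframe_of_sections (Fintype.card_fin r)
    (fun i => D.isSectionAt_frame q i hmem) (D.linearIndependent_frame q hmem)
  have hsec : ∀ i, ∀ᶠ x in 𝓝 q, D.IsSectionAt (D.frame q i) x := fun i => by
    filter_upwards [(D.isOpen_frameSet q).mem_nhds hmem] with x hx
    exact D.isSectionAt_frame q i hx
  have hP : ContMDiffAt (dualModel I r).tangent I.tangent ∞
      (fun ξ => (⟨(D.tangentProj ξ).proj, P.proj _ (D.tangentProj ξ).2⟩ : TangentBundle I M)) ξ₀ :=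
    (P.smooth (D.tangentProj ξ₀)).comp ξ₀ (D.contMDiff_tangentProj ξ₀)
  have hc : ContMDiffAt (dualModel I r).tangent 𝓘(ℝ, Fin r → ℝ) ∞
      (fun ξ => Θ (D.tangentProj ξ).proj (P.proj _ (D.tangentProj ξ).2)) ξ₀ :=
    ContMDiffAt.comp (g := fun w : TangentBundle I M => Θ w.proj w.2) ξ₀ (hΘ _ rfl) hP
  have hfin : ContMDiffAt (dualModel I r).tangent 𝓘(ℝ, ℝ) ∞
      (fun ξ => ∑ i, Θ (D.tangentProj ξ).proj (P.proj _ (D.tangentProj ξ).2) i *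
        D.evalSec (D.frame q i) ⟨ξ.proj.proj, nab.verticalPart ξ⟩) ξ₀ := by
    apply ContMDiffAt.sum
    intro i _
    exact (contMDiffAt_pi_space.1 hc i).mul (nab.contMDiffAt_evalSec_verticalPart ξ₀ (hsec i))
  refine hfin.congr_of_eventuallyEq ?_
  have hcont : ContinuousAt (fun ξ : TangentBundle (dualModel I r) D.DualTotal => ξ.proj.proj) ξ₀ :=
    (D.continuous_dualProj.comp (FiberBundle.continuous_proj (E × (Fin r → ℝ))
      (TangentSpace (dualModel I r) : D.DualTotal → Type _))).continuousAt
  filter_upwards [hcont.eventually hΘ', hcont.eventually (eventually_frame_mem (D := D) q)]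
    with ξ h1 h2
  exact D.pair_eq_sum (z := ⟨ξ.proj.proj, nab.verticalPart ξ⟩) h2 (P.toSpace (D.tangentProj ξ)) _
    (h1 _ (P.toSpace (D.tangentProj ξ)).2)

lemma contMDiff_extendedLagrangian {L : TangentBundle I M → ℝ}
    (hL : ContMDiff I.tangent 𝓘(ℝ, ℝ) ∞ L) :
    ContMDiff (dualModel I r).tangent 𝓘(ℝ, ℝ) ∞ (nab.extendedLagrangian P L) :=
  (hL.comp D.contMDiff_tangentProj).add (nab.contMDiff_correction P)

end ExtendedLagrangian
end EhresmannConnection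

/-! ### The two-form of the extended Lagrangian along the zero section -/

section Hessian

variable {E : Type*} [NormedAddCommGroup E] [NormedSpace ℝ E]
  {E' : Type*} [NormedAddCommGroup E'] [NormedSpace ℝ E']

lemma fderiv_fderiv_comp_clm {f : E' → ℝ} {A : E →L[ℝ] E'} {y : E} (hf : ContDiffAt ℝ ∞ f (A y))
    (w w' : E) : fderiv ℝ (fderiv ℝ (f ∘ A)) y w w' =
      fderiv ℝ (fderiv ℝ f) (A y) (A w) (A w') := by
  have h1 : fderiv ℝ (f ∘ A) =ᶠ[𝓝 y] fun y' => (fderiv ℝ f (A y')).comp A := by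
    have h2 : ∀ᶠ p in 𝓝 (A y), DifferentiableAt ℝ f p := by
      filter_upwards [(hf.of_le two_le_infty).eventually (by simp)] with p hp
      exact hp.differentiableAt (by simp)
    filter_upwards [A.continuous.continuousAt.eventually h2] with y' hy'
    rw [fderiv_comp y' hy' A.differentiableAt, A.fderiv]
  have h3 : HasFDerivAt (fun y' => fderiv ℝ f (A y')) ((fderiv ℝ (fderiv ℝ f) (A y)).comp A) y :=
    (((hf.fderiv_right (m := ∞) (by simp)).differentiableAt (by simp)).hasFDerivAt).comp y
      A.hasFDerivAt
  have h4 := (((ContinuousLinearMap.compL ℝ E E' ℝ).flip A).hasFDerivAt).comp y h3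
  have h5 : HasFDerivAt (fderiv ℝ (f ∘ A)) _ y := h4.congr_of_eventuallyEq h1
  rw [h5.fderiv]
  rfl

/-- If the derivative of `f` in the direction `V` is `c + t m` along a line, the mixed second
derivative is `m`. -/
lemma fderiv_fderiv_of_line {f : E → ℝ} {y W V : E} (hf : ContDiffAt ℝ ∞ f y) {c m : ℝ}
    (h : ∀ t : ℝ, fderiv ℝ f (y + t • W) V = c + t * m) :
    fderiv ℝ (fderiv ℝ f) y W V = m := by
  have h1 : HasFDerivAt (fderiv ℝ f) (fderiv ℝ (fderiv ℝ f) y) (y + (0 : ℝ) • W) := by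
    rw [zero_smul, add_zero]
    exact ((hf.fderiv_right (m := ∞) (by simp)).differentiableAt (by simp)).hasFDerivAt
  have h2 : HasDerivAt (fun t : ℝ => y + t • W) ((1 : ℝ) • W) 0 :=
    ((hasDerivAt_id 0).smul_const W).const_add y
  have h3 := h1.comp_hasDerivAt 0 h2
  have h4 := h3.clm_apply (hasDerivAt_const 0 V)
  have h5 : HasDerivAt (fun t : ℝ => c + t * m) (1 * m) 0 :=
    ((hasDerivAt_id 0).mul_const m).const_add c
  have h6 : (fun t : ℝ => (fderiv ℝ f ∘ fun t : ℝ => y + t • W) t V) = fun t => c + t * m :=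
    funext h
  rw [h6] at h4
  have h7 := h4.unique h5
  simpa using h7

lemma fderiv_of_line {f : E → ℝ} {y V : E} (hf : DifferentiableAt ℝ f y) {c m : ℝ}
    (h : ∀ t : ℝ, f (y + t • V) = c + t * m) : fderiv ℝ f y V = m := by
  have h1 : HasFDerivAt f (fderiv ℝ f y) (y + (0 : ℝ) • V) := by
    rw [zero_smul, add_zero]
    exact hf.hasFDerivAt
  have h2 : HasDerivAt (fun t : ℝ => y + t • V) ((1 : ℝ) • V) 0 :=
    ((hasDerivAt_id 0).smul_const V).const_add y
  have h3 := h1.comp_hasDerivAt 0 h2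
  have h5 : HasDerivAt (fun t : ℝ => c + t * m) (1 * m) 0 :=
    ((hasDerivAt_id 0).mul_const m).const_add c
  have h6 : (f ∘ fun t : ℝ => y + t • V) = fun t => c + t * m := funext h
  rw [h6] at h3
  have h7 := h3.unique h5
  simpa using h7

end Hessian

section FormAt

variable {E : Type*} [NormedAddCommGroup E] [NormedSpace ℝ E] [FiniteDimensional ℝ E]
  {H : Type*} [TopologicalSpace H] {I : ModelWithCorners ℝ E H} [I.Boundaryless]
  {M : Type*} [TopologicalSpace M] [ChartedSpace H M] [IsManifold I ∞ M]

/-- The Hessian of a Lagrangian in a preferred chart. -/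
def chartHessian (L : TangentBundle I M → ℝ) (ξ : TangentBundle I M) :
    E × E →L[ℝ] E × E →L[ℝ] ℝ :=
  fderiv ℝ (fderiv ℝ (readInChart L ξ)) (extChartAt I.tangent ξ ξ)

/-- The Lagrangian two-form on the components of tangent vectors. -/
def lagrangianFormAt (L : TangentBundle I M → ℝ) (ξ : TangentBundle I M) (w w' : E × E) : ℝ :=
  lagrangianForm L ξ ![w, w']

variable {L : TangentBundle I M → ℝ}

lemma lagrangianFormAt_eq (hL : ContMDiff I.tangent 𝓘(ℝ, ℝ) ∞ L) (ξ : TangentBundle I M)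
    (w w' : E × E) : lagrangianFormAt L ξ w w' =
      chartHessian L ξ w' (0, w.1) - chartHessian L ξ w (0, w'.1) :=
  lagrangianForm_apply hL ξ w w'

lemma chartHessian_symm (hL : ContMDiff I.tangent 𝓘(ℝ, ℝ) ∞ L) (ξ : TangentBundle I M)
    (w w' : E × E) : chartHessian L ξ w w' = chartHessian L ξ w' w :=
  ((contDiffAt_readInChart hL (mem_extChartAt_target ξ)).of_le two_le_infty).isSymmSndFDerivAt
    (by simp) w w'

lemma lagrangianFormAt_add (hL : ContMDiff I.tangent 𝓘(ℝ, ℝ) ∞ L) (ξ : TangentBundle I M)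
    (w₁ w₂ w' : E × E) : lagrangianFormAt L ξ (w₁ + w₂) w' =
      lagrangianFormAt L ξ w₁ w' + lagrangianFormAt L ξ w₂ w' := by
  have h : ((0, (w₁ + w₂).1) : E × E) = (0, w₁.1) + (0, w₂.1) := by simp
  rw [lagrangianFormAt_eq hL, lagrangianFormAt_eq hL, lagrangianFormAt_eq hL, h, map_add, map_add,
    add_apply]
  ring

lemma lagrangianFormAt_swap (hL : ContMDiff I.tangent 𝓘(ℝ, ℝ) ∞ L) (ξ : TangentBundle I M)
    (w w' : E × E) : lagrangianFormAt L ξ w w' = -lagrangianFormAt L ξ w' w := by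
  rw [lagrangianFormAt_eq hL, lagrangianFormAt_eq hL]
  ring

lemma mem_ker_lagrangianForm {ξ : TangentBundle I M} {w : E × E} :
    (show TangentSpace I.tangent ξ from w) ∈ DiffForm.ker (lagrangianForm L) ξ ↔
      ∀ u, lagrangianFormAt L ξ w u = 0 := Iff.rfl

end FormAt

namespace RegularDistribution

section LiftSpace

variable {E : Type*} [NormedAddCommGroup E] [NormedSpace ℝ E] [FiniteDimensional ℝ E]
  {H : Type*} [TopologicalSpace H] {I : ModelWithCorners ℝ E H} [I.Boundaryless]
  {M : Type*} [TopologicalSpace M] [ChartedSpace H M] [IsManifold I ∞ M] {r : ℕ}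
  {D : RegularDistribution I M r}
  {K : RegularDistribution I.tangent (TangentBundle I M) (2 * r)}

lemma exists_sum_frame {q : M} {e : TangentSpace I q} (he : e ∈ D.space q) :
    ∃ c : Fin r → ℝ, ∑ i, c i • D.frame q i q = e := by
  rw [← D.span_frame q (D.mem_frameSet q)] at he
  exact (Submodule.mem_span_range_iff_exists_fun ℝ).1 he

lemma exists_sum_liftFrame (hlift : ∀ v, K.space v = D.liftSpace v) {v : TangentBundle I M}
    {w : E × E} (hw : (show TangentSpace I.tangent v from w) ∈ K.space v) :
    ∃ c d : Fin r → ℝ, w.1 = ∑ i, c i • (show E from D.frame v.proj i v.proj) ∧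
      w.2 = ∑ i, c i • (show E × E from completeLift (D.frame v.proj i) v).2 +
        ∑ i, d i • (show E from D.frame v.proj i v.proj) := by
  rw [← span_liftFrame hlift v.proj (D.mem_frameSet v.proj)] at hw
  obtain ⟨c, hc⟩ := (Submodule.mem_span_range_iff_exists_fun ℝ).1 hw
  rw [Fintype.sum_sum_type] at hc
  have hc' : w = ∑ i, c (Sum.inl i) • (show E × E from D.liftFrame v.proj (Sum.inl i) v) +
      ∑ i, c (Sum.inr i) • (show E × E from D.liftFrame v.proj (Sum.inr i) v) := hc.symm
  refine ⟨fun i => c (Sum.inl i), fun i => c (Sum.inr i), ?_, ?_⟩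
  · rw [hc', Prod.fst_add, Prod.fst_sum, Prod.fst_sum]
    refine (congrArg₂ (· + ·) rfl (Finset.sum_eq_zero fun i _ => ?_)).trans (add_zero _)
    exact smul_zero (c (Sum.inr i))
  · rw [hc', Prod.snd_add, Prod.snd_sum, Prod.snd_sum]
    refine congrArg₂ (· + ·) rfl (Finset.sum_congr rfl fun i _ => ?_)
    exact congrArg (fun u : E => c (Sum.inr i) • u)
      (congrArg Prod.snd (vLift_tangent v (D.frame v.proj i v.proj)))

lemma sum_frame_mem (q : M) (c : Fin r → ℝ) :
    (show TangentSpace I q from ∑ i, c i • (show E from D.frame q i q)) ∈ D.space q :=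
  Submodule.sum_mem (D.space q) fun i _ => Submodule.smul_mem _ _
    (D.isSectionAt_frame q i (D.mem_frameSet q)).2.self_of_nhds

lemma fst_mem_of_mem_lift (hlift : ∀ v, K.space v = D.liftSpace v) {v : TangentBundle I M}
    {w : E × E} (hw : (show TangentSpace I.tangent v from w) ∈ K.space v) :
    (show TangentSpace I v.proj from w.1) ∈ D.space v.proj := by
  obtain ⟨c, d, h1, -⟩ := exists_sum_liftFrame hlift hw
  rw [h1]
  exact sum_frame_mem v.proj c

lemma snd_mem_of_mem_lift (hlift : ∀ v, K.space v = D.liftSpace v) {v : TangentBundle I M}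
    {w : E × E} (hw : (show TangentSpace I.tangent v from w) ∈ K.space v) (hw0 : w.1 = 0) :
    (show TangentSpace I v.proj from w.2) ∈ D.space v.proj := by
  obtain ⟨c, d, h1, h2⟩ := exists_sum_liftFrame hlift hw
  have hc := Fintype.linearIndependent_iff.1
    (D.linearIndependent_frame v.proj (D.mem_frameSet v.proj)) c (h1.symm.trans hw0)
  rw [h2]
  simp only [hc, zero_smul, Finset.sum_const_zero, zero_add]
  exact sum_frame_mem v.proj d

lemma vertical_mem_lift (hlift : ∀ v, K.space v = D.liftSpace v) {v : TangentBundle I M}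
    {e : E} (he : (show TangentSpace I v.proj from e) ∈ D.space v.proj) :
    (show TangentSpace I.tangent v from ((0, e) : E × E)) ∈ K.space v := by
  obtain ⟨c, hc⟩ := exists_sum_frame he
  have h1 : (show TangentSpace I.tangent v from ((0, e) : E × E)) =
      ∑ i, c i • D.liftFrame v.proj (Sum.inr i) v := by
    refine (vLift_tangent v e).symm.trans ?_
    refine (congrArg (vLift I v) hc.symm).trans ?_
    refine (map_sum (vLift I v) _ _).trans (Finset.sum_congr rfl fun i _ => ?_)
    exact map_smul (vLift I v) _ _
  rw [h1]
  exact Submodule.sum_mem _ fun i _ => Submodule.smul_mem _ _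
    (liftFrame_mem hlift v.proj (D.mem_frameSet v.proj) _)

lemma exists_mem_lift (hlift : ∀ v, K.space v = D.liftSpace v) {v : TangentBundle I M}
    {e : E} (he : (show TangentSpace I v.proj from e) ∈ D.space v.proj) :
    ∃ b : E, (show TangentSpace I.tangent v from ((e, b) : E × E)) ∈ K.space v := by
  obtain ⟨c, hc⟩ := exists_sum_frame he
  let w : E × E := ∑ i, c i • (show E × E from D.liftFrame v.proj (Sum.inl i) v)
  have hw : (show TangentSpace I.tangent v from w) ∈ K.space v :=
    Submodule.sum_mem (K.space v) fun i _ => Submodule.smul_mem _ _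
      (liftFrame_mem hlift v.proj (D.mem_frameSet v.proj) _)
  have h1 : w.1 = e := by
    simp only [w]
    rw [Prod.fst_sum]
    exact hc
  refine ⟨w.2, ?_⟩
  rw [← h1]
  exact hw

end LiftSpace

end RegularDistribution

namespace RegularDistribution

section ZeroSectionCharts

variable {E : Type*} [NormedAddCommGroup E] [NormedSpace ℝ E] [FiniteDimensional ℝ E]
  {H : Type*} [TopologicalSpace H] {I : ModelWithCorners ℝ E H} [I.Boundaryless]
  {M : Type*} [TopologicalSpace M] [ChartedSpace H M] [IsManifold I ∞ M] {r : ℕ}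
  (D : RegularDistribution I M r)

lemma extChartAt_dualTotal_fibre {z₀ z : D.DualTotal} (h : z₀.proj = z.proj) :
    extChartAt (dualModel I r) z₀ z =
      (extChartAt I z.proj z.proj, fibreCoord (Fin r → ℝ) D.Dual z.proj z.2) := by
  rw [D.extChartAt_dualTotal (h ▸ D.mem_frameSet z.proj), h]
  refine Prod.ext rfl (funext fun i => ?_)
  refine (D.trivializationAt_snd_apply z.proj (D.mem_frameSet z.proj) i).symm.trans ?_
  simp [fibreCoord]

/-- Tangent vectors of the dual over a fixed point, in a preferred chart over that point. -/
lemma tangent_extChartAt_dual {ξ₀ ξ : TangentBundle (dualModel I r) D.DualTotal}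
    (h : ξ₀.proj.proj = ξ.proj.proj) :
    extChartAt (dualModel I r).tangent ξ₀ ξ = (((extChartAt I ξ.proj.proj ξ.proj.proj,
      fibreCoord (Fin r → ℝ) D.Dual ξ.proj.proj ξ.proj.2), ξ.2) :
        (E × (Fin r → ℝ)) × (E × (Fin r → ℝ))) := by
  have h1 : extChartAt (dualModel I r) ξ₀.proj = extChartAt (dualModel I r) ξ.proj := by
    rw [FiberBundle.extChartAt, FiberBundle.extChartAt, h]
  have hsrc : ξ.proj ∈ (extChartAt (dualModel I r) ξ₀.proj).source := by
    rw [h1]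
    exact mem_extChartAt_source _
  rw [tangent_extChartAt_apply hsrc]
  refine Prod.ext (D.extChartAt_dualTotal_fibre h) ?_
  have h2 : chartDeriv (dualModel I r) ξ₀.proj ξ.proj ξ.2 = ξ.2 := by
    rw [chartDeriv, h1]
    exact chartDeriv_self ξ.proj ξ.2
  exact h2

/-- The inclusion of the components of tangent vectors to the zero section. -/
def zeroIncl (E : Type*) [NormedAddCommGroup E] [NormedSpace ℝ E] (r : ℕ) :
    E × E →L[ℝ] (E × (Fin r → ℝ)) × (E × (Fin r → ℝ)) :=
  (ContinuousLinearMap.inl ℝ E (Fin r → ℝ)).prodMap (ContinuousLinearMap.inl ℝ E (Fin r → ℝ))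

lemma zeroIncl_apply (w : E × E) : zeroIncl E r w = ((w.1, 0), (w.2, 0)) := rfl

lemma extChartAt_tangentZero {v₀ v : TangentBundle I M} (h1 : v.proj ∈ D.frameSet v₀.proj)
    (h2 : v.proj ∈ (extChartAt I v₀.proj).source) :
    extChartAt (dualModel I r).tangent (D.tangentZero v₀) (D.tangentZero v) =
      zeroIncl E r (extChartAt I.tangent v₀ v) := by
  refine extChartAt_tangentMap_of_linear_in_charts (f := zeroSection (Fin r → ℝ) D.Dual)
    (η₀ := D.tangentZero v₀) (D.hasMFDerivAt_dualZero v.proj).mdifferentiableAt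
    (ContinuousLinearMap.inl ℝ E (Fin r → ℝ)) h2
    (D.mem_extChartAt_source_dualTotal.2 ⟨h1, h2⟩) ?_
  filter_upwards [(D.isOpen_frameSet v₀.proj).mem_nhds h1] with x hx
  refine (D.extChartAt_dualTotal (z₀ := (D.tangentZero v₀).proj)
    (z := zeroSection (Fin r → ℝ) D.Dual x) hx).trans ?_
  exact Prod.ext rfl (funext fun i => D.evalSec_zero)

lemma eventually_extChartAt_tangentZero (v₀ : TangentBundle I M) :
    ∀ᶠ v in 𝓝 v₀, extChartAt (dualModel I r).tangent (D.tangentZero v₀) (D.tangentZero v) =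
      zeroIncl E r (extChartAt I.tangent v₀ v) := by
  have hcont := (FiberBundle.continuous_proj E (TangentSpace I : M → Type _)).continuousAt (x := v₀)
  filter_upwards [hcont.eventually ((D.isOpen_frameSet v₀.proj).mem_nhds (D.mem_frameSet v₀.proj)),
    hcont.eventually (extChartAt_source_mem_nhds (I := I) v₀.proj)] with v h1 h2
  exact D.extChartAt_tangentZero h1 h2

lemma hasMFDerivAt_tangentZero (v : TangentBundle I M) :
    HasMFDerivAt I.tangent (dualModel I r).tangent D.tangentZero v (zeroIncl E r) :=
  hasMFDerivAt_of_linear_in_charts (D.contMDiff_tangentZero v).continuousAt _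
    (D.eventually_extChartAt_tangentZero v)

lemma isEmbedding_tangentZero : IsEmbedding (D.tangentZero) :=
  Function.LeftInverse.isEmbedding D.tangentProj_tangentZero D.contMDiff_tangentProj.continuous
    D.contMDiff_tangentZero.continuous

lemma isClosed_range_tangentZero : IsClosed (range D.tangentZero) := by
  rw [← isOpen_compl_iff, isOpen_iff_mem_nhds]
  intro ξ₁ hξ₁
  set q := ξ₁.proj.proj with hq
  let v₀ : TangentBundle I M := ⟨q, 0⟩
  let e := extChartAt (dualModel I r).tangent (D.tangentZero v₀)
  have hsrc1 : ξ₁.proj ∈ (extChartAt (dualModel I r) (D.tangentZero v₀).proj).source :=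
    D.mem_extChartAt_source_dualTotal.2 ⟨D.mem_frameSet q, mem_extChartAt_source q⟩
  have hsrc : ξ₁ ∈ e.source := mem_tangent_extChartAt_source.2 hsrc1
  let g : TangentBundle (dualModel I r) D.DualTotal → (Fin r → ℝ) × (Fin r → ℝ) :=
    fun ξ => ((e ξ).1.2, (e ξ).2.2)
  have hg : ContinuousAt g ξ₁ := by
    have h1 : ContinuousAt e ξ₁ := continuousAt_extChartAt' hsrc
    exact (continuous_snd.continuousAt.comp (continuous_fst.continuousAt.comp h1)).prodMk
      (continuous_snd.continuousAt.comp (continuous_snd.continuousAt.comp h1))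
  have hne : g ξ₁ ≠ 0 := by
    intro h0
    apply hξ₁
    refine ⟨D.tangentProj ξ₁, ?_⟩
    have hsrc2 : D.tangentZero (D.tangentProj ξ₁) ∈ e.source :=
      mem_tangent_extChartAt_source.2
        (D.mem_extChartAt_source_dualTotal.2 ⟨D.mem_frameSet q, mem_extChartAt_source q⟩)
    refine e.injOn hsrc2 hsrc ?_
    refine (D.extChartAt_tangentZero (v₀ := v₀) (v := D.tangentProj ξ₁) (D.mem_frameSet q)
      (mem_extChartAt_source q)).trans ?_
    have h2 : e ξ₁ = _ := tangent_extChartAt_apply (ξ₀ := D.tangentZero v₀) hsrc1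
    have h3 := D.extChartAt_dualTotal (z₀ := (D.tangentZero v₀).proj) (z := ξ₁.proj)
      (D.mem_frameSet q)
    have h4 := D.chartDeriv_dual_fst (z₀ := (D.tangentZero v₀).proj) hsrc1
    refine (congrArg (zeroIncl E r) (tangent_extChartAt_apply (ξ₀ := v₀) (ξ := D.tangentProj ξ₁)
      (mem_extChartAt_source q))).trans ?_
    refine Prod.ext (Prod.ext ?_ ?_) (Prod.ext ?_ ?_)
    · exact ((congrArg (fun p => p.1.1) h2).trans (congrArg Prod.fst h3)).symm
    · exact (congrArg Prod.fst h0).symm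
    · exact ((congrArg (fun p => p.2.1) h2).trans h4).symm
    · exact (congrArg Prod.snd h0).symm
  have hcont : ContinuousAt (fun ξ : TangentBundle (dualModel I r) D.DualTotal => ξ.proj.proj) ξ₁ :=
    (D.continuous_dualProj.comp (FiberBundle.continuous_proj (E × (Fin r → ℝ))
      (TangentSpace (dualModel I r) : D.DualTotal → Type _))).continuousAt
  filter_upwards [hg.eventually_ne hne, hcont.eventually ((D.isOpen_frameSet q).mem_nhds
    (D.mem_frameSet q)), hcont.eventually (extChartAt_source_mem_nhds (I := I) q)] with ξ h1 h2 h3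
  rintro ⟨v, rfl⟩
  apply h1
  have h4 : e (D.tangentZero v) = _ := D.extChartAt_tangentZero (v₀ := v₀) (v := v) h2 h3
  simp only [g]
  rw [h4]
  rfl

/-- Components of tangent vectors of the dual: those tangent to the zero section, and the others. -/
def zeroInclEquiv (E : Type*) [NormedAddCommGroup E] [NormedSpace ℝ E] (r : ℕ) :
    ((E × E) × ((Fin r → ℝ) × (Fin r → ℝ))) ≃L[ℝ] (E × (Fin r → ℝ)) × (E × (Fin r → ℝ)) :=
  ContinuousLinearEquiv.prodProdProdComm ℝ E E (Fin r → ℝ) (Fin r → ℝ)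

lemma isImmersionAt_tangentZero (v : TangentBundle I M) :
    Manifold.IsImmersionAtOfComplement ((Fin r → ℝ) × (Fin r → ℝ)) I.tangent
      (dualModel I r).tangent ∞ D.tangentZero v := by
  let U : Set (TangentBundle I M) := π E (TangentSpace I : M → Type _) ⁻¹' D.frameSet v.proj
  have hU : IsOpen U := (D.isOpen_frameSet v.proj).preimage
    (FiberBundle.continuous_proj E (TangentSpace I : M → Type _))
  have hUv : v ∈ U := D.mem_frameSet v.proj
  refine Manifold.IsImmersionAtOfComplement.mk_of_continuousAt
    (D.contMDiff_tangentZero v).continuousAt (zeroInclEquiv E r)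
    ((chartAt (ModelProd H E) v).restr U) (chartAt _ (D.tangentZero v)) ?_
    (mem_chart_source _ _) ?_ (IsManifold.chart_mem_maximalAtlas _) ?_
  · rw [OpenPartialHomeomorph.restr_source, hU.interior_eq]
    exact ⟨mem_chart_source _ _, hUv⟩
  · exact restr_mem_maximalAtlas _ (IsManifold.chart_mem_maximalAtlas v) hU
  · intro y hy
    have hy1 : y ∈ (extChartAt I.tangent v).target ∧ (extChartAt I.tangent v).symm y ∈ U := by
      have h0 := PartialEquiv.map_target _ hy
      have h1 := PartialEquiv.right_inv _ hy
      rw [OpenPartialHomeomorph.extend_source, OpenPartialHomeomorph.restr_source,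
        hU.interior_eq] at h0
      refine ⟨?_, h0.2⟩
      rw [← h1]
      exact (extChartAt I.tangent v).map_source (by rw [extChartAt_source]; exact h0.1)
    have h1 := (extChartAt I.tangent v).map_target hy1.1
    have h2 := D.extChartAt_tangentZero hy1.2 (mem_tangent_extChartAt_source.1 h1)
    refine Eq.trans h2 ?_
    rw [(extChartAt I.tangent v).right_inv hy1.1]
    rfl

lemma isSmoothEmbedding_tangentZero :
    Manifold.IsSmoothEmbedding I.tangent (dualModel I r).tangent ∞ D.tangentZero :=
  ⟨Manifold.IsImmersionOfComplement.isImmersion fun v => D.isImmersionAt_tangentZero v,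
    D.isEmbedding_tangentZero⟩

end ZeroSectionCharts
end RegularDistribution

namespace EhresmannConnection

section Coisotropic

open RegularDistribution

variable {E : Type*} [NormedAddCommGroup E] [NormedSpace ℝ E] [FiniteDimensional ℝ E]
  {H : Type*} [TopologicalSpace H] {I : ModelWithCorners ℝ E H} [I.Boundaryless]
  {M : Type*} [TopologicalSpace M] [ChartedSpace H M] [IsManifold I ∞ M] {r : ℕ}
  {D : RegularDistribution I M r}
  {K : RegularDistribution I.tangent (TangentBundle I M) (2 * r)}
  (nab : EhresmannConnection D) (P : AlmostProduct D) {L : TangentBundle I M → ℝ}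

/-- The pairing of fibre coordinates with the projection of a tangent vector to the
distribution. -/
def fibrePairing (q : M) (η : Fin r → ℝ) (b : E) : ℝ :=
  D.pair ((fibreCoord (Fin r → ℝ) D.Dual q).symm η) (P.toSpace (⟨q, b⟩ : TangentBundle I M))

lemma fibrePairing_add_smul (q : M) (η : Fin r → ℝ) (a b : E) (t : ℝ) :
    fibrePairing P q η (a + t • b) = fibrePairing P q η a + t * fibrePairing P q η b := by
  have h : P.toSpace (⟨q, a + t • b⟩ : TangentBundle I M) =
      P.toSpace (⟨q, a⟩ : TangentBundle I M) + t • P.toSpace (⟨q, b⟩ : TangentBundle I M) := by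
    apply Subtype.ext
    refine (map_add (P.proj q) _ _).trans ?_
    exact congrArg₂ (· + ·) rfl (map_smul (P.proj q) t _)
  rw [fibrePairing, h, map_add, map_smul]
  rfl

lemma fibrePairing_smul_left (q : M) (t : ℝ) (η : Fin r → ℝ) (b : E) :
    fibrePairing P q (t • η) b = t * fibrePairing P q η b := by
  rw [fibrePairing, map_smul, pair_smul]
  rfl

lemma almostProduct_proj_of_mem {q : M} {e : TangentSpace I q} (he : e ∈ D.space q) :
    P.proj q e = e := by
  rw [← P.range_eq] at he
  obtain ⟨u, rfl⟩ := he
  exact P.idem q u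

lemma eq_zero_of_fibrePairing_left {q : M} {η : Fin r → ℝ}
    (h : ∀ e : E, (show TangentSpace I q from e) ∈ D.space q → fibrePairing P q η e = 0) :
    η = 0 := by
  have h1 : (fibreCoord (Fin r → ℝ) D.Dual q).symm η = 0 := by
    apply ContinuousLinearMap.ext (M₁ := D.space q)
    rintro ⟨e, he⟩
    have h2 : P.toSpace (⟨q, e⟩ : TangentBundle I M) = ⟨e, he⟩ :=
      Subtype.ext (almostProduct_proj_of_mem P he)
    have h3 : D.pair ((fibreCoord (Fin r → ℝ) D.Dual q).symm η)
      (P.toSpace (⟨q, e⟩ : TangentBundle I M)) = 0 := h e he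
    rw [h2] at h3
    exact h3
  have h2 := congrArg (fibreCoord (Fin r → ℝ) D.Dual q) h1
  rwa [ContinuousLinearEquiv.apply_symm_apply, map_zero] at h2

lemma eq_zero_of_fibrePairing_right {q : M} {e : E}
    (he : (show TangentSpace I q from e) ∈ D.space q) (h : ∀ η, fibrePairing P q η e = 0) :
    e = 0 := by
  have h2 : P.toSpace (⟨q, e⟩ : TangentBundle I M) = ⟨e, he⟩ :=
    Subtype.ext (almostProduct_proj_of_mem P he)
  have hq := D.mem_frameSet q
  have h3 : (D.frameBasis q hq).equivFun ⟨e, he⟩ = 0 := by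
    funext i
    have := D.finiteDimensional_space q
    let μ : D.Dual q := LinearMap.toContinuousLinearMap (E := D.space q) (F' := ℝ)
      ((D.frameBasis q hq).coord i)
    have h4 := h (fibreCoord (Fin r → ℝ) D.Dual q μ)
    rw [fibrePairing, h2, ContinuousLinearEquiv.symm_apply_apply] at h4
    exact h4
  have h5 : (⟨e, he⟩ : D.space q) = 0 := by
    simpa using h3
  exact congrArg Subtype.val h5

lemma readInChart_extChartAt {L' : TangentBundle I M → ℝ} {ξ₀ ξ : TangentBundle I M}
    (h : ξ.proj ∈ (extChartAt I ξ₀.proj).source) :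
    readInChart L' ξ₀ (extChartAt I.tangent ξ₀ ξ) = L' ξ := by
  rw [readInChart, Function.comp_apply,
    (extChartAt I.tangent ξ₀).left_inv (mem_tangent_extChartAt_source.2 h)]

/-- The vertical derivative of the extended Lagrangian at vectors over a fixed point. -/
lemma fderiv_readInChart_vertical (hL : ContMDiff I.tangent 𝓘(ℝ, ℝ) ∞ L)
    {ξ₀ ξ : TangentBundle (dualModel I r) D.DualTotal} (h : ξ₀.proj.proj = ξ.proj.proj)
    (η : Fin r → ℝ) :
    fderiv ℝ (readInChart (nab.extendedLagrangian P L) ξ₀)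
      (extChartAt (dualModel I r).tangent ξ₀ ξ) (0, (0, η)) =
      fibrePairing P ξ.proj.proj η (show E × (Fin r → ℝ) from ξ.2).1 := by
  have hsrc : ∀ ξ' : TangentBundle (dualModel I r) D.DualTotal, ξ₀.proj.proj = ξ'.proj.proj →
      ξ'.proj ∈ (extChartAt (dualModel I r) ξ₀.proj).source := fun ξ' h' =>
    D.mem_extChartAt_source_dualTotal.2
      ⟨by rw [← h']; exact D.mem_frameSet _, by rw [← h']; exact mem_extChartAt_source _⟩
  have hmem : extChartAt (dualModel I r).tangent ξ₀ ξ ∈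
      (extChartAt (dualModel I r).tangent ξ₀).target :=
    (extChartAt (dualModel I r).tangent ξ₀).map_source
      (mem_tangent_extChartAt_source.2 (hsrc ξ h))
  refine fderiv_of_line (c := nab.extendedLagrangian P L ξ)
    ((contDiffAt_readInChart (nab.contMDiff_extendedLagrangian P hL) hmem).differentiableAt
      (by simp)) fun t => ?_
  let η' : D.Dual ξ.proj.proj := (fibreCoord (Fin r → ℝ) D.Dual ξ.proj.proj).symm (t • η)
  let ξ' : TangentBundle (dualModel I r) D.DualTotal := ⟨ξ.proj, ξ.2 + vLift I ξ.proj η'⟩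
  have h1 : extChartAt (dualModel I r).tangent ξ₀ ξ + t • ((0, (0, η)) :
      (E × (Fin r → ℝ)) × (E × (Fin r → ℝ))) = extChartAt (dualModel I r).tangent ξ₀ ξ' := by
    rw [D.tangent_extChartAt_dual h, D.tangent_extChartAt_dual (ξ := ξ') h]
    refine Prod.ext ?_ ?_
    · exact (congrArg₂ (· + ·) rfl (smul_zero t)).trans (add_zero _)
    · refine congrArg (fun u : E × (Fin r → ℝ) => (show E × (Fin r → ℝ) from ξ.2) + u) ?_
      refine Prod.ext (smul_zero t) ?_
      exact ((fibreCoord (Fin r → ℝ) D.Dual ξ.proj.proj).apply_symm_apply (t • η)).symm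
  rw [h1, readInChart_extChartAt (hsrc ξ' h)]
  refine (nab.extendedLagrangian_add_vLift P L ξ η').trans ?_
  refine congrArg (fun u : ℝ => nab.extendedLagrangian P L ξ + u) ?_
  rw [← fibrePairing_smul_left]
  exact pair_toSpace_congr P η' (tangentProj_snd ξ)

/-- The mixed second derivatives of the extended Lagrangian in vertical directions. -/
lemma chartHessian_vertical (hL : ContMDiff I.tangent 𝓘(ℝ, ℝ) ∞ L)
    (ξ₀ : TangentBundle (dualModel I r) D.DualTotal) (μ : Fin r → ℝ) (w : E × (Fin r → ℝ))
    (η : Fin r → ℝ) :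
    chartHessian (nab.extendedLagrangian P L) ξ₀ ((0, μ), w) (0, (0, η)) =
      fibrePairing P ξ₀.proj.proj η w.1 := by
  refine fderiv_fderiv_of_line
    (c := fibrePairing P ξ₀.proj.proj η (show E × (Fin r → ℝ) from ξ₀.2).1)
    (contDiffAt_readInChart (nab.contMDiff_extendedLagrangian P hL) (mem_extChartAt_target ξ₀))
    fun t => ?_
  let μ' : D.Dual ξ₀.proj.proj := (fibreCoord (Fin r → ℝ) D.Dual ξ₀.proj.proj).symm μ
  let ξ : TangentBundle (dualModel I r) D.DualTotal :=
    ⟨⟨ξ₀.proj.proj, ξ₀.proj.2 + t • μ'⟩,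
      (show E × (Fin r → ℝ) from (show E × (Fin r → ℝ) from ξ₀.2) + t • w)⟩
  have h1 : extChartAt (dualModel I r).tangent ξ₀ ξ₀ + t • ((((0, μ) : E × (Fin r → ℝ)), w) :
      (E × (Fin r → ℝ)) × (E × (Fin r → ℝ))) = extChartAt (dualModel I r).tangent ξ₀ ξ := by
    refine (congrArg₂ (· + ·) (D.tangent_extChartAt_dual rfl) rfl).trans
      (Eq.trans ?_ (D.tangent_extChartAt_dual (ξ₀ := ξ₀) (ξ := ξ) rfl).symm)
    refine Prod.ext (Prod.ext ?_ ?_) rfl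
    · exact (congrArg₂ (· + ·) rfl (smul_zero t)).trans (add_zero _)
    · have h2 : fibreCoord (Fin r → ℝ) D.Dual ξ₀.proj.proj (ξ₀.proj.2 + t • μ') =
          fibreCoord (Fin r → ℝ) D.Dual ξ₀.proj.proj ξ₀.proj.2 + t • μ := by
        rw [map_add, map_smul, ContinuousLinearEquiv.apply_symm_apply]
      exact h2.symm
  rw [h1, nab.fderiv_readInChart_vertical P hL (ξ₀ := ξ₀) (ξ := ξ) rfl]
  exact fibrePairing_add_smul P ξ₀.proj.proj η _ w.1 t

variable {nab}

/-- The second derivatives of the extended Lagrangian along the zero section. -/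
lemma chartHessian_zeroIncl (hnab : nab.TrivialAlongZero) (hL : ContMDiff I.tangent 𝓘(ℝ, ℝ) ∞ L)
    (v : TangentBundle I M) (w w' : E × E) :
    chartHessian (nab.extendedLagrangian P L) (D.tangentZero v) (zeroIncl E r w) (zeroIncl E r w') =
      chartHessian L v w w' := by
  have h0 := (D.eventually_extChartAt_tangentZero v).self_of_nhds
  have h1 : readInChart L v =ᶠ[𝓝 (extChartAt I.tangent v v)]
      readInChart (nab.extendedLagrangian P L) (D.tangentZero v) ∘ zeroIncl E r := by
    have hc : ContinuousAt (fun y => ((extChartAt I.tangent v).symm y).proj)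
        (extChartAt I.tangent v v) := by
      refine ContinuousAt.comp (g := fun u : TangentBundle I M => u.proj)
        (FiberBundle.continuous_proj E (TangentSpace I : M → Type _)).continuousAt
        (continuousAt_extChartAt_symm v)
    have hv : ((extChartAt I.tangent v).symm (extChartAt I.tangent v v)).proj = v.proj := by
      rw [extChartAt_to_inv]
    have hfr : D.frameSet v.proj ∈
        𝓝 ((extChartAt I.tangent v).symm (extChartAt I.tangent v v)).proj := by
      rw [hv]
      exact (D.isOpen_frameSet v.proj).mem_nhds (D.mem_frameSet v.proj)
    have h2 := hc.eventually hfr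
    filter_upwards [h2, extChartAt_target_mem_nhds (I := I.tangent) v] with y hy hy'
    have hsrc := mem_tangent_extChartAt_source.1 ((extChartAt I.tangent v).map_target hy')
    have h3 := D.extChartAt_tangentZero hy hsrc
    rw [(extChartAt I.tangent v).right_inv hy'] at h3
    rw [Function.comp_apply, ← h3]
    have hyf : ((extChartAt I.tangent v).symm y).proj ∈ D.frameSet v.proj := hy
    refine Eq.trans ?_ (readInChart_extChartAt (ξ₀ := D.tangentZero v)
      (ξ := D.tangentZero ((extChartAt I.tangent v).symm y))
      (D.mem_extChartAt_source_dualTotal.2 ⟨hyf, hsrc⟩)).symm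
    rw [extendedLagrangian_tangentZero P hnab]
    rfl
  have h4 : ContDiffAt ℝ ∞ (readInChart (nab.extendedLagrangian P L) (D.tangentZero v))
      (zeroIncl E r (extChartAt I.tangent v v)) := by
    rw [← h0]
    exact contDiffAt_readInChart (nab.contMDiff_extendedLagrangian P hL) (mem_extChartAt_target _)
  rw [chartHessian, chartHessian, h0, ← fderiv_fderiv_comp_clm h4, h1.fderiv.fderiv_eq]

lemma lagrangianFormAt_zeroIncl (hnab : nab.TrivialAlongZero)
    (hL : ContMDiff I.tangent 𝓘(ℝ, ℝ) ∞ L) (v : TangentBundle I M) (w w' : E × E) :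
    lagrangianFormAt (nab.extendedLagrangian P L) (D.tangentZero v) (zeroIncl E r w)
      (zeroIncl E r w') = lagrangianFormAt L v w w' := by
  have h : ∀ a : E, ((0, (a, 0)) : (E × (Fin r → ℝ)) × (E × (Fin r → ℝ))) =
      zeroIncl E r (0, a) := fun a => rfl
  rw [lagrangianFormAt_eq hL, lagrangianFormAt_eq (nab.contMDiff_extendedLagrangian P hL),
    zeroIncl_apply, zeroIncl_apply, h, h]
  exact congrArg₂ (· - ·) (chartHessian_zeroIncl P hnab hL v w' (0, w.1))
    (chartHessian_zeroIncl P hnab hL v w (0, w'.1))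

variable (nab)

lemma lagrangianFormAt_vertical_zeroIncl (hL : ContMDiff I.tangent 𝓘(ℝ, ℝ) ∞ L)
    (ξ₀ : TangentBundle (dualModel I r) D.DualTotal) (η ν : Fin r → ℝ) (b : E) :
    lagrangianFormAt (nab.extendedLagrangian P L) ξ₀ ((0, η), (0, ν)) (zeroIncl E r (0, b)) =
      fibrePairing P ξ₀.proj.proj η b := by
  rw [lagrangianFormAt_eq (nab.contMDiff_extendedLagrangian P hL), zeroIncl_apply]
  refine (congrArg₂ (· - ·) (nab.chartHessian_vertical P hL ξ₀ 0 (b, 0) η)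
    (map_zero _)).trans (sub_zero _)

lemma lagrangianFormAt_apply_vertical (hL : ContMDiff I.tangent 𝓘(ℝ, ℝ) ∞ L)
    (ξ₀ : TangentBundle (dualModel I r) D.DualTotal)
    (w : (E × (Fin r → ℝ)) × (E × (Fin r → ℝ))) (ν : Fin r → ℝ) :
    lagrangianFormAt (nab.extendedLagrangian P L) ξ₀ w (0, (0, ν)) =
      fibrePairing P ξ₀.proj.proj ν w.1.1 := by
  have hL' := nab.contMDiff_extendedLagrangian P hL
  rw [lagrangianFormAt_eq hL', chartHessian_symm hL']
  refine (congrArg₂ (· - ·) (nab.chartHessian_vertical P hL ξ₀ 0 w.1 ν)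
    (map_zero _)).trans (sub_zero _)

variable {nab}

/-- Vectors orthogonal to the zero section are tangent to it. -/
lemma eq_zero_of_orthogonal (hker : ∀ v, K.space v = DiffForm.ker (lagrangianForm L) v)
    (hlift : ∀ v, K.space v = D.liftSpace v) (hnab : nab.TrivialAlongZero)
    (hL : ContMDiff I.tangent 𝓘(ℝ, ℝ) ∞ L) (v : TangentBundle I M)
    {w : (E × (Fin r → ℝ)) × (E × (Fin r → ℝ))}
    (hw : ∀ u, lagrangianFormAt (nab.extendedLagrangian P L) (D.tangentZero v) w
      (zeroIncl E r u) = 0) : w = zeroIncl E r (w.1.1, w.2.1) := by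
  have hL' := nab.contMDiff_extendedLagrangian P hL
  have hdec : w = zeroIncl E r (w.1.1, w.2.1) + ((0, w.1.2), (0, w.2.2)) := by
    rw [zeroIncl_apply]
    ext <;> simp
  have hform : ∀ u, lagrangianFormAt L v (w.1.1, w.2.1) u +
      lagrangianFormAt (nab.extendedLagrangian P L) (D.tangentZero v) ((0, w.1.2), (0, w.2.2))
        (zeroIncl E r u) = 0 := fun u => by
    rw [← lagrangianFormAt_zeroIncl P hnab hL, ← lagrangianFormAt_add hL', ← hdec, hw]
  have hK : ∀ u : E × E, (show TangentSpace I.tangent v from u) ∈ K.space v →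
      ∀ u', lagrangianFormAt L v u' u = 0 := fun u hu u' => by
    rw [hker] at hu
    rw [lagrangianFormAt_swap hL, mem_ker_lagrangianForm.1 hu, neg_zero]
  have h1 : w.1.2 = 0 := by
    refine eq_zero_of_fibrePairing_left P (q := v.proj) fun e he => ?_
    have h2 := hform (0, e)
    rw [hK _ (vertical_mem_lift hlift he), zero_add,
      nab.lagrangianFormAt_vertical_zeroIncl P hL] at h2
    exact h2
  have h3 : w.2.2 = 0 := by
    refine eq_zero_of_fibrePairing_left P (q := v.proj) fun e he => ?_
    obtain ⟨b, hb⟩ := exists_mem_lift hlift he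
    have h2 := hform (e, b)
    rw [hK _ hb, zero_add, h1, lagrangianFormAt_swap hL'] at h2
    have h4 := nab.lagrangianFormAt_apply_vertical P hL (D.tangentZero v) (zeroIncl E r (e, b)) w.2.2
    exact h4.symm.trans (neg_eq_zero.1 h2)
  rw [zeroIncl_apply]
  exact Prod.ext (Prod.ext rfl h1) (Prod.ext rfl h3)

lemma ker_lagrangianForm_tangentZero (hker : ∀ v, K.space v = DiffForm.ker (lagrangianForm L) v)
    (hlift : ∀ v, K.space v = D.liftSpace v) (hnab : nab.TrivialAlongZero)
    (hL : ContMDiff I.tangent 𝓘(ℝ, ℝ) ∞ L) (v : TangentBundle I M) :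
    DiffForm.ker (lagrangianForm (nab.extendedLagrangian P L)) (D.tangentZero v) = ⊥ := by
  have hL' := nab.contMDiff_extendedLagrangian P hL
  rw [Submodule.eq_bot_iff]
  intro w' hw'
  let w : (E × (Fin r → ℝ)) × (E × (Fin r → ℝ)) := w'
  have hw : ∀ u, lagrangianFormAt (nab.extendedLagrangian P L) (D.tangentZero v) w u = 0 := hw'
  have hdec := eq_zero_of_orthogonal P hker hlift hnab hL v fun u => hw (zeroIncl E r u)
  have hwK : (show TangentSpace I.tangent v from ((w.1.1, w.2.1) : E × E)) ∈ K.space v := by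
    rw [hker]
    refine mem_ker_lagrangianForm.2 fun u => ?_
    rw [← lagrangianFormAt_zeroIncl P hnab hL, ← hdec]
    exact hw _
  have h1 : w.1.1 = 0 := by
    refine eq_zero_of_fibrePairing_right P (q := v.proj) (fst_mem_of_mem_lift hlift hwK) fun η => ?_
    exact (nab.lagrangianFormAt_apply_vertical P hL (D.tangentZero v) w η).symm.trans (hw _)
  have h2 : w.2.1 = 0 := by
    refine eq_zero_of_fibrePairing_right P (q := v.proj)
      (snd_mem_of_mem_lift hlift hwK h1) fun η => ?_
    have h3 := hw ((0, η), (0, 0))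
    rw [lagrangianFormAt_swap hL', neg_eq_zero, hdec, h1] at h3
    exact (nab.lagrangianFormAt_vertical_zeroIncl P hL (D.tangentZero v) η 0 w.2.1).symm.trans h3
  have h3 : w = 0 := by
    rw [hdec, h1, h2]
    rfl
  exact h3

lemma isCoisotropicEmbedding (hker : ∀ v, K.space v = DiffForm.ker (lagrangianForm L) v)
    (hlift : ∀ v, K.space v = D.liftSpace v) (hnab : nab.TrivialAlongZero)
    (hL : ContMDiff I.tangent 𝓘(ℝ, ℝ) ∞ L) :
    DiffForm.IsCoisotropicEmbedding D.tangentZero (lagrangianForm L)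
      (lagrangianForm (nab.extendedLagrangian P L)) where
  isSmoothEmbedding := D.isSmoothEmbedding_tangentZero
  isClosed_range := D.isClosed_range_tangentZero
  exists_symplectic := by
    have hL' := nab.contMDiff_extendedLagrangian P hL
    refine ⟨{ξ | DiffForm.ker (lagrangianForm (nab.extendedLagrangian P L)) ξ = ⊥},
      DiffForm.isOpen_setOf_ker_eq_bot (smoothOn_lagrangianForm hL'), ?_,
      (smoothOn_lagrangianForm hL').mono (subset_univ _), fun ξ _ => d_lagrangianForm hL' ξ,
      fun ξ hξ => hξ⟩
    rintro _ ⟨v, rfl⟩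
    exact ker_lagrangianForm_tangentZero P hker hlift hnab hL v
  pullback_eq := by
    funext v
    ext w
    have h1 : mfderiv I.tangent (dualModel I r).tangent D.tangentZero v = zeroIncl E r :=
      (D.hasMFDerivAt_tangentZero v).mfderiv
    have h2 : ∀ w : Fin 2 → E × E, w = ![w 0, w 1] := fun w => by
      funext i
      fin_cases i <;> rfl
    have h3 : (fun i => (mfderiv I.tangent (dualModel I r).tangent D.tangentZero v (w i) :
        TangentSpace (dualModel I r).tangent (D.tangentZero v))) =
        ![zeroIncl E r (w 0), zeroIncl E r (w 1)] := by
      rw [h1]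
      funext i
      fin_cases i <;> rfl
    change lagrangianForm (nab.extendedLagrangian P L) (D.tangentZero v)
      (fun i => mfderiv I.tangent (dualModel I r).tangent D.tangentZero v (w i)) = _
    rw [h3]
    refine (lagrangianFormAt_zeroIncl P hnab hL v (w 0) (w 1)).trans ?_
    exact congrArg (lagrangianForm L v) (h2 w).symm
  coisotropic := by
    intro v w hw
    have h1 : mfderiv I.tangent (dualModel I r).tangent D.tangentZero v = zeroIncl E r :=
      (D.hasMFDerivAt_tangentZero v).mfderiv
    rw [h1] at hw ⊢
    have h2 := eq_zero_of_orthogonal P hker hlift hnab hL v (w := w) hw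
    exact ⟨(((show (E × (Fin r → ℝ)) × (E × (Fin r → ℝ)) from w).1.1,
      (show (E × (Fin r → ℝ)) × (E × (Fin r → ℝ)) from w).2.1) : E × E), h2.symm⟩

end Coisotropic
end EhresmannConnection

end

theorem mainTheorem1 {E : Type*} [NormedAddCommGroup E] [NormedSpace ℝ E] [FiniteDimensional ℝ E]
    {H : Type*} [TopologicalSpace H] (I : ModelWithCorners ℝ E H) [I.Boundaryless]
    {Q : Type*} [TopologicalSpace Q] [ChartedSpace H Q] [IsManifold I ∞ Q]
    (L : TangentBundle I Q → ℝ) (hL : ContMDiff I.tangent 𝓘(ℝ, ℝ) ∞ L)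
    (hsing : IsSingular L) (hcons : IsConsistent L)
    {r : ℕ} (D : RegularDistribution I Q r)
    (K : RegularDistribution I.tangent (TangentBundle I Q) (2 * r))
    (hker : ∀ v, K.space v = DiffForm.ker (lagrangianForm L) v)
    (hlift : ∀ v, K.space v = D.liftSpace v)
    (nab : EhresmannConnection D) (hnab : nab.TrivialAlongZero) (P : AlmostProduct D) :
    -- the extended Lagrangian is globally defined and smooth, and restricts to `L` on `TQ`
    ContMDiff (RegularDistribution.dualModel I r).tangent 𝓘(ℝ, ℝ) ∞
        (nab.extendedLagrangian P L) ∧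
    (∀ v, nab.extendedLagrangian P L (D.tangentZero v) = L v) ∧
    -- `T(D*)` is diffeomorphic to the thickening `K*` by the foliated Tulczyjew map, which carries
    -- the embedding of `TQ` into `T(D*)` to the zero section of `K*`
    (∃ α : Diffeomorph (RegularDistribution.dualModel I r).tangent
          (RegularDistribution.dualModel I.tangent (2 * r))
          (TangentBundle (RegularDistribution.dualModel I r) D.DualTotal) K.DualTotal ∞,
        D.IsTulczyjew K α ∧
        ∀ v, α (D.tangentZero v) = Bundle.zeroSection (Fin (2 * r) → ℝ) K.Dual v) ∧
    -- the two-form of the extended Lagrangian is symplectic near `TQ`, and `TQ` is coisotropic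
    DiffForm.IsCoisotropicEmbedding D.tangentZero (lagrangianForm L)
      (lagrangianForm (nab.extendedLagrangian P L)) :=
  ⟨nab.contMDiff_extendedLagrangian P hL,
    EhresmannConnection.extendedLagrangian_tangentZero P hnab L,
    ⟨RegularDistribution.tulczyjewDiffeomorph hlift,
      RegularDistribution.isTulczyjew_tulczyjew hlift,
      RegularDistribution.tulczyjew_tangentZero hlift⟩,
    EhresmannConnection.isCoisotropicEmbedding P hker hlift hnab hL⟩
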